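/- For finite sets $S,T$ of points in the plane, a many-to-many matching between $S$ and $T$ is a set $M\subseteq S\times T$ such that every $p\in S$ is the first component of some pair in $M$ and every $q\in T$ is the second component of some pair in $M$; its cost is $\sum_{(p,q)\in M}\lVert p-q\rVert_2$. A nearest-neighbor pairing is a set $M=\{(u,f(u)):u\in S\}\cup\{(g(v),v):v\in T\}$, where $f(u)$ is a point of $T$ nearest to $u$ and $g(v)$ is a point of $S$ nearest to $v$ (ties broken arbitrarily). (i) Every nearest-neighbor pairing $M$ of $S$ and $T$ is a many-to-many matching, and its cost is at most twice the cost of every many-to-many matching between $S$ and $T$, hence at most twice the minimum cost. (ii) There is a deterministic algorithm that, given arbitrary non-empty finite sets $S,T\subset\mathbb{R}^2$ with $n=|S|+|T|$ (as lists of the coordinates of their points, in any order), outputs a list of the pairs of a nearest-neighbor pairing of $S$ and $T$, without repetition, in $O(n\log n)$ time. The model of computation is the real RAM: exact real arithmetic ($+,-,\times,/$) and comparisons at unit cost, no rounding of reals to integers, and indirect addressing with integers of $O(\log n)$ bits, on which $+,-,\times$, integer division and comparisons also take unit time. In particular, minimum-cost many-to-many matching in the plane has a 2-approximation algorithm that runs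 in $O(n\log n)$ time. -/

import Mathlib

/-! ### Many-to-many matchings of planar point sets -/

/-- The Euclidean plane. -/
abbrev Plane : Type := EuclideanSpace ℝ (Fin 2)

/-- A many-to-many matching between `S` and `T`: a set of pairs in `S × T` such that every point
of `S` occurs as a first component and every point of `T` occurs as a second component. -/
def IsManyToManyMatching (S T : Finset Plane) (M : Finset (Plane × Plane)) : Prop :=
  M ⊆ S ×ˢ T ∧ (∀ p ∈ S, ∃ q, (p, q) ∈ M) ∧ (∀ q ∈ T, ∃ p, (p, q) ∈ M)

/-- The cost of a set of pairs: the sum of the Euclidean distances of its pairs. -/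
noncomputable def matchingCost (M : Finset (Plane × Plane)) : ℝ :=
  ∑ e ∈ M, dist e.1 e.2

/-- `q` is a nearest point of `A` to `p`. -/
def IsNearest (A : Finset Plane) (p q : Plane) : Prop :=
  q ∈ A ∧ ∀ r ∈ A, dist p q ≤ dist p r

/-- `M` arises by pairing every point of `S` with a nearest neighbor `f u` in `T` and every point
of `T` with a nearest neighbor `g v` in `S` (ties being broken arbitrarily). -/
def IsNearestNeighborPairing (S T : Finset Plane) (M : Finset (Plane × Plane)) : Prop :=
  ∃ f g : Plane → Plane,
    (∀ u ∈ S, IsNearest T u (f u)) ∧ (∀ v ∈ T, IsNearest S v (g v)) ∧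
    ∀ u v : Plane, (u, v) ∈ M ↔ (u ∈ S ∧ v = f u) ∨ (v ∈ T ∧ u = g v)

/-! ### The real RAM

Memory consists of arrays of natural numbers ("words") and arrays of exact real numbers, with
indirect addressing.  A program names only finitely many arrays, so they can be interleaved in a
single memory at the price of a constant factor.  All operations below have unit cost.  Words are
bounded by a number `W`: a program that computes a word `≥ W`, or divides by zero, is stuck.  There
is no conversion from reals to words (no floor function), and real literals are integers. -/

namespace RealRAM

/-- Memory: `s.nat a i` and `s.real a i` are the contents of cell `i` of the `a`-th word array
and of the `a`-th real array. -/
structure State where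
  nat : ℕ → ℕ → ℕ
  real : ℕ → ℕ → ℝ

/-- Word expressions; `get a i` reads cell `i` of word array `a`. -/
inductive NExp where
  | const (c : ℕ)
  | get (a : ℕ) (i : NExp)
  | add (e₁ e₂ : NExp)
  | sub (e₁ e₂ : NExp)
  | mul (e₁ e₂ : NExp)
  | div (e₁ e₂ : NExp)

/-- Real expressions; `get a i` reads cell `i` of real array `a`. -/
inductive RExp where
  | const (c : ℤ)
  | get (a : ℕ) (i : NExp)
  | add (e₁ e₂ : RExp)
  | sub (e₁ e₂ : RExp)
  | mul (e₁ e₂ : RExp)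
  | div (e₁ e₂ : RExp)

/-- Tests. -/
inductive BExp where
  | natLt (e₁ e₂ : NExp)
  | realLt (e₁ e₂ : RExp)
  | not (b : BExp)
  | and (b₁ b₂ : BExp)

/-- Value of a word expression (truncated subtraction, integer division). -/
def NExp.val (s : State) : NExp → ℕ
  | .const c => c
  | .get a i => s.nat a (i.val s)
  | .add e₁ e₂ => e₁.val s + e₂.val s
  | .sub e₁ e₂ => e₁.val s - e₂.val s
  | .mul e₁ e₂ => e₁.val s * e₂.val s
  | .div e₁ e₂ => e₁.val s / e₂.val s

/-- The evaluation involves no word `≥ W` and no division by zero. -/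
def NExp.Ok (W : ℕ) (s : State) : NExp → Prop
  | .const c => c < W
  | .get a i => i.Ok W s ∧ s.nat a (i.val s) < W
  | .add e₁ e₂ => e₁.Ok W s ∧ e₂.Ok W s ∧ e₁.val s + e₂.val s < W
  | .sub e₁ e₂ => e₁.Ok W s ∧ e₂.Ok W s
  | .mul e₁ e₂ => e₁.Ok W s ∧ e₂.Ok W s ∧ e₁.val s * e₂.val s < W
  | .div e₁ e₂ => e₁.Ok W s ∧ e₂.Ok W s ∧ e₂.val s ≠ 0

/-- Number of elementary operations of an evaluation. -/
def NExp.cost : NExp → ℕ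
  | .const _ => 1
  | .get _ i => i.cost + 1
  | .add e₁ e₂ => e₁.cost + e₂.cost + 1
  | .sub e₁ e₂ => e₁.cost + e₂.cost + 1
  | .mul e₁ e₂ => e₁.cost + e₂.cost + 1
  | .div e₁ e₂ => e₁.cost + e₂.cost + 1

/-- Value of a real expression (exact real arithmetic). -/
noncomputable def RExp.val (s : State) : RExp → ℝ
  | .const c => (c : ℝ)
  | .get a i => s.real a (i.val s)
  | .add e₁ e₂ => e₁.val s + e₂.val s
  | .sub e₁ e₂ => e₁.val s - e₂.val s
  | .mul e₁ e₂ => e₁.val s * e₂.val s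
  | .div e₁ e₂ => e₁.val s / e₂.val s

/-- The evaluation involves no word `≥ W` and no division by zero. -/
def RExp.Ok (W : ℕ) (s : State) : RExp → Prop
  | .const _ => True
  | .get _ i => i.Ok W s
  | .add e₁ e₂ => e₁.Ok W s ∧ e₂.Ok W s
  | .sub e₁ e₂ => e₁.Ok W s ∧ e₂.Ok W s
  | .mul e₁ e₂ => e₁.Ok W s ∧ e₂.Ok W s
  | .div e₁ e₂ => e₁.Ok W s ∧ e₂.Ok W s ∧ e₂.val s ≠ 0

/-- Number of elementary operations of an evaluation. -/
def RExp.cost : RExp → ℕ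
  | .const _ => 1
  | .get _ i => i.cost + 1
  | .add e₁ e₂ => e₁.cost + e₂.cost + 1
  | .sub e₁ e₂ => e₁.cost + e₂.cost + 1
  | .mul e₁ e₂ => e₁.cost + e₂.cost + 1
  | .div e₁ e₂ => e₁.cost + e₂.cost + 1

/-- The test holds. -/
def BExp.Holds (s : State) : BExp → Prop
  | .natLt e₁ e₂ => e₁.val s < e₂.val s
  | .realLt e₁ e₂ => e₁.val s < e₂.val s
  | .not b => ¬ b.Holds s
  | .and b₁ b₂ => b₁.Holds s ∧ b₂.Holds s

/-- The evaluation involves no word `≥ W` and no division by zero. -/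
def BExp.Ok (W : ℕ) (s : State) : BExp → Prop
  | .natLt e₁ e₂ => e₁.Ok W s ∧ e₂.Ok W s
  | .realLt e₁ e₂ => e₁.Ok W s ∧ e₂.Ok W s
  | .not b => b.Ok W s
  | .and b₁ b₂ => b₁.Ok W s ∧ b₂.Ok W s

/-- Number of elementary operations of a test. -/
def BExp.cost : BExp → ℕ
  | .natLt e₁ e₂ => e₁.cost + e₂.cost + 1
  | .realLt e₁ e₂ => e₁.cost + e₂.cost + 1
  | .not b => b.cost + 1
  | .and b₁ b₂ => b₁.cost + b₂.cost + 1

/-- Commands; `call k` runs the `k`-th procedure of the program (memory is global). -/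
inductive Cmd where
  | skip
  | setNat (a : ℕ) (i e : NExp)
  | setReal (a : ℕ) (i : NExp) (e : RExp)
  | seq (c₁ c₂ : Cmd)
  | ite (b : BExp) (c₁ c₂ : Cmd)
  | while (b : BExp) (c : Cmd)
  | call (k : ℕ)

/-- A program: a main command and a finite list of (possibly recursive) procedures. -/
structure Program where
  main : Cmd
  procs : List Cmd

/-- Overwrite cell `i` of word array `a`. -/
def State.setNat (s : State) (a i v : ℕ) : State :=
  { s with nat := Function.update s.nat a (Function.update (s.nat a) i v) }

/-- Overwrite cell `i` of real array `a`. -/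
noncomputable def State.setReal (s : State) (a i : ℕ) (v : ℝ) : State :=
  { s with real := Function.update s.real a (Function.update (s.real a) i v) }

/-- `Exec procs W c s t s'`: with word bound `W`, the command `c` started in memory `s` halts after
exactly `t` elementary steps in memory `s'`. -/
inductive Exec (procs : List Cmd) (W : ℕ) : Cmd → State → ℕ → State → Prop where
  | skip (s : State) : Exec procs W .skip s 1 s
  | setNat (s : State) (a : ℕ) (i e : NExp) (hi : i.Ok W s) (he : e.Ok W s) :
      Exec procs W (.setNat a i e) s (i.cost + e.cost + 1) (s.setNat a (i.val s) (e.val s))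
  | setReal (s : State) (a : ℕ) (i : NExp) (e : RExp) (hi : i.Ok W s) (he : e.Ok W s) :
      Exec procs W (.setReal a i e) s (i.cost + e.cost + 1) (s.setReal a (i.val s) (e.val s))
  | seq {c₁ c₂ : Cmd} {s s₁ s₂ : State} {t₁ t₂ : ℕ}
      (h₁ : Exec procs W c₁ s t₁ s₁) (h₂ : Exec procs W c₂ s₁ t₂ s₂) :
      Exec procs W (.seq c₁ c₂) s (t₁ + t₂) s₂
  | iteTrue {b : BExp} {c₁ c₂ : Cmd} {s s' : State} {t : ℕ} (hb : b.Ok W s) (h : b.Holds s)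
      (h₁ : Exec procs W c₁ s t s') : Exec procs W (.ite b c₁ c₂) s (b.cost + 1 + t) s'
  | iteFalse {b : BExp} {c₁ c₂ : Cmd} {s s' : State} {t : ℕ} (hb : b.Ok W s) (h : ¬ b.Holds s)
      (h₂ : Exec procs W c₂ s t s') : Exec procs W (.ite b c₁ c₂) s (b.cost + 1 + t) s'
  | whileTrue {b : BExp} {c : Cmd} {s s₁ s₂ : State} {t₁ t₂ : ℕ} (hb : b.Ok W s)
      (h : b.Holds s) (h₁ : Exec procs W c s t₁ s₁) (h₂ : Exec procs W (.while b c) s₁ t₂ s₂) :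
      Exec procs W (.while b c) s (b.cost + 1 + t₁ + t₂) s₂
  | whileFalse {b : BExp} {c : Cmd} {s : State} (hb : b.Ok W s) (h : ¬ b.Holds s) :
      Exec procs W (.while b c) s (b.cost + 1) s
  | call {k : ℕ} {c : Cmd} {s s' : State} {t : ℕ} (hk : procs[k]? = some c)
      (h : Exec procs W c s t s') : Exec procs W (.call k) s (t + 1) s'

/-- With word bound `W`, the program started in memory `s` halts after exactly `t` elementary
steps in memory `s'`. -/
def Program.HaltsIn (P : Program) (W : ℕ) (s : State) (t : ℕ) (s' : State) : Prop :=
  Exec P.procs W P.main s t s'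

/-- Initial memory for the points `x 0, …, x (a - 1)` and `y 0, …, y (b - 1)`: cells `0` and `1` of
word array `0` hold `a` and `b`; real arrays `0` and `1` hold the first and second coordinates of
the points `x i`, real arrays `2` and `3` those of the points `y j`; all other cells are zero. -/
noncomputable def input {a b : ℕ} (x : Fin a → Plane) (y : Fin b → Plane) : State where
  nat k i := if k = 0 ∧ i = 0 then a else if k = 0 ∧ i = 1 then b else 0
  real k i :=
    if k = 0 then (if h : i < a then x ⟨i, h⟩ 0 else 0)
    else if k = 1 then (if h : i < a then x ⟨i, h⟩ 1 else 0)
    else if k = 2 then (if h : i < b then y ⟨i, h⟩ 0 else 0)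
    else if k = 3 then (if h : i < b then y ⟨i, h⟩ 1 else 0)
    else 0

/-- The final memory `s` lists every pair of `M` exactly once, and nothing else: cell `0` of word
array `0` holds the number of pairs, and the `k`-th pair is `(x i, y j)`, where `i` and `j` are the
contents of cell `k` of word arrays `1` and `2`. -/
def IsOutput {a b : ℕ} (x : Fin a → Plane) (y : Fin b → Plane) (s : State)
    (M : Finset (Plane × Plane)) : Prop :=
  ∃ L : List (Fin a × Fin b),
    s.nat 0 0 = L.length ∧
    (∀ (k : ℕ) (h : k < L.length), s.nat 1 k = (L[k].1 : ℕ) ∧ s.nat 2 k = (L[k].2 : ℕ)) ∧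
    ((L.map fun e => (x e.1, y e.2) : List (Plane × Plane)) : Multiset (Plane × Plane)) = M.val

end RealRAM

/-!
For (i), fix any many-to-many matching `M'`.  Every point `u` of `S` occurs in a pair of `M'`, which
is at least as long as the distance from `u` to its nearest neighbor; different points get different
pairs, so the nearest-neighbor pairs of the points of `S` cost together at most as much as `M'`.
The same holds for `T`, whence the factor two (`sum_le_matchingCost`, `matchingCost_le`).

For (ii), it suffices to find the nearest site of each of many query points, where the sites are one
of the two sets and the query points are the other.  A horizontal line sweeps upwards and finds, for
every query point, the nearest one among the sites below it; a second sweep with negated second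
coordinates deals with the sites above it, and the nearer one of the two results is the answer
(`nearestSites_spec`).

The restriction of the Voronoi diagram of the sites below the sweep line to that line is a sequence
of intervals, ordered like the first coordinates of their sites.  A site is *active* as long as it
may own an interval.  Let `a`, `b`, `c` be active sites that are consecutive by first coordinate.
Among these three, `b` owns an interval at height `t` if and only if `gap X Y a b c t` is positive.
This is an affine function of `t`, positive at the height of `b` (`gap_self_pos`).  Hence once it is
negative above `b`, it remains so, and `b` can be discarded for good (`Sweep.Inv.remove`).  This
happens at the second coordinate `death X Y a b c` of the circumcenter if the three sites make a
left turn, and never otherwise.  Before a query at height `t` is answered, active sites are removed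
until no three consecutive ones have a negative gap.  Then the distance from a point on the sweep line to
the active sites first decreases and then increases along their sequence, so a comparison of two
neighboring sites tells which half contains a nearest one (`exists_nearest_append`): the query is a
binary search.

The active sites are stored at the leaves of a complete binary tree, at the rank of the first
coordinate; sites with the same first coordinate share a leaf, where the higher one replaces the
lower one (`Sweep.Inv.insert`).  Every node keeps the first two and the last two active sites below
it and the earliest death among triples of consecutive sites below it.  These data can be computed
from those of the two children (`deaths_append`), so a change at a leaf costs logarithmic time
(`updatePath_spec`).  Sorting uses the same kind of tree, as a tournament.  Each site is inserted
once, removed at most once, and each query is answered once, which gives `O(n log n)` steps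
(`sweepStep_spec`, with the potential `Sweep.potential`).

Ties need no care: `b` is removed only if its gap is negative, and then at every point of the sweep
line one of its two neighbors is at least as near, while a vanishing gap does not disturb the binary
search.  So no general position is assumed.  The constants in the bounds for the running time are generous.
-/

namespace RealRAM

/-! ### Reasoning about programs -/

@[simp] theorem State.setNat_nat (s : State) (a i v b j : ℕ) :
    (s.setNat a i v).nat b j = if b = a ∧ j = i then v else s.nat b j := by
  unfold State.setNat
  by_cases hb : b = a
  · subst hb
    by_cases hj : j = i <;> simp [hj]
  · simp [hb]

@[simp] theorem State.setNat_real (s : State) (a i v : ℕ) : (s.setNat a i v).real = s.real := rfl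

@[simp] theorem State.setReal_nat (s : State) (a i : ℕ) (v : ℝ) :
    (s.setReal a i v).nat = s.nat := rfl

@[simp] theorem State.setReal_real (s : State) (a i : ℕ) (v : ℝ) (b j : ℕ) :
    (s.setReal a i v).real b j = if b = a ∧ j = i then v else s.real b j := by
  unfold State.setReal
  by_cases hb : b = a
  · subst hb
    by_cases hj : j = i <;> simp [hj]
  · simp [hb]

/-- The command `c` contains an assignment to word array `a` (a call may write anything). -/
def Cmd.WritesNat (a : ℕ) : Cmd → Prop
  | .skip => False
  | .setNat b _ _ => a = b
  | .setReal _ _ _ => False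
  | .seq c₁ c₂ => c₁.WritesNat a ∨ c₂.WritesNat a
  | .ite _ c₁ c₂ => c₁.WritesNat a ∨ c₂.WritesNat a
  | .while _ c => c.WritesNat a
  | .call _ => True

/-- The command `c` contains an assignment to real array `a` (a call may write anything). -/
def Cmd.WritesReal (a : ℕ) : Cmd → Prop
  | .skip => False
  | .setNat _ _ _ => False
  | .setReal b _ _ => a = b
  | .seq c₁ c₂ => c₁.WritesReal a ∨ c₂.WritesReal a
  | .ite _ c₁ c₂ => c₁.WritesReal a ∨ c₂.WritesReal a
  | .while _ c => c.WritesReal a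
  | .call _ => True

/-- The memories `s` and `s'` agree on all arrays to which `c` contains no assignment. -/
structure Frame (c : Cmd) (s s' : State) : Prop where
  nat : ∀ a, ¬ c.WritesNat a → s'.nat a = s.nat a
  real : ∀ a, ¬ c.WritesReal a → s'.real a = s.real a

theorem Frame.refl (c : Cmd) (s : State) : Frame c s s := ⟨fun _ _ => rfl, fun _ _ => rfl⟩

theorem Frame.trans {c : Cmd} {s₁ s₂ s₃ : State} (h : Frame c s₁ s₂) (h' : Frame c s₂ s₃) :
    Frame c s₁ s₃ :=
  ⟨fun a ha => (h'.nat a ha).trans (h.nat a ha), fun a ha => (h'.real a ha).trans (h.real a ha)⟩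

/-- An execution changes only the arrays to which the command contains an assignment. -/
theorem Exec.frame {procs : List Cmd} {W : ℕ} {c : Cmd} {s s' : State} {t : ℕ}
    (h : Exec procs W c s t s') : Frame c s s' := by
  induction h with
  | skip s => exact Frame.refl _ _
  | setNat s a i e _ _ =>
    refine ⟨fun b hb => ?_, fun _ _ => rfl⟩
    funext j
    have : b ≠ a := hb
    simp [this]
  | setReal s a i e _ _ =>
    refine ⟨fun _ _ => rfl, fun b hb => ?_⟩
    funext j
    have : b ≠ a := hb
    simp [this]
  | seq _ _ ih₁ ih₂ =>
    refine ⟨fun a ha => ?_, fun a ha => ?_⟩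
    · rw [ih₂.nat a fun h => ha (Or.inr h), ih₁.nat a fun h => ha (Or.inl h)]
    · rw [ih₂.real a fun h => ha (Or.inr h), ih₁.real a fun h => ha (Or.inl h)]
  | iteTrue _ _ _ ih =>
    exact ⟨fun a ha => ih.nat a fun h => ha (Or.inl h),
      fun a ha => ih.real a fun h => ha (Or.inl h)⟩
  | iteFalse _ _ _ ih =>
    exact ⟨fun a ha => ih.nat a fun h => ha (Or.inr h),
      fun a ha => ih.real a fun h => ha (Or.inr h)⟩
  | whileTrue _ _ _ _ ih₁ ih₂ =>
    refine ⟨fun a ha => ?_, fun a ha => ?_⟩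
    · rw [ih₂.nat a ha, ih₁.nat a ha]
    · rw [ih₂.real a ha, ih₁.real a ha]
  | whileFalse _ _ => exact Frame.refl _ _
  | call _ _ _ => exact ⟨fun a ha => absurd trivial ha, fun a ha => absurd trivial ha⟩

/-- Total correctness with running time: `c`, started in `s` with word bound `W` and without
procedures, halts after some number `t` of steps in some memory `s'` such that `Q t s'`. -/
def Ex (W : ℕ) (c : Cmd) (s : State) (Q : ℕ → State → Prop) : Prop :=
  ∃ t s', Exec [] W c s t s' ∧ Q t s'

variable {W : ℕ}

theorem Ex.mono {c : Cmd} {s : State} {Q Q' : ℕ → State → Prop} (h : Ex W c s Q)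
    (hQ : ∀ t s', Frame c s s' → Q t s' → Q' t s') : Ex W c s Q' := by
  obtain ⟨t, s', he, hq⟩ := h
  exact ⟨t, s', he, hQ t s' he.frame hq⟩

/-- The rule for sequences.  The frame of the first command is handed to the second one, so that
specifications need to mention only what a command changes. -/
theorem Ex.seq {c₁ c₂ : Cmd} {s : State} {Q₁ Q : ℕ → State → Prop} (h₁ : Ex W c₁ s Q₁)
    (h₂ : ∀ t₁ s₁, Frame c₁ s s₁ → Q₁ t₁ s₁ → Ex W c₂ s₁ fun t s' => Q (t₁ + t) s') :
    Ex W (.seq c₁ c₂) s Q := by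
  obtain ⟨t, s', he, hq⟩ := h₁
  obtain ⟨t', s'', he', hq'⟩ := h₂ t s' he.frame hq
  exact ⟨_, _, .seq he he', hq'⟩

theorem Ex.ite {b : BExp} {c₁ c₂ : Cmd} {s : State} {Q : ℕ → State → Prop} (hb : b.Ok W s)
    (h₁ : b.Holds s → Ex W c₁ s fun t s' => Q (b.cost + 1 + t) s')
    (h₂ : ¬ b.Holds s → Ex W c₂ s fun t s' => Q (b.cost + 1 + t) s') :
    Ex W (.ite b c₁ c₂) s Q := by
  by_cases h : b.Holds s
  · obtain ⟨t, s', he, hq⟩ := h₁ h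
    exact ⟨_, _, .iteTrue hb h he, hq⟩
  · obtain ⟨t, s', he, hq⟩ := h₂ h
    exact ⟨_, _, .iteFalse hb h he, hq⟩

/-- The rule for loops: `I g` is an invariant that depends on a ghost value `g`, and `Φ g` is a
potential that pays for the test and the body of every round. -/
theorem Ex.loop {γ : Type*} {b : BExp} {c : Cmd} {s₀ : State} (I : γ → State → Prop) (Φ : γ → ℕ)
    (g₀ : γ) (h₀ : I g₀ s₀)
    (hb : ∀ g s, Frame (.while b c) s₀ s → I g s → b.Ok W s)
    (step : ∀ g s, Frame (.while b c) s₀ s → I g s → b.Holds s →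
      Ex W c s fun t s' => ∃ g', I g' s' ∧ t + b.cost + 1 + Φ g' ≤ Φ g) :
    Ex W (.while b c) s₀ fun t s' =>
      ∃ g, I g s' ∧ ¬ b.Holds s' ∧ t + Φ g ≤ Φ g₀ + b.cost + 1 := by
  suffices H : ∀ n g s, Φ g ≤ n → Frame (.while b c) s₀ s → I g s → Ex W (.while b c) s fun t s' =>
      ∃ g', I g' s' ∧ ¬ b.Holds s' ∧ t + Φ g' ≤ Φ g + b.cost + 1 from
    H _ g₀ s₀ le_rfl (Frame.refl _ _) h₀
  intro n
  induction n with
  | zero =>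
    intro g s hn hf hI
    by_cases h : b.Holds s
    · obtain ⟨t, s', -, g', -, hle⟩ := step g s hf hI h
      omega
    · exact ⟨_, _, .whileFalse (hb g s hf hI) h, g, hI, h, by omega⟩
  | succ n ih =>
    intro g s hn hf hI
    by_cases h : b.Holds s
    · obtain ⟨t, s', he, g', hI', hle⟩ := step g s hf hI h
      obtain ⟨t', s'', he', g'', hI'', hn'', hle'⟩ := ih g' s' (by omega)
        (hf.trans ⟨he.frame.nat, he.frame.real⟩) hI'
      exact ⟨_, _, .whileTrue (hb g s hf hI) h he he', g'', hI'', hn'', by omega⟩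
    · exact ⟨_, _, .whileFalse (hb g s hf hI) h, g, hI, h, by omega⟩

/-- Weakest precondition of a command without loops and calls. -/
def Cmd.wp (W : ℕ) : Cmd → (State → Prop) → State → Prop
  | .skip, Q, s => Q s
  | .setNat a i e, Q, s => (i.Ok W s ∧ e.Ok W s) ∧ Q (s.setNat a (i.val s) (e.val s))
  | .setReal a i e, Q, s => (i.Ok W s ∧ e.Ok W s) ∧ Q (s.setReal a (i.val s) (e.val s))
  | .seq c₁ c₂, Q, s => c₁.wp W (fun s' => c₂.wp W Q s') s
  | .ite b c₁ c₂, Q, s => b.Ok W s ∧ (b.Holds s → c₁.wp W Q s) ∧ (¬ b.Holds s → c₂.wp W Q s)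
  | .while _ _, _, _ => False
  | .call _, _, _ => False

/-- Bound for the running time of a command without loops and calls. -/
def Cmd.maxCost : Cmd → ℕ
  | .skip => 1
  | .setNat _ i e => i.cost + e.cost + 1
  | .setReal _ i e => i.cost + e.cost + 1
  | .seq c₁ c₂ => c₁.maxCost + c₂.maxCost
  | .ite b c₁ c₂ => b.cost + 1 + (c₁.maxCost + c₂.maxCost)
  | .while _ _ => 0
  | .call _ => 0

/-- Commands without loops and calls are verified by simplification of `Cmd.wp`.  The bound for the
running time adds up both branches of a conditional. -/
theorem Ex.of_wp {c : Cmd} {s : State} {Q : State → Prop} (h : c.wp W Q s) :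
    Ex W c s fun t s' => t ≤ c.maxCost ∧ Q s' := by
  induction c generalizing s Q with
  | skip => exact ⟨_, _, .skip s, le_rfl, h⟩
  | setNat a i e => exact ⟨_, _, .setNat s a i e h.1.1 h.1.2, le_rfl, h.2⟩
  | setReal a i e => exact ⟨_, _, .setReal s a i e h.1.1 h.1.2, le_rfl, h.2⟩
  | seq c₁ c₂ ih₁ ih₂ =>
    obtain ⟨t, s', he, ht, h'⟩ := ih₁ (s := s) h
    obtain ⟨t', s'', he', ht', h''⟩ := ih₂ (s := s') h'
    exact ⟨_, _, .seq he he', by simp only [Cmd.maxCost]; omega, h''⟩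
  | ite b c₁ c₂ ih₁ ih₂ =>
    by_cases hb : b.Holds s
    · obtain ⟨t, s', he, ht, h'⟩ := ih₁ (h.2.1 hb)
      exact ⟨_, _, .iteTrue h.1 hb he, by simp only [Cmd.maxCost]; omega, h'⟩
    · obtain ⟨t, s', he, ht, h'⟩ := ih₂ (h.2.2 hb)
      exact ⟨_, _, .iteFalse h.1 hb he, by simp only [Cmd.maxCost]; omega, h'⟩
  | _ => exact h.elim

-- Simplification evaluates all expressions, costs, preconditions and frames of concrete commands.
attribute [simp] NExp.val NExp.Ok NExp.cost RExp.val RExp.Ok RExp.cost BExp.Holds BExp.Ok BExp.cost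
  Cmd.wp Cmd.maxCost Cmd.WritesNat Cmd.WritesReal

/-- The word scalar kept in cell `0` of word array `a`. -/
abbrev NExp.scalar (a : ℕ) : NExp := .get a (.const 0)

/-! ### Segment trees -/

-- The arrays of the tree have fixed numbers.  They are notations for numerals, so that `simp` and
-- `omega` can tell different arrays apart.  Word arrays: the current node and a loop counter (both
-- scalars), then for every node its first two and its last two entries and the winner among its
-- entries, with `0` for none and `p + 1` for `p`, and finally the number of leaves (a scalar).
notation "arrNode" => (3 : ℕ)
notation "arrCtr" => (4 : ℕ)
notation "arrFst" => (5 : ℕ)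
notation "arrSnd" => (6 : ℕ)
notation "arrLst" => (7 : ℕ)
notation "arrPen" => (8 : ℕ)
notation "arrWho" => (9 : ℕ)
notation "arrSize" => (10 : ℕ)

-- Real array: for every node the key of the winner.  Real arrays `0` to `5` hold coordinates.
notation "arrTime" => (6 : ℕ)

/-- The entries of the leaves below node `v` of height `h`, from left to right.  Nodes are numbered
as in a heap: the children of `v` are `2 * v` and `2 * v + 1`, so that the leaves below `v` are
`v * 2 ^ h, …, v * 2 ^ h + 2 ^ h - 1`. -/
def leafList (occ : ℕ → Option ℕ) (h v : ℕ) : List ℕ :=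
  (List.range' (v * 2 ^ h) (2 ^ h)).filterMap occ

theorem leafList_zero (occ : ℕ → Option ℕ) (v : ℕ) : leafList occ 0 v = (occ v).toList := by
  cases h : occ v <;> simp [leafList, h]

theorem leafList_succ (occ : ℕ → Option ℕ) (h v : ℕ) :
    leafList occ (h + 1) v = leafList occ h (2 * v) ++ leafList occ h (2 * v + 1) := by
  unfold leafList
  rw [← List.filterMap_append]
  congr 1
  have h1 : (2 * v + 1) * 2 ^ h = 2 * v * 2 ^ h + 2 ^ h := by ring
  have h2 : 2 ^ (h + 1) = 2 ^ h + 2 ^ h := by ring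
  have h3 : v * 2 ^ (h + 1) = 2 * v * 2 ^ h := by ring
  rw [h1, h3, h2]
  exact List.range'_append_1.symm

theorem mem_leafList {occ : ℕ → Option ℕ} {h v p : ℕ} :
    p ∈ leafList occ h v ↔ ∃ w, w / 2 ^ h = v ∧ occ w = some p := by
  simp only [leafList, List.mem_filterMap, List.mem_range'_1]
  have : 0 < 2 ^ h := by positivity
  refine exists_congr fun w => and_congr_left fun _ => ?_
  rw [Nat.div_eq_iff this]
  constructor <;> rintro ⟨h1, h2⟩ <;> constructor <;> omega

theorem leafList_congr {occ occ' : ℕ → Option ℕ} {h v : ℕ}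
    (H : ∀ w, w / 2 ^ h = v → occ w = occ' w) : leafList occ h v = leafList occ' h v := by
  unfold leafList
  refine List.filterMap_congr fun w hw => H w ?_
  rw [List.mem_range'_1] at hw
  have : 0 < 2 ^ h := by positivity
  rw [Nat.div_eq_iff this]
  omega

/-- If the entries increase along the leaves with respect to a key, the list does. -/
theorem leafList_pairwise {occ : ℕ → Option ℕ} {r : ℕ → ℕ → Prop}
    (H : ∀ v w p q, v < w → occ v = some p → occ w = some q → r p q) (h v : ℕ) :
    (leafList occ h v).Pairwise r := by
  unfold leafList
  rw [List.pairwise_filterMap]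
  exact (List.pairwise_lt_range' (s := v * 2 ^ h) (n := 2 ^ h)).imp
    fun hab p hp q hq => H _ _ _ _ hab hp hq

/-- In memory `s`, every node `v` of the segment tree with `2 ^ D` leaves carries data that describe
the list of entries below `v`; here `Rep s v l` says that the data at `v` describe `l`. -/
def TreeRep (Rep : State → ℕ → List ℕ → Prop) (D : ℕ) (occ : ℕ → Option ℕ) (s : State) : Prop :=
  ∀ h ≤ D, ∀ v, 2 ^ (D - h) ≤ v → v < 2 ^ (D - h + 1) → Rep s v (leafList occ h v)

theorem TreeRep.root {Rep : State → ℕ → List ℕ → Prop} {D : ℕ} {occ : ℕ → Option ℕ} {s : State}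
    (h : TreeRep Rep D occ s) : Rep s 1 (leafList occ D 1) :=
  h D le_rfl 1 (by simp) (by simp)

/-- Two nodes of heights `h` and `h'` with the same number have the same height. -/
theorem height_unique {D h h' v : ℕ} (hh : h ≤ D) (hh' : h' ≤ D) (h1 : 2 ^ (D - h) ≤ v)
    (h2 : v < 2 ^ (D - h + 1)) (h3 : 2 ^ (D - h') ≤ v) (h4 : v < 2 ^ (D - h' + 1)) : h = h' := by
  have := (Nat.pow_lt_pow_iff_right (a := 2) (by norm_num)).1 (h1.trans_lt h4)
  have := (Nat.pow_lt_pow_iff_right (a := 2) (by norm_num)).1 (h3.trans_lt h2)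
  omega

theorem ancestor_bounds {D h v : ℕ} (hh : h ≤ D) (h1 : 2 ^ D ≤ v) (h2 : v < 2 ^ (D + 1)) :
    2 ^ (D - h) ≤ v / 2 ^ h ∧ v / 2 ^ h < 2 ^ (D - h + 1) := by
  have h3 : 0 < 2 ^ h := by positivity
  have h4 : 2 ^ (D - h) * 2 ^ h = 2 ^ D := by rw [← pow_add]; congr 1; omega
  constructor
  · rw [Nat.le_div_iff_mul_le h3, h4]; exact h1
  · rw [Nat.div_lt_iff_lt_mul h3, pow_succ, mul_right_comm, h4, ← pow_succ]; exact h2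

/-- Recompute the data at the proper ancestors of the node in the scalar `arrNode`, bottom-up. -/
def updatePath (comb : Cmd) : Cmd :=
  .while (.natLt (.const 1) (.scalar arrNode))
    (.seq (.setNat arrNode (.const 0) (.div (.scalar arrNode) (.const 2))) comb)

/-- If the data at a leaf have been changed, recomputing them at its ancestors repairs the tree,
where `comb` computes the data at a node from those at its children.  At a time when `h` ancestors
have been treated, the data are right except at the remaining ancestors. -/
theorem updatePath_spec {Rep : State → ℕ → List ℕ → Prop} {comb : Cmd} {B D leaf : ℕ}
    {occ occ' : ℕ → Option ℕ} {s₀ : State}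
    (hcomb : ∀ s v l₁ l₂, Frame (updatePath comb) s₀ s → s.nat arrNode 0 = v → 0 < v → v < 2 ^ D →
      Rep s (2 * v) l₁ → Rep s (2 * v + 1) l₂ →
      Ex W comb s fun t s' => t ≤ B ∧ s'.nat arrNode 0 = v ∧ Rep s' v (l₁ ++ l₂) ∧
        ∀ w ≠ v, ∀ l, Rep s w l → Rep s' w l)
    (hRep : ∀ s s' v l, (∀ a, a ≠ arrNode → s'.nat a = s.nat a) → s'.real = s.real →
      Rep s v l → Rep s' v l)
    (hW : 2 * 2 ^ D < W) (hl : s₀.nat arrNode 0 = leaf) (h1 : 2 ^ D ≤ leaf)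
    (h2 : leaf < 2 ^ (D + 1)) (hocc : ∀ w ≠ leaf, occ' w = occ w)
    (hold : ∀ h ≤ D, ∀ v, 2 ^ (D - h) ≤ v → v < 2 ^ (D - h + 1) → v ≠ leaf →
      Rep s₀ v (leafList occ h v))
    (hnew : Rep s₀ leaf (occ' leaf).toList) :
    Ex W (updatePath comb) s₀ fun t s' => t ≤ (B + 20) * (D + 1) ∧ TreeRep Rep D occ' s' := by
  have hWD : 1 < W := by
    have : 0 < 2 ^ D := by positivity
    omega
  refine (Ex.loop (γ := ℕ)
    (fun h s => h ≤ D ∧ s.nat arrNode 0 = leaf / 2 ^ h ∧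
      ∀ h' ≤ D, ∀ v, 2 ^ (D - h') ≤ v → v < 2 ^ (D - h' + 1) → (h' ≤ h ∨ v ≠ leaf / 2 ^ h') →
        Rep s v (leafList occ' h' v))
    (fun h => (D - h) * (B + 20)) 0 ?_ ?_ ?_).mono ?_
  · refine ⟨Nat.zero_le _, by simpa using hl, fun h' hh' v hv1 hv2 hor => ?_⟩
    by_cases hv : v = leaf
    · have : h' = 0 := height_unique hh' (Nat.zero_le D) hv1 hv2 (by simpa [hv] using h1)
        (by simpa [hv] using h2)
      subst this
      rw [leafList_zero, hv]
      exact hnew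
    · have hne : v ≠ leaf / 2 ^ h' := by
        rcases hor with h | h
        · have : h' = 0 := by omega
          subst this
          simpa using hv
        · exact h
      rw [leafList_congr (occ' := occ) fun w hw => hocc w ?_]
      · exact hold h' hh' v hv1 hv2 hv
      · rintro rfl
        exact hne hw.symm
  · rintro h s - ⟨hh, hs, -⟩
    have := (ancestor_bounds hh h1 h2).2
    have h5 : 2 ^ (D - h + 1) ≤ 2 ^ (D + 1) := Nat.pow_le_pow_right (by norm_num) (by omega)
    have h6 : 2 ^ (D + 1) = 2 * 2 ^ D := by ring
    simp [hs]
    omega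
  · rintro h s hf ⟨hh, hs, hR⟩ hlt
    simp only [BExp.Holds, NExp.val, hs] at hlt
    have hb := ancestor_bounds hh h1 h2
    have hhD : h < D := by
      rcases hh.lt_or_eq with h' | h'
      · exact h'
      · subst h'; simp at hb; omega
    have h5 : 2 ^ (D - h + 1) ≤ 2 ^ (D + 1) := Nat.pow_le_pow_right (by norm_num) (by omega)
    have h6 : 2 ^ (D + 1) = 2 * 2 ^ D := by ring
    have hdiv : leaf / 2 ^ (h + 1) = leaf / 2 ^ h / 2 := by rw [pow_succ, Nat.div_div_eq_div_mul]
    have hb' := ancestor_bounds (D := D) (h := h + 1) hhD h1 h2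
    have hDh : D - h = D - (h + 1) + 1 := by omega
    refine Ex.seq (Ex.of_wp (Q := fun s' => s' = s.setNat arrNode 0 (leaf / 2 ^ (h + 1))) ?_) ?_
    · simp [hs, hdiv]
      omega
    rintro t₁ s₁ hf₁ ⟨ht₁, rfl⟩
    have hkeep : ∀ w l, Rep s w l → Rep (s.setNat arrNode 0 (leaf / 2 ^ (h + 1))) w l :=
      fun w l hw => hRep s _ _ _ (fun a ha => by funext j; simp [ha]) rfl hw
    set v := leaf / 2 ^ (h + 1) with hv
    have hvD : v < 2 ^ D := hb'.2.trans_le (Nat.pow_le_pow_right (by norm_num) (by omega))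
    refine (hcomb (s.setNat arrNode 0 v) v (leafList occ' h (2 * v)) (leafList occ' h (2 * v + 1))
      (hf.trans ⟨fun a ha => ?_, fun a _ => by simp⟩) (by simp) ?_ hvD ?_ ?_).mono ?_
    · have : a ≠ arrNode := fun h => ha (by simp [h])
      funext j; simp [this]
    · exact lt_of_lt_of_le (by positivity) hb'.1
    · refine hkeep _ _ (hR h hh _ ?_ ?_ (Or.inl le_rfl)) <;> rw [hDh] <;> rw [pow_succ] <;> omega
    · refine hkeep _ _ (hR h hh _ ?_ ?_ (Or.inl le_rfl)) <;> rw [hDh] <;> rw [pow_succ] <;> omega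
    · rintro t s' - ⟨ht, hn, hnew', hothers⟩
      refine ⟨h + 1, ⟨hhD, hn, fun h' hh' w hw1 hw2 hor => ?_⟩, ?_⟩
      · by_cases hw : w = v
        · have : h' = h + 1 := height_unique hh' hhD hw1 hw2 (hw ▸ hb'.1) (hw ▸ hb'.2)
          subst this
          rw [leafList_succ, hw]
          exact hnew'
        · refine hothers w hw _ (hkeep _ _ (hR h' hh' w hw1 hw2 ?_))
          rcases hor with h3 | h3
          · rcases Nat.lt_or_ge h h' with h4 | h4
            · have : h' = h + 1 := by omega
              subst this
              exact Or.inr hw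
            · exact Or.inl h4
          · exact Or.inr h3
      · simp at ht₁ ⊢
        have : (D - h) * (B + 20) = (D - (h + 1)) * (B + 20) + (B + 20) := by
          rw [hDh]; ring_nf
        omega
  · rintro t s' - ⟨h, ⟨hh, hs, hR⟩, hn, ht⟩
    have hhD : h = D := by
      by_contra hne
      apply hn
      have hb := (ancestor_bounds hh h1 h2).1
      have : 2 ^ 1 ≤ 2 ^ (D - h) := Nat.pow_le_pow_right (by norm_num) (by omega)
      simp only [BExp.Holds, NExp.val, hs]
      omega
    subst hhD
    refine ⟨?_, fun h' hh' v hv1 hv2 => hR h' hh' v hv1 hv2 (Or.inl hh')⟩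
    simp at ht
    nlinarith

/-- The leaves that carry an entry. -/
def occupied (occ : ℕ → Option ℕ) (D : ℕ) : Finset ℕ :=
  (Finset.Ico (2 ^ D) (2 ^ (D + 1))).filter fun v => (occ v).isSome

theorem occupied_card_vacate {occ occ' : ℕ → Option ℕ} {D leaf : ℕ} (h1 : 2 ^ D ≤ leaf)
    (h2 : leaf < 2 ^ (D + 1)) (hocc : ∀ w ≠ leaf, occ' w = occ w) (ho : occ leaf ≠ none)
    (hn : occ' leaf = none) : (occupied occ' D).card + 1 = (occupied occ D).card := by
  have : occupied occ' D = (occupied occ D).erase leaf := by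
    ext v
    by_cases hv : v = leaf
    · subst hv; simp [occupied, hn]
    · simp [occupied, hv, hocc v hv]
  rw [this, Finset.card_erase_add_one]
  simp [occupied, h1, h2, Option.isSome_iff_ne_none, ho]

theorem occupied_card_le {occ occ' : ℕ → Option ℕ} {D leaf : ℕ}
    (hocc : ∀ w ≠ leaf, occ' w = occ w) : (occupied occ' D).card ≤ (occupied occ D).card + 1 := by
  have : occupied occ' D ⊆ insert leaf (occupied occ D) := by
    intro v
    by_cases hv : v = leaf
    · subst hv; simp
    · simp [occupied, hv, hocc v hv]
  exact (Finset.card_le_card this).trans (Finset.card_insert_le _ _)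

/-- Choose a power of two that is at least the number in cell `c` of word array `0` as number of
leaves and clear all nodes. -/
def initTree (c : ℕ) : Cmd :=
  .seq (.setNat arrSize (.const 0) (.const 1)) <|
  .seq (.while (.natLt (.scalar arrSize) (.get 0 (.const c)))
    (.setNat arrSize (.const 0) (.add (.scalar arrSize) (.scalar arrSize)))) <|
  .seq (.setNat arrNode (.const 0) (.const 0)) <|
  .while (.natLt (.scalar arrNode) (.add (.scalar arrSize) (.scalar arrSize))) <|
    .seq (.setNat arrFst (.scalar arrNode) (.const 0)) <|
    .seq (.setNat arrSnd (.scalar arrNode) (.const 0)) <|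
    .seq (.setNat arrLst (.scalar arrNode) (.const 0)) <|
    .seq (.setNat arrPen (.scalar arrNode) (.const 0)) <|
    .seq (.setNat arrWho (.scalar arrNode) (.const 0)) <|
    .setNat arrNode (.const 0) (.add (.scalar arrNode) (.const 1))

/-- Only `8 * m + 8 < W` is asked of the word bound, since there are fewer than `2 * m` leaves and
hence fewer than `4 * m` nodes. -/
theorem initTree_spec {c m : ℕ} {s₀ : State} (hc : s₀.nat 0 c = m) (hcW : c < W) (hm : 1 ≤ m)
    (hW : 8 * m + 8 < W) :
    Ex W (initTree c) s₀ fun t s' => t ≤ 300 * m ∧ ∃ D, s'.nat arrSize 0 = 2 ^ D ∧ m ≤ 2 ^ D ∧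
      2 ^ D < 2 * m ∧ ∀ v < 2 * 2 ^ D, s'.nat arrFst v = 0 ∧ s'.nat arrSnd v = 0 ∧
        s'.nat arrLst v = 0 ∧ s'.nat arrPen v = 0 ∧ s'.nat arrWho v = 0 := by
  refine Ex.seq (Ex.of_wp (Q := fun s => s.nat arrSize 0 = 1) (by simp; omega)) ?_
  rintro t₁ s₁ hf₁ ⟨ht₁, h1⟩
  have hc1 : s₁.nat 0 c = m := by rw [hf₁.nat 0 (by simp), hc]
  -- every doubling is paid for by the growth of the number of leaves
  refine Ex.seq (Ex.loop (γ := ℕ) (fun D s => s.nat arrSize 0 = 2 ^ D ∧ 2 ^ D < 2 * m)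
    (fun D => (2 * m - 2 ^ D) * 20) 0 (by simp [h1]; omega) ?_ ?_) ?_
  · rintro D s hf ⟨hs, hD⟩
    have := hf.nat 0 (by simp)
    simp [hs, this, hc1]
    omega
  · rintro D s hf ⟨hs, hD⟩ hlt
    have h0 := hf.nat 0 (by simp)
    simp [hs, h0, hc1] at hlt
    refine (Ex.of_wp (Q := fun s => s.nat arrSize 0 = 2 ^ (D + 1)) ?_).mono ?_
    · simp [hs, pow_succ]
      omega
    · rintro t s' - ⟨ht, hs'⟩
      have hpos : 0 < 2 ^ D := by positivity
      refine ⟨D + 1, ⟨hs', by rw [pow_succ]; omega⟩, ?_⟩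
      simp [pow_succ] at ht ⊢
      omega
  rintro t₂ s₂ hf₂ ⟨D, ⟨hs2, hD⟩, hn, ht₂⟩
  have hc2 : s₂.nat 0 c = m := by rw [hf₂.nat 0 (by simp), hc1]
  simp [hs2, hc2] at hn
  refine Ex.seq (Ex.of_wp (Q := fun s => s.nat arrNode 0 = 0 ∧ s.nat arrSize 0 = 2 ^ D)
    (by simp [hs2]; omega)) ?_
  rintro t₃ s₃ - ⟨ht₃, h3, h3'⟩
  refine (Ex.loop (γ := ℕ) (fun k s => s.nat arrNode 0 = k ∧ k ≤ 2 * 2 ^ D ∧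
    ∀ v < k, s.nat arrFst v = 0 ∧ s.nat arrSnd v = 0 ∧
        s.nat arrLst v = 0 ∧ s.nat arrPen v = 0 ∧ s.nat arrWho v = 0)
    (fun k => (2 * 2 ^ D - k) * 40) 0 ⟨h3, by omega, by simp⟩ ?_ ?_).mono ?_
  · rintro k s hf ⟨hs, hk, -⟩
    have := hf.nat arrSize (by simp)
    simp [hs, this, h3']
    omega
  · rintro k s hf ⟨hs, hk, hz⟩ hlt
    have h0 := hf.nat arrSize (by simp)
    simp [hs, h0, h3'] at hlt
    refine (Ex.of_wp (Q := fun s => s.nat arrNode 0 = k + 1 ∧ ∀ v < k + 1, s.nat arrFst v = 0 ∧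
        s.nat arrSnd v = 0 ∧ s.nat arrLst v = 0 ∧ s.nat arrPen v = 0 ∧ s.nat arrWho v = 0)
        ?_).mono ?_
    · simp [hs]
      refine ⟨by omega, by omega, fun v hv => ?_⟩
      have : v ≠ k → v < k := by omega
      refine ⟨fun h => (hz v (this h)).1, fun h => (hz v (this h)).2.1,
        fun h => (hz v (this h)).2.2.1, fun h => (hz v (this h)).2.2.2.1,
        fun h => (hz v (this h)).2.2.2.2⟩
    · rintro t s' - ⟨ht, hs', hz'⟩
      refine ⟨k + 1, ⟨hs', by omega, hz'⟩, ?_⟩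
      simp at ht ⊢
      omega
  · rintro t s' hf ⟨k, ⟨hs, hk, hz⟩, hn', ht⟩
    have h0 := hf.nat arrSize (by simp)
    simp [hs, h0, h3'] at hn' ht ht₁ ht₂ ht₃
    refine ⟨by omega, D, by rw [h0, h3'], hn, hD, fun v hv => hz v (by omega)⟩

theorem TreeRep.of_empty {Rep : State → ℕ → List ℕ → Prop} {D : ℕ} {s : State}
    (h : ∀ v < 2 * 2 ^ D, Rep s v []) : TreeRep Rep D (fun _ => none) s := by
  intro h' hh' v _ hv
  have : leafList (fun _ => none) h' v = [] := by simp [leafList]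
  rw [this]
  refine h v (hv.trans_le ?_)
  rw [← pow_succ']
  exact Nat.pow_le_pow_right (by norm_num) (by omega)

/-! ### Sorting by a tournament -/

/-- The pair `(who, time)` describes an element of `C` with minimal second component: `who` is one
more than its first component, and `0` if `C` is empty. -/
def Best (who : ℕ) (time : ℝ) (C : Set (ℕ × ℝ)) : Prop :=
  (who = 0 ∧ C = ∅) ∨ (0 < who ∧ (who - 1, time) ∈ C ∧ ∀ e ∈ C, time ≤ e.2)

theorem Best.left {w₁ w₂ : ℕ} {t₁ t₂ : ℝ} {C₁ C₂ : Set (ℕ × ℝ)} (h₁ : Best w₁ t₁ C₁)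
    (h₂ : Best w₂ t₂ C₂) (h : 0 < w₁ ∧ (0 < w₂ → t₁ ≤ t₂)) : Best w₁ t₁ (C₁ ∪ C₂) := by
  obtain ⟨h, ht⟩ := h
  rcases h₁ with h₁ | ⟨-, hm, hle⟩
  · omega
  refine Or.inr ⟨h, Or.inl hm, ?_⟩
  rintro e (he | he)
  · exact hle e he
  · rcases h₂ with ⟨-, rfl⟩ | ⟨h0, -, hle'⟩
    · exact he.elim
    · exact (ht h0).trans (hle' e he)

theorem Best.right {w₁ w₂ : ℕ} {t₁ t₂ : ℝ} {C₁ C₂ : Set (ℕ × ℝ)} (h₁ : Best w₁ t₁ C₁)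
    (h₂ : Best w₂ t₂ C₂) (h : 0 < w₁ → 0 < w₂ ∧ t₂ ≤ t₁) : Best w₂ t₂ (C₁ ∪ C₂) := by
  rcases h₁ with ⟨-, rfl⟩ | h₁'
  · simpa using h₂
  · rw [Set.union_comm]
    exact h₂.left (Or.inr h₁') ⟨(h h₁'.1).1, fun h' => (h h').2⟩

/-- The left child of the node in the scalar `arrNode`. -/
abbrev lchild : NExp := .add (.scalar arrNode) (.scalar arrNode)
/-- The right child of the node in the scalar `arrNode`. -/
abbrev rchild : NExp := .add lchild (.const 1)

/-- Copy the better of the best elements at the two children to their parent. -/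
def mergeBest : Cmd :=
  .ite (.and (.natLt (.const 0) (.get arrWho lchild))
      (.not (.and (.natLt (.const 0) (.get arrWho rchild))
        (.realLt (.get arrTime rchild) (.get arrTime lchild)))))
    (.seq (.setNat arrWho (.scalar arrNode) (.get arrWho lchild))
      (.setReal arrTime (.scalar arrNode) (.get arrTime lchild)))
    (.seq (.setNat arrWho (.scalar arrNode) (.get arrWho rchild))
      (.setReal arrTime (.scalar arrNode) (.get arrTime rchild)))

theorem mergeBest_spec {s : State} {v : ℕ} {C₁ C₂ : Set (ℕ × ℝ)} (hv : s.nat arrNode 0 = v)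
    (hW : v + v + 1 < W) (hl : s.nat arrWho (v + v) < W)
    (hr : s.nat arrWho (v + v + 1) < W)
    (h₁ : Best (s.nat arrWho (v + v)) (s.real arrTime (v + v)) C₁)
    (h₂ : Best (s.nat arrWho (v + v + 1)) (s.real arrTime (v + v + 1)) C₂) :
    Ex W mergeBest s fun t s' => t ≤ 80 ∧ Best (s'.nat arrWho v) (s'.real arrTime v) (C₁ ∪ C₂) ∧
      ∀ w ≠ v, s'.nat arrWho w = s.nat arrWho w ∧ s'.real arrTime w = s.real arrTime w := by
  refine (Ex.of_wp (Q := fun s' => Best (s'.nat arrWho v) (s'.real arrTime v) (C₁ ∪ C₂) ∧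
      ∀ w ≠ v, s'.nat arrWho w = s.nat arrWho w ∧ s'.real arrTime w = s.real arrTime w) ?_).mono ?_
  · simp only [mergeBest, Cmd.wp, BExp.Holds, BExp.Ok]
    refine ⟨?_, fun h => ?_, fun h => ?_⟩
    · simp [hv]; omega
    · simp [hv] at h
      simp +contextual [hv]
      exact ⟨by omega, by omega, h₁.left h₂ h⟩
    · simp [hv] at h
      simp +contextual [hv]
      exact ⟨by omega, by omega, h₁.right h₂ fun h0 => ⟨(h h0).1, (h h0).2.le⟩⟩
  · rintro t s' - ⟨ht, h⟩
    simp [mergeBest] at ht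
    exact ⟨by omega, h⟩

/-- The data at node `v` are those of a tournament among the members of `l` by the key `K`. -/
def MinRep (m : ℕ) (K : ℕ → ℝ) (s : State) (v : ℕ) (l : List ℕ) : Prop :=
  (∀ p ∈ l, p < m) ∧ Best (s.nat arrWho v) (s.real arrTime v) {e | e.1 ∈ l ∧ e.2 = K e.1}

theorem MinRep.who_le {m : ℕ} {K : ℕ → ℝ} {s : State} {v : ℕ} {l : List ℕ}
    (h : MinRep m K s v l) : s.nat arrWho v ≤ m := by
  rcases h.2 with h' | h'
  · omega
  · have := h.1 _ h'.2.1.1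
    omega

theorem MinRep.congr {m : ℕ} {K : ℕ → ℝ} {s s' : State} {v : ℕ} {l : List ℕ}
    (h : MinRep m K s v l) (h₁ : s'.nat arrWho v = s.nat arrWho v)
    (h₂ : s'.real arrTime v = s.real arrTime v) : MinRep m K s' v l := by
  unfold MinRep
  rw [h₁, h₂]
  exact h

theorem updatePath_mergeBest_spec {m D leaf : ℕ} {K : ℕ → ℝ} {occ occ' : ℕ → Option ℕ}
    {s₀ : State} (hm : m < W) (hW : 2 * 2 ^ D < W) (hl : s₀.nat arrNode 0 = leaf)
    (h1 : 2 ^ D ≤ leaf) (h2 : leaf < 2 ^ (D + 1)) (hocc : ∀ w ≠ leaf, occ' w = occ w)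
    (hold : ∀ h ≤ D, ∀ v, 2 ^ (D - h) ≤ v → v < 2 ^ (D - h + 1) → v ≠ leaf →
      MinRep m K s₀ v (leafList occ h v))
    (hnew : MinRep m K s₀ leaf (occ' leaf).toList) :
    Ex W (updatePath mergeBest) s₀ fun t s' =>
      t ≤ 100 * (D + 1) ∧ TreeRep (MinRep m K) D occ' s' := by
  refine updatePath_spec (B := 80) ?_ ?_ hW hl h1 h2 hocc hold hnew
  · intro s v l₁ l₂ hf hv hv0 hvD hR₁ hR₂
    rw [two_mul] at hR₁ hR₂
    refine (mergeBest_spec hv (by omega) (hR₁.who_le.trans_lt hm) (hR₂.who_le.trans_lt hm)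
      hR₁.2 hR₂.2).mono ?_
    rintro t s' hf' ⟨ht, hb, ho⟩
    refine ⟨ht, by rw [hf'.nat arrNode (by simp [mergeBest]), hv], ⟨?_, ?_⟩, fun w hw l h =>
      h.congr (ho w hw).1 (ho w hw).2⟩
    · intro p hp
      rcases List.mem_append.1 hp with h | h
      exacts [hR₁.1 p h, hR₂.1 p h]
    · convert hb using 1
      ext e
      simp [or_and_right]
  · intro s s' v l hn hr h
    exact h.congr (by rw [hn _ (by norm_num)]) (by rw [hr])

/-- Write the numbers less than the content of cell `c` of word array `0` to word array `P`, sorted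
by the keys in real array `K`: the numbers enter a tournament, from which the winner is removed
again and again. -/
def sortBy (K c P : ℕ) : Cmd :=
  .seq (initTree c) <|
  .seq (.setNat arrCtr (.const 0) (.const 0)) <|
  .seq (.while (.natLt (.scalar arrCtr) (.get 0 (.const c))) <|
    .seq
      (.seq (.setNat arrNode (.const 0) (.add (.scalar arrSize) (.scalar arrCtr))) <|
      .seq (.setNat arrWho (.scalar arrNode) (.add (.scalar arrCtr) (.const 1))) <|
      .setReal arrTime (.scalar arrNode) (.get K (.scalar arrCtr))) <|
    .seq (updatePath mergeBest) <|
    .setNat arrCtr (.const 0) (.add (.scalar arrCtr) (.const 1))) <|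
  .seq (.setNat arrCtr (.const 0) (.const 0)) <|
  .while (.natLt (.scalar arrCtr) (.get 0 (.const c))) <|
    .seq
      (.seq (.setNat P (.scalar arrCtr) (.sub (.get arrWho (.const 1)) (.const 1))) <|
      .seq (.setNat arrNode (.const 0) (.add (.scalar arrSize) (.get P (.scalar arrCtr)))) <|
      .setNat arrWho (.scalar arrNode) (.const 0)) <|
    .seq (updatePath mergeBest) <|
    .setNat arrCtr (.const 0) (.add (.scalar arrCtr) (.const 1))

/-- `σ 0, …, σ (m - 1)` lists the numbers less than `m` by increasing key. -/
structure IsSorting (K : ℕ → ℝ) (m : ℕ) (σ : ℕ → ℕ) : Prop where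
  lt : ∀ i < m, σ i < m
  surj : ∀ p < m, ∃ i < m, σ i = p
  mono : ∀ i j, i ≤ j → j < m → K (σ i) ≤ K (σ j)

theorem sortBy_spec {K c P m : ℕ} {s₀ : State} (hc : s₀.nat 0 c = m) (hcW : c < W) (hm : 1 ≤ m)
    (hW : 8 * m + 8 < W) (hK : K < 6) (hP : 16 ≤ P) :
    Ex W (sortBy K c P) s₀ fun t s' => t ≤ 800 * (m * (Nat.log 2 m + 2)) ∧
      IsSorting (s₀.real K) m (s'.nat P) := by
  obtain ⟨P, rfl⟩ := Nat.exists_eq_add_of_le' hP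
  have hK6 : K ≠ 6 := by omega
  refine Ex.seq (initTree_spec hc hcW hm hW) ?_
  rintro t₁ s₁ hf₁ ⟨ht₁, D, hs1, hmD, hDm, hz⟩
  have hD2 : 2 ^ (D + 1) = 2 * 2 ^ D := by ring
  have hc1 : s₁.nat 0 c = m := by rw [hf₁.nat 0 (by simp [initTree]), hc]
  have hK1 : s₁.real K = s₀.real K := hf₁.real K (by simp [initTree])
  have hT1 : TreeRep (MinRep m (s₀.real K)) D (fun _ => none) s₁ :=
    TreeRep.of_empty fun v hv => ⟨by simp, Or.inl ⟨(hz v hv).2.2.2.2, by simp⟩⟩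
  clear hz
  refine Ex.seq (Ex.of_wp (Q := fun s => s.nat arrCtr 0 = 0 ∧ s.nat arrSize 0 = 2 ^ D ∧
    s.nat 0 c = m ∧ s.real K = s₀.real K ∧ s.nat arrWho = s₁.nat arrWho ∧ s.real = s₁.real)
    ?_) ?_
  · simp [hs1, hc1, hK1]
    exact ⟨by omega, funext fun j => by simp⟩
  rintro t₂ s₂ - ⟨ht₂, hi2, hs2, hc2, hK2, hw2, hr2⟩
  have hT2 : TreeRep (MinRep m (s₀.real K)) D (fun _ => none) s₂ := fun h hh v h1 h2 =>
    (hT1 h hh v h1 h2).congr (by rw [hw2]) (by rw [hr2])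
  refine Ex.seq (Ex.loop (γ := ℕ) (fun k s => s.nat arrCtr 0 = k ∧ k ≤ m ∧
    TreeRep (MinRep m (s₀.real K)) D
      (fun v => if 2 ^ D ≤ v ∧ v < 2 ^ D + k then some (v - 2 ^ D) else none) s)
    (fun k => (m - k) * (100 * (D + 1) + 60)) 0 ⟨hi2, by omega, ?_⟩ ?_ ?_) ?_
  · convert hT2 using 2 with v
    simp
  · rintro k s hf ⟨hs, hk, -⟩
    have := hf.nat 0 (by simp [updatePath, mergeBest])
    simp [hs, this, hc2]
    omega
  · rintro k s hf ⟨hs, hk, hT⟩ hlt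
    have h0 := hf.nat 0 (by simp [updatePath, mergeBest])
    have hsz := hf.nat arrSize (by simp [updatePath, mergeBest])
    have hKs := hf.real K (by simp [updatePath, mergeBest, hK6])
    simp [hs, h0, hc2] at hlt
    refine Ex.seq (Ex.of_wp (Q := fun s' => s'.nat arrCtr 0 = k ∧ s'.nat arrNode 0 = 2 ^ D + k ∧
      s'.nat arrWho (2 ^ D + k) = k + 1 ∧ s'.real arrTime (2 ^ D + k) = s₀.real K k ∧
      ∀ w ≠ 2 ^ D + k, s'.nat arrWho w = s.nat arrWho w ∧ s'.real arrTime w = s.real arrTime w)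
      ?_) ?_
    · simp +contextual [hs, hsz, hs2, hKs, hK2]
      omega
    rintro t₃ s₃ - ⟨ht₃, hi3, hn3, hw3, hr3, ho3⟩
    refine Ex.seq (updatePath_mergeBest_spec (m := m) (K := s₀.real K)
      (occ' := fun v => if 2 ^ D ≤ v ∧ v < 2 ^ D + (k + 1) then some (v - 2 ^ D) else none)
      (by omega) (by omega) hn3 (by omega) (by omega)
      (fun w hw => ?_) (fun h hh v h1 h2 hv => (hT h hh v h1 h2).congr (ho3 v hv).1 (ho3 v hv).2)
      ⟨?_, Or.inr ⟨?_, ?_, ?_⟩⟩) ?_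
    · have : (2 ^ D ≤ w ∧ w < 2 ^ D + (k + 1)) ↔ (2 ^ D ≤ w ∧ w < 2 ^ D + k) := by omega
      simp [this]
    · simp [hlt]
    · omega
    · simp [hw3, hr3]
    · simp [hr3]
    rintro t₄ s₄ hf₄ ⟨ht₄, hT4⟩
    have hi4 : s₄.nat arrCtr 0 = k := by rw [hf₄.nat _ (by simp [updatePath, mergeBest]), hi3]
    refine (Ex.of_wp (Q := fun s => s.nat arrCtr 0 = k + 1 ∧ s.nat arrWho = s₄.nat arrWho ∧
      s.real = s₄.real) ?_).mono ?_
    · simp [hi4]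
      exact ⟨by omega, funext fun j => by simp⟩
    rintro t₅ s₅ - ⟨ht₅, hi5, hw5, hr5⟩
    refine ⟨k + 1, ⟨hi5, hlt, fun h hh v h1 h2 => (hT4 h hh v h1 h2).congr (by rw [hw5])
      (by rw [hr5])⟩, ?_⟩
    have : (m - k) * (100 * (D + 1) + 60) =
        (m - (k + 1)) * (100 * (D + 1) + 60) + (100 * (D + 1) + 60) := by
      rw [show m - k = m - (k + 1) + 1 by omega]; ring
    simp at ht₃ ht₅ ⊢
    omega
  rintro t₃ s₃ hf₃ ⟨k, ⟨hi3, hk, hT3⟩, hn3, ht₃⟩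
  have hc3 : s₃.nat 0 c = m := by rw [hf₃.nat 0 (by simp [updatePath, mergeBest]), hc2]
  have hs3 : s₃.nat arrSize 0 = 2 ^ D := by
    rw [hf₃.nat _ (by simp [updatePath, mergeBest]), hs2]
  obtain rfl : k = m := by simp [hi3, hc3] at hn3; omega
  set occ₀ : ℕ → Option ℕ := fun v => if 2 ^ D ≤ v ∧ v < 2 ^ D + k then some (v - 2 ^ D) else none
    with hocc₀
  refine Ex.seq (Ex.of_wp (Q := fun s => s.nat arrCtr 0 = 0 ∧ s.nat arrSize 0 = 2 ^ D ∧
    s.nat 0 c = k ∧ s.nat arrWho = s₃.nat arrWho ∧ s.real = s₃.real) ?_) ?_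
  · simp [hs3, hc3]
    exact ⟨by omega, funext fun j => by simp⟩
  rintro t₄ s₄ - ⟨ht₄, hi4, hs4, hc4, hw4, hr4⟩
  -- the ghost value is the number of winners so far together with the leaves still in the
  -- tournament
  refine (Ex.loop (γ := ℕ × (ℕ → Option ℕ)) (fun g s => s.nat arrCtr 0 = g.1 ∧ g.1 ≤ k ∧
    TreeRep (MinRep k (s₀.real K)) D g.2 s ∧
    (∀ v p, g.2 v = some p → v = 2 ^ D + p ∧ p < k) ∧
    (occupied g.2 D).card + g.1 = k ∧
    (∀ p < k, g.2 (2 ^ D + p) = some p ∨ ∃ i < g.1, s.nat (P + 16) i = p) ∧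
    (∀ i < g.1, s.nat (P + 16) i < k) ∧
    (∀ i j, i ≤ j → j < g.1 → s₀.real K (s.nat (P + 16) i) ≤ s₀.real K (s.nat (P + 16) j)) ∧
    (∀ i < g.1, ∀ v p, g.2 v = some p → s₀.real K (s.nat (P + 16) i) ≤ s₀.real K p))
    (fun g => (k - g.1) * (100 * (D + 1) + 60)) (0, occ₀) ?_ ?_ ?_).mono ?_
  · refine ⟨hi4, by simp, fun h hh v h1 h2 => (hT3 h hh v h1 h2).congr (by rw [hw4]) (by rw [hr4]),
      ?_, ?_, ?_, by simp, by simp, by simp⟩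
    · intro v p h
      simp only [hocc₀] at h
      split_ifs at h with h'
      simp at h
      omega
    · have : occupied occ₀ D = Finset.Ico (2 ^ D) (2 ^ D + k) := by
        ext v
        by_cases h : 2 ^ D ≤ v ∧ v < 2 ^ D + k
        · simp [occupied, hocc₀, h]; omega
        · simp [occupied, hocc₀, h]
      simp [this]
    · intro p hp
      left
      simp [hocc₀, hp]
  · rintro ⟨j, occ⟩ s hf ⟨hs, hj, -⟩
    have := hf.nat 0 (by simp [updatePath, mergeBest])
    simp [hs, this, hc4]
    simp at hj
    omega
  · rintro ⟨j, occ⟩ s hf ⟨hs, hj, hT, hv, hcard, hsur, hlt', hmono, hge⟩ hlt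
    have h0 := hf.nat 0 (by simp [updatePath, mergeBest])
    have hsz := hf.nat arrSize (by simp [updatePath, mergeBest])
    simp [hs, h0, hc4] at hlt
    dsimp only at hs hj hT hv hcard hsur hlt' hmono hge
    -- the tournament is not over, so it has a winner `p`
    obtain ⟨u, hu⟩ : (occupied occ D).Nonempty := by
      rw [← Finset.card_pos]; omega
    obtain ⟨q, hq⟩ : ∃ q, occ u = some q := by
      simp [occupied, Option.isSome_iff_exists] at hu
      exact hu.2
    have hroot := hT.root
    have hmem : ∀ v p, occ v = some p → p ∈ leafList occ D 1 := by
      intro v p h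
      refine mem_leafList.2 ⟨v, ?_, h⟩
      have := hv v p h
      rw [Nat.div_eq_iff (by positivity)]
      omega
    rcases hroot.2 with ⟨-, he⟩ | ⟨hpos, ⟨hmem1, htime⟩, hmin⟩
    · exact absurd (show (q, s₀.real K q) ∈ (∅ : Set (ℕ × ℝ)) from he ▸ ⟨hmem u q hq, rfl⟩)
        (Set.notMem_empty _)
    simp only at hmem1 htime
    obtain ⟨p, hp⟩ : ∃ p, s.nat arrWho 1 = p + 1 := ⟨s.nat arrWho 1 - 1, by omega⟩
    rw [hp, Nat.add_sub_cancel] at hmem1 htime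
    obtain ⟨w, -, hw⟩ := mem_leafList.1 hmem1
    obtain ⟨rfl, hpk⟩ := hv w p hw
    refine Ex.seq (Ex.of_wp (Q := fun s' => s'.nat arrCtr 0 = j ∧ s'.nat arrNode 0 = 2 ^ D + p ∧
      s'.nat arrWho (2 ^ D + p) = 0 ∧ s'.nat (P + 16) j = p ∧
      (∀ i ≠ j, s'.nat (P + 16) i = s.nat (P + 16) i) ∧ s'.real = s.real ∧
      ∀ w ≠ 2 ^ D + p, s'.nat arrWho w = s.nat arrWho w) ?_) ?_
    · simp +contextual [hs, hsz, hs4, hp]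
      omega
    rintro t₅ s₅ - ⟨ht₅, hi5, hn5, hw5, hp5, hP5, hr5, ho5⟩
    have hother : ∀ w ≠ 2 ^ D + p, (Function.update occ (2 ^ D + p) none) w = occ w :=
      fun w hw => Function.update_of_ne hw _ _
    refine Ex.seq (updatePath_mergeBest_spec (m := k) (K := s₀.real K)
      (occ' := Function.update occ (2 ^ D + p) none)
      (by omega) (by omega) hn5 (by omega) (by omega) hother
      (fun h hh v h1 h2 hv => (hT h hh v h1 h2).congr (ho5 v hv) (by rw [hr5]))
      ⟨by simp, Or.inl ⟨hw5, by simp⟩⟩) ?_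
    rintro t₆ s₆ hf₆ ⟨ht₆, hT6⟩
    have hi6 : s₆.nat arrCtr 0 = j := by rw [hf₆.nat _ (by simp [updatePath, mergeBest]), hi5]
    have hP6 : s₆.nat (P + 16) = s₅.nat (P + 16) := hf₆.nat _ (by simp [updatePath, mergeBest])
    refine (Ex.of_wp (Q := fun s => s.nat arrCtr 0 = j + 1 ∧ s.nat arrWho = s₆.nat arrWho ∧
      s.nat (P + 16) = s₅.nat (P + 16) ∧ s.real = s₆.real) ?_).mono ?_
    · simp [hi6, ← hP6]
      exact ⟨by omega, funext fun j => by simp, funext fun j => by simp⟩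
    rintro t₇ s₇ - ⟨ht₇, hi7, hw7, hP7, hr7⟩
    have hle : ∀ v p', occ v = some p' → s₀.real K p ≤ s₀.real K p' := fun v p' h => by
      have := hmin (p', s₀.real K p') ⟨hmem v p' h, rfl⟩
      rwa [htime] at this
    have hocc : ∀ v p', Function.update occ (2 ^ D + p) none v = some p' → occ v = some p' := by
      intro v p' h
      by_cases hv : v = 2 ^ D + p
      · rw [hv, Function.update_self] at h
        exact absurd h (by simp)
      · rwa [hother v hv] at h
    have hPlt : ∀ i < j, s₇.nat (P + 16) i = s.nat (P + 16) i := fun i hi => by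
      rw [hP7, hP5 i hi.ne]
    have hPj : s₇.nat (P + 16) j = p := by rw [hP7, hp5]
    refine ⟨(j + 1, Function.update occ (2 ^ D + p) none), ⟨hi7, hlt, fun h hh v h1 h2 =>
      (hT6 h hh v h1 h2).congr (by rw [hw7]) (by rw [hr7]), fun v p' h => hv v p' (hocc v p' h),
      ?_, ?_, ?_, ?_, ?_⟩, ?_⟩
    · have := occupied_card_vacate (D := D) (occ := occ) (leaf := 2 ^ D + p) (by omega) (by omega)
        hother (by simp [hw]) (by simp)
      dsimp only
      omega
    · intro p' hp'
      by_cases hpp : p' = p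
      · exact Or.inr ⟨j, by simp, by rw [hPj, hpp]⟩
      · rcases hsur p' hp' with h | ⟨i, hi, h⟩
        · exact Or.inl (by rw [← h]; exact hother _ (by omega))
        · exact Or.inr ⟨i, by simp only; omega, by rw [hPlt i hi, h]⟩
    · intro i hi
      rcases Nat.lt_succ_iff_lt_or_eq.1 hi with h | rfl
      · rw [hPlt i h]; exact hlt' i h
      · rw [hPj]; exact hpk
    · intro i i' hii hi'
      rcases Nat.lt_succ_iff_lt_or_eq.1 hi' with h | rfl
      · rw [hPlt i' h, hPlt i (by omega)]; exact hmono i i' hii h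
      · rcases hii.lt_or_eq with h | rfl
        · rw [hPlt i h, hPj]; exact hge i h _ p hw
        · exact le_rfl
    · intro i hi v p' h
      rcases Nat.lt_succ_iff_lt_or_eq.1 hi with h' | rfl
      · rw [hPlt i h']; exact hge i h' v p' (hocc v p' h)
      · rw [hPj]; exact hle v p' (hocc v p' h)
    · have : (k - j) * (100 * (D + 1) + 60) =
          (k - (j + 1)) * (100 * (D + 1) + 60) + (100 * (D + 1) + 60) := by
        rw [show k - j = k - (j + 1) + 1 by omega]; ring
      simp at ht₅ ht₇ ⊢
      omega
  · rintro t₅ s₅ hf₅ ⟨⟨j, occ⟩, ⟨hs, hj, hT, hv, hcard, hsur, hlt', hmono, hge⟩, hn5, ht₅⟩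
    have hc5 : s₅.nat 0 c = k := by rw [hf₅.nat 0 (by simp [updatePath, mergeBest]), hc4]
    dsimp only at hs hj hT hv hcard hsur hlt' hmono hge
    obtain rfl : j = k := by simp [hs, hc5] at hn5; omega
    refine ⟨?_, hlt', fun p hp => ?_, hmono⟩
    · have hD : D ≤ Nat.log 2 j + 1 := by
        rcases Nat.eq_zero_or_pos D with h | h
        · omega
        · have h3 : 2 ^ D = 2 * 2 ^ (D - 1) := by
            rw [← pow_succ']; congr 1; omega
          have := Nat.le_log_of_pow_le (b := 2) (by norm_num) (show 2 ^ (D - 1) ≤ j by omega)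
          omega
      have h3 : j * (D + 1) ≤ j * (Nat.log 2 j + 2) := Nat.mul_le_mul_left _ (by omega)
      have h4 : j * (100 * (D + 1) + 60) = 100 * (j * (D + 1)) + 60 * j := by ring
      have h5 : j * 2 ≤ j * (Nat.log 2 j + 2) := Nat.mul_le_mul_left _ (by omega)
      simp [h4] at ht₂ ht₃ ht₄ ht₅
      omega
    · rcases hsur p hp with h | h
      · have : 0 < (occupied occ D).card := Finset.card_pos.2 ⟨2 ^ D + p, by
          simp [occupied, h]; omega⟩
        omega
      · exact h

/-! ### Nearest sites on a sweep line -/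

/-- Squared distance between the point `(x, t)` and site `p`, which is the point `(X p, Y p)`.
Sites are referred to by number throughout, and `X`, `Y` are their coordinates. -/
def sqDist (X Y : ℕ → ℝ) (p : ℕ) (x t : ℝ) : ℝ :=
  (X p - x) * (X p - x) + (Y p - t) * (Y p - t)

/-- Twice the signed area of the triangle with vertices `a`, `b`, `c`. -/
def orient (X Y : ℕ → ℝ) (a b c : ℕ) : ℝ :=
  (X b - X a) * (Y c - Y b) - (Y b - Y a) * (X c - X b)

/-- The numerator of the second coordinate of the circumcenter of `a`, `b`, `c`; the denominator is
`2 * orient X Y a b c`. -/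
def circumNum (X Y : ℕ → ℝ) (a b c : ℕ) : ℝ :=
  (X c * X c + Y c * Y c - (X b * X b + Y b * Y b)) * (X b - X a) -
    (X b * X b + Y b * Y b - (X a * X a + Y a * Y a)) * (X c - X b)

/-- Second coordinate of the circumcenter of `a`, `b`, `c`: the height at which the cell of `b` in
the Voronoi diagram of `a`, `b`, `c` ends, if `b` lies below the line through `a` and `c`. -/
noncomputable def death (X Y : ℕ → ℝ) (a b c : ℕ) : ℝ :=
  circumNum X Y a b c / (2 * orient X Y a b c)

/-- Positive multiple of the length of the part of the line of height `t` on which `b` is the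
nearest of the sites `a`, `b`, `c` (where `X a < X b < X c`); negative if there is no such part. -/
def gap (X Y : ℕ → ℝ) (a b c : ℕ) (t : ℝ) : ℝ :=
  circumNum X Y a b c - 2 * t * orient X Y a b c

section Geometry
variable {X Y : ℕ → ℝ} {a b c : ℕ} {x t t' : ℝ}

theorem gap_self_pos (hab : X a < X b) (hbc : X b < X c) : 0 < gap X Y a b c (Y b) := by
  have h1 : 0 < X b - X a := sub_pos.2 hab
  have h2 : 0 < X c - X b := sub_pos.2 hbc
  have : gap X Y a b c (Y b) = ((X c - X b) ^ 2 + (Y c - Y b) ^ 2) * (X b - X a) +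
      ((X b - X a) ^ 2 + (Y b - Y a) ^ 2) * (X c - X b) := by
    unfold gap circumNum orient; ring
  rw [this]
  positivity

/-- If the triple does not make a left turn, the cell of `b` never ends. -/
theorem gap_nonneg_of_orient_nonpos (hab : X a < X b) (hbc : X b < X c) (hb : Y b ≤ t)
    (ho : orient X Y a b c ≤ 0) : 0 ≤ gap X Y a b c t := by
  have := gap_self_pos (Y := Y) hab hbc
  unfold gap at *
  nlinarith

theorem gap_neg_iff (ho : 0 < orient X Y a b c) : gap X Y a b c t < 0 ↔ death X Y a b c < t := by
  unfold gap death
  rw [div_lt_iff₀ (by positivity)]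
  constructor <;> intro h <;> linarith

theorem gap_neg_of_le (ho : 0 < orient X Y a b c) (h : gap X Y a b c t < 0) (ht : t ≤ t') :
    gap X Y a b c t' < 0 := by
  rw [gap_neg_iff ho] at *
  exact h.trans_le ht

/-- The gap expressed by the differences of squared distances from any point of the line of height
`t`.  All comparisons of distances below follow from it. -/
theorem gap_eq : gap X Y a b c t =
    (sqDist X Y c x t - sqDist X Y b x t) * (X b - X a) -
      (sqDist X Y b x t - sqDist X Y a x t) * (X c - X b) := by
  unfold gap circumNum orient sqDist; ring

/-- A site with negative gap is never strictly nearest. -/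
theorem sqDist_le_of_gap_neg (hab : X a < X b) (hbc : X b < X c) (h : gap X Y a b c t < 0) :
    sqDist X Y a x t ≤ sqDist X Y b x t ∨ sqDist X Y c x t ≤ sqDist X Y b x t := by
  by_contra! hn
  have := gap_eq (X := X) (Y := Y) (a := a) (b := b) (c := c) (x := x) (t := t)
  have h1 := mul_pos (sub_pos.2 hn.2) (sub_pos.2 hab)
  have h2 := mul_pos (sub_pos.2 hn.1) (sub_pos.2 hbc)
  nlinarith

theorem sqDist_le_right (hab : X a < X b) (hbc : X b < X c) (h : 0 ≤ gap X Y a b c t)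
    (hle : sqDist X Y a x t ≤ sqDist X Y b x t) : sqDist X Y b x t ≤ sqDist X Y c x t := by
  have h0 := gap_eq (X := X) (Y := Y) (a := a) (b := b) (c := c) (x := x) (t := t)
  have h2 := mul_nonneg (sub_nonneg.2 hle) (sub_pos.2 hbc).le
  by_contra! hn
  have h1 := mul_pos (sub_pos.2 hn) (sub_pos.2 hab)
  nlinarith

theorem sqDist_le_left (hab : X a < X b) (hbc : X b < X c) (h : 0 ≤ gap X Y a b c t)
    (hle : sqDist X Y c x t ≤ sqDist X Y b x t) : sqDist X Y b x t ≤ sqDist X Y a x t := by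
  have h0 := gap_eq (X := X) (Y := Y) (a := a) (b := b) (c := c) (x := x) (t := t)
  have h2 := mul_nonneg (sub_nonneg.2 hle) (sub_pos.2 hab).le
  by_contra! hn
  have h1 := mul_pos (sub_pos.2 hn) (sub_pos.2 hbc)
  nlinarith

/-- Of two sites on a vertical line, the higher one is nearer to every point above it. -/
theorem sqDist_le_of_above (hX : X a = X b) (hY : Y a ≤ Y b) (ht : Y b ≤ t) :
    sqDist X Y b x t ≤ sqDist X Y a x t := by
  unfold sqDist
  rw [hX]
  nlinarith

end Geometry

/-- `a`, `b`, `c` are consecutive entries of `l`. -/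
def Consec (l : List ℕ) (a b c : ℕ) : Prop :=
  ∃ i : ℕ, l[i]? = some a ∧ l[i + 1]? = some b ∧ l[i + 2]? = some c

theorem Consec.mem {l : List ℕ} {a b c : ℕ} (h : Consec l a b c) : a ∈ l ∧ b ∈ l ∧ c ∈ l := by
  obtain ⟨i, h1, h2, h3⟩ := h
  exact ⟨List.mem_of_getElem? h1, List.mem_of_getElem? h2, List.mem_of_getElem? h3⟩

theorem Consec.rel {l : List ℕ} {a b c : ℕ} {r : ℕ → ℕ → Prop} (hl : l.Pairwise r)
    (h : Consec l a b c) : r a b ∧ r b c := by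
  obtain ⟨i, h1, h2, h3⟩ := h
  obtain ⟨g1, rfl⟩ := List.getElem?_eq_some_iff.1 h1
  obtain ⟨g2, rfl⟩ := List.getElem?_eq_some_iff.1 h2
  obtain ⟨g3, rfl⟩ := List.getElem?_eq_some_iff.1 h3
  exact ⟨List.pairwise_iff_getElem.1 hl _ _ _ _ (by omega),
    List.pairwise_iff_getElem.1 hl _ _ _ _ (by omega)⟩

/-- Three consecutive entries of a concatenation lie in one of the parts or straddle the border;
therefore two entries at either end of a list are all that has to be known of it. -/
theorem consec_append {l₁ l₂ : List ℕ} {a b c : ℕ} : Consec (l₁ ++ l₂) a b c ↔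
    Consec l₁ a b c ∨ Consec l₂ a b c ∨
    (l₁.reverse[1]? = some a ∧ l₁.reverse[0]? = some b ∧ l₂[0]? = some c) ∨
    (l₁.reverse[0]? = some a ∧ l₂[0]? = some b ∧ l₂[1]? = some c) := by
  have hr : ∀ k x, l₁.reverse[k]? = some x ↔ k < l₁.length ∧ l₁[l₁.length - 1 - k]? = some x := by
    intro k x
    constructor
    · intro h
      have hk : k < l₁.length := by
        have := (List.getElem?_eq_some_iff.1 h).1
        simpa using this
      exact ⟨hk, by rwa [List.getElem?_reverse hk] at h⟩
    · rintro ⟨hk, h⟩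
      rwa [List.getElem?_reverse hk]
  constructor
  · rintro ⟨i, h1, h2, h3⟩
    rw [List.getElem?_append] at h1 h2 h3
    rcases lt_or_ge (i + 2) l₁.length with h | h
    · rw [if_pos (by omega)] at h1 h2 h3
      exact Or.inl ⟨i, h1, h2, h3⟩
    rcases Nat.lt_or_ge (i + 1) l₁.length with h' | h'
    · rw [if_pos (by omega)] at h1 h2
      rw [if_neg (by omega)] at h3
      refine Or.inr (Or.inr (Or.inl ⟨(hr _ _).2 ⟨by omega, ?_⟩, (hr _ _).2 ⟨by omega, ?_⟩, ?_⟩))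
      · rwa [show l₁.length - 1 - 1 = i by omega]
      · rwa [show l₁.length - 1 - 0 = i + 1 by omega]
      · rwa [show i + 2 - l₁.length = 0 by omega] at h3
    rcases Nat.lt_or_ge i l₁.length with h'' | h''
    · rw [if_pos (by omega)] at h1
      rw [if_neg (by omega)] at h2 h3
      refine Or.inr (Or.inr (Or.inr ⟨(hr _ _).2 ⟨by omega, ?_⟩, ?_, ?_⟩))
      · rwa [show l₁.length - 1 - 0 = i by omega]
      · rwa [show i + 1 - l₁.length = 0 by omega] at h2
      · rwa [show i + 2 - l₁.length = 1 by omega] at h3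
    · rw [if_neg (by omega)] at h1 h2 h3
      refine Or.inr (Or.inl ⟨i - l₁.length, h1, ?_, ?_⟩)
      · rwa [show i - l₁.length + 1 = i + 1 - l₁.length by omega]
      · rwa [show i - l₁.length + 2 = i + 2 - l₁.length by omega]
  · rintro (⟨i, h1, h2, h3⟩ | ⟨i, h1, h2, h3⟩ | ⟨h1, h2, h3⟩ | ⟨h1, h2, h3⟩)
    · have := (List.getElem?_eq_some_iff.1 h3).1
      refine ⟨i, ?_, ?_, ?_⟩ <;> rw [List.getElem?_append, if_pos (by omega)] <;> assumption
    · refine ⟨i + l₁.length, ?_, ?_, ?_⟩ <;> rw [List.getElem?_append, if_neg (by omega)]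
      · rwa [show i + l₁.length - l₁.length = i by omega]
      · rwa [show i + l₁.length + 1 - l₁.length = i + 1 by omega]
      · rwa [show i + l₁.length + 2 - l₁.length = i + 2 by omega]
    · rw [hr] at h1 h2
      refine ⟨l₁.length - 2, ?_, ?_, ?_⟩ <;> rw [List.getElem?_append]
      · rw [if_pos (by omega)]; exact h1.2
      · rw [if_pos (by omega), show l₁.length - 2 + 1 = l₁.length - 1 - 0 by omega]; exact h2.2
      · rwa [if_neg (by omega), show l₁.length - 2 + 2 - l₁.length = 0 by omega]
    · rw [hr] at h1
      refine ⟨l₁.length - 1, ?_, ?_, ?_⟩ <;> rw [List.getElem?_append]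
      · rw [if_pos (by omega)]; exact h1.2
      · rwa [if_neg (by omega), show l₁.length - 1 + 1 - l₁.length = 0 by omega]
      · rwa [if_neg (by omega), show l₁.length - 1 + 2 - l₁.length = 1 by omega]

/-- The entries of `l` whose cell, as determined by the two neighbors in `l`, ends somewhere, each
with the height at which it ends. -/
def deaths (X Y : ℕ → ℝ) (l : List ℕ) : Set (ℕ × ℝ) :=
  {e | ∃ a c, Consec l a e.1 c ∧ 0 < orient X Y a e.1 c ∧ e.2 = death X Y a e.1 c}

/-- If no site between two others has negative gap at height `t`, and `a` is at least as near to
`(x, t)` as its right neighbor, then it is at least as near as all sites to its right. -/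
theorem sqDist_le_of_chain {X Y : ℕ → ℝ} {x t : ℝ} {l : List ℕ} {a b : ℕ}
    (hl : (a :: b :: l).Pairwise fun p q => X p < X q)
    (hgap : ∀ p q r, Consec (a :: b :: l) p q r → 0 ≤ gap X Y p q r t)
    (hab : sqDist X Y a x t ≤ sqDist X Y b x t) :
    ∀ p ∈ b :: l, sqDist X Y a x t ≤ sqDist X Y p x t := by
  induction l generalizing a b with
  | nil => simpa using hab
  | cons c l ih =>
    have hbc : sqDist X Y b x t ≤ sqDist X Y c x t := by
      simp only [List.pairwise_cons, List.mem_cons] at hl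
      exact sqDist_le_right (hl.1 b (by simp)) (hl.2.1 c (by simp))
        (hgap a b c ⟨0, by simp, by simp, by simp⟩) hab
    intro p hp
    rcases List.mem_cons.1 hp with rfl | hp
    · exact hab
    · refine hab.trans (ih (List.pairwise_cons.1 hl).2 (fun p q r h => hgap p q r ?_) hbc p hp)
      obtain ⟨i, h⟩ := h
      exact ⟨i + 1, by simpa using h⟩

/-- The mirror image of `sqDist_le_of_chain`. -/
theorem sqDist_le_of_chain_left {X Y : ℕ → ℝ} {x t : ℝ} {l : List ℕ} {a b : ℕ}
    (hl : (b :: a :: l).Pairwise fun p q => X q < X p)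
    (hgap : ∀ p q r, Consec (b :: a :: l) r q p → 0 ≤ gap X Y p q r t)
    (hab : sqDist X Y b x t ≤ sqDist X Y a x t) :
    ∀ p ∈ a :: l, sqDist X Y b x t ≤ sqDist X Y p x t := by
  induction l generalizing a b with
  | nil => simpa using hab
  | cons c l ih =>
    have hbc : sqDist X Y a x t ≤ sqDist X Y c x t := by
      simp only [List.pairwise_cons, List.mem_cons] at hl
      exact sqDist_le_left (hl.2.1 c (by simp)) (hl.1 a (by simp))
        (hgap c a b ⟨0, by simp, by simp, by simp⟩) hab
    intro p hp
    rcases List.mem_cons.1 hp with rfl | hp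
    · exact hab
    · refine hab.trans (ih (List.pairwise_cons.1 hl).2 (fun p q r h => hgap p q r ?_) hbc p hp)
      obtain ⟨i, h⟩ := h
      exact ⟨i + 1, by simpa using h⟩

theorem Consec.reverse {l : List ℕ} {a b c : ℕ} (h : Consec l a b c) : Consec l.reverse c b a := by
  obtain ⟨i, h1, h2, h3⟩ := h
  have := (List.getElem?_eq_some_iff.1 h3).1
  refine ⟨l.length - 1 - (i + 2), ?_, ?_, ?_⟩ <;> rw [List.getElem?_reverse (by omega)]
  · rwa [show l.length - 1 - (l.length - 1 - (i + 2)) = i + 2 by omega]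
  · rwa [show l.length - 1 - (l.length - 1 - (i + 2) + 1) = i + 1 by omega]
  · rwa [show l.length - 1 - (l.length - 1 - (i + 2) + 2) = i by omega]

/-- The comparison made in binary search: compare the two sites at the border of two halves of
the list of sites. -/
theorem exists_nearest_append {X Y : ℕ → ℝ} {x t : ℝ} {l₁ l₂ : List ℕ} {a b : ℕ}
    (ha : l₁.reverse[0]? = some a) (hb : l₂[0]? = some b)
    (hl : (l₁ ++ l₂).Pairwise fun p q => X p < X q)
    (hgap : ∀ p q r, Consec (l₁ ++ l₂) p q r → 0 ≤ gap X Y p q r t) :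
    (sqDist X Y a x t ≤ sqDist X Y b x t → ∀ p ∈ l₂, sqDist X Y a x t ≤ sqDist X Y p x t) ∧
    (sqDist X Y b x t ≤ sqDist X Y a x t → ∀ p ∈ l₁, sqDist X Y b x t ≤ sqDist X Y p x t) := by
  obtain ⟨l₁', rfl⟩ : ∃ l, l₁ = l ++ [a] := by
    cases h : l₁.reverse with
    | nil => simp [h] at ha
    | cons y l =>
      simp [h] at ha
      exact ⟨l.reverse, by rw [← List.reverse_reverse l₁, h, List.reverse_cons, ha]⟩
  obtain ⟨l₂', rfl⟩ : ∃ l, l₂ = b :: l := by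
    cases l₂ with
    | nil => simp at hb
    | cons y l => simp at hb; exact ⟨l, by rw [hb]⟩
  have e : (l₁' ++ [a]) ++ b :: l₂' = l₁' ++ (a :: b :: l₂') := by simp
  have e' : ((l₁' ++ [a]) ++ b :: l₂') = (b :: a :: l₁'.reverse).reverse ++ l₂' := by simp
  constructor
  · intro hab
    refine sqDist_le_of_chain ?_ (fun p q r h => hgap p q r ?_) hab
    · rw [e] at hl; exact (List.pairwise_append.1 hl).2.1
    · rw [e, consec_append]; exact Or.inr (Or.inl h)
  · intro hab p hp
    refine sqDist_le_of_chain_left (l := l₁'.reverse) ?_ (fun p q r h => hgap p q r ?_) hab p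
      (by simpa [or_comm] using hp)
    · rw [e'] at hl; exact List.pairwise_reverse.1 (List.pairwise_append.1 hl).1
    · rw [e', consec_append]; exact Or.inl h.reverse

/-! ### The nodes of the sweep line tree -/

/-- Encoding of an optional number as a word. -/
def encode : Option ℕ → ℕ
  | none => 0
  | some p => p + 1

@[simp] theorem encode_none : encode none = 0 := rfl
@[simp] theorem encode_some (p : ℕ) : encode (some p) = p + 1 := rfl

theorem encode_pos {o : Option ℕ} : 0 < encode o ↔ ∃ p, o = some p := by
  cases o <;> simp

/-- The data at node `v` are those for the list `l` of sites: its first two entries, its last two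
entries, and the first entry whose cell ends. -/
structure SweepRep (m : ℕ) (X Y : ℕ → ℝ) (s : State) (v : ℕ) (l : List ℕ) : Prop where
  lt : ∀ p ∈ l, p < m
  fst : s.nat arrFst v = encode l[0]?
  snd : s.nat arrSnd v = encode l[1]?
  lst : s.nat arrLst v = encode l.reverse[0]?
  pen : s.nat arrPen v = encode l.reverse[1]?
  best : Best (s.nat arrWho v) (s.real arrTime v) (deaths X Y l)

theorem SweepRep.congr {m : ℕ} {X Y : ℕ → ℝ} {s s' : State} {v : ℕ} {l : List ℕ}
    (h : SweepRep m X Y s v l) (h1 : s'.nat arrFst v = s.nat arrFst v)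
    (h2 : s'.nat arrSnd v = s.nat arrSnd v) (h3 : s'.nat arrLst v = s.nat arrLst v)
    (h4 : s'.nat arrPen v = s.nat arrPen v) (h5 : s'.nat arrWho v = s.nat arrWho v)
    (h6 : s'.real arrTime v = s.real arrTime v) : SweepRep m X Y s' v l :=
  ⟨h.lt, h1 ▸ h.fst, h2 ▸ h.snd, h3 ▸ h.lst, h4 ▸ h.pen, by rw [h5, h6]; exact h.best⟩

theorem encode_getElem?_le {l : List ℕ} {m : ℕ} (h : ∀ p ∈ l, p < m) (i : ℕ) :
    encode l[i]? ≤ m := by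
  cases hi : l[i]? with
  | none => simp
  | some p => exact h p (List.mem_of_getElem? hi)

theorem SweepRep.le {m : ℕ} {X Y : ℕ → ℝ} {s : State} {v : ℕ} {l : List ℕ}
    (h : SweepRep m X Y s v l) : s.nat arrFst v ≤ m ∧ s.nat arrSnd v ≤ m ∧ s.nat arrLst v ≤ m ∧
      s.nat arrPen v ≤ m ∧ s.nat arrWho v ≤ m := by
  have hr : ∀ p ∈ l.reverse, p < m := fun p hp => h.lt p (List.mem_reverse.1 hp)
  refine ⟨?_, ?_, ?_, ?_, ?_⟩
  · rw [h.fst]; exact encode_getElem?_le h.lt 0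
  · rw [h.snd]; exact encode_getElem?_le h.lt 1
  · rw [h.lst]; exact encode_getElem?_le hr 0
  · rw [h.pen]; exact encode_getElem?_le hr 1
  · rcases h.best with h' | ⟨h1, ⟨a, c, h2, -⟩, -⟩
    · omega
    · have := h.lt _ h2.mem.2.1
      omega

@[simp] theorem NExp.val_setReal (s : State) (a i : ℕ) (v : ℝ) (e : NExp) :
    e.val (s.setReal a i v) = e.val s := by
  induction e <;> simp_all

@[simp] theorem NExp.ok_setReal (s : State) (a i : ℕ) (v : ℝ) (e : NExp) :
    e.Ok W (s.setReal a i v) ↔ e.Ok W s := by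
  induction e <;> simp_all

/-- If the cell of the middle one of three consecutive sites `a`, `b`, `c` ends, let it compete with
the best element at the current node.  Real arrays `8` and `9` hold the orientation and the height
at which the cell ends. -/
def consider (sx sy : ℕ) (a b c : NExp) : Cmd :=
  let X := RExp.get sx
  let Y := RExp.get sy
  let N := fun i => RExp.add (.mul (X i) (X i)) (.mul (Y i) (Y i))
  .seq (.setReal 8 (.const 0) (.sub (.mul (.sub (X b) (X a)) (.sub (Y c) (Y b)))
    (.mul (.sub (Y b) (Y a)) (.sub (X c) (X b))))) <|
  .ite (.realLt (.const 0) (.get 8 (.const 0)))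
    (.seq (.setReal 9 (.const 0) (.div
      (.sub (.mul (.sub (N c) (N b)) (.sub (X b) (X a)))
        (.mul (.sub (N b) (N a)) (.sub (X c) (X b))))
      (.mul (.const 2) (.get 8 (.const 0))))) <|
    .ite (.and (.natLt (.const 0) (.get arrWho (.scalar arrNode)))
      (.not (.realLt (.get 9 (.const 0)) (.get arrTime (.scalar arrNode))))) .skip
      (.seq (.setNat arrWho (.scalar arrNode) (.add b (.const 1)))
        (.setReal arrTime (.scalar arrNode) (.get 9 (.const 0))))) .skip

theorem consider_spec {sx sy : ℕ} {ea eb ec : NExp} {s : State} {v m a b c : ℕ} {X Y : ℕ → ℝ}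
    {C : Set (ℕ × ℝ)} (hx : sx < 6) (hy : sy < 6) (hX : s.real sx = X) (hY : s.real sy = Y)
    (hv : s.nat arrNode 0 = v) (hvW : v < W) (hm : m + 2 < W) (hw : s.nat arrWho v < W)
    (ha : ea.val s = a) (hb : eb.val s = b) (hc : ec.val s = c) (hbm : b < m)
    (ha' : ea.Ok W s) (hb' : eb.Ok W s) (hc' : ec.Ok W s)
    (hC : Best (s.nat arrWho v) (s.real arrTime v) C) :
    Ex W (consider sx sy ea eb ec) s fun t s' =>
      t ≤ 100 + 20 * (ea.cost + eb.cost + ec.cost) ∧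
      Best (s'.nat arrWho v) (s'.real arrTime v)
        (C ∪ {e | 0 < orient X Y a b c ∧ e = (b, death X Y a b c)}) ∧
      ∀ w ≠ v, s'.nat arrWho w = s.nat arrWho w ∧ s'.real arrTime w = s.real arrTime w := by
  have hx' : sx ≠ 6 ∧ sx ≠ 8 ∧ sx ≠ 9 := by omega
  have hy' : sy ≠ 6 ∧ sy ≠ 8 ∧ sy ≠ 9 := by omega
  refine (Ex.of_wp (Q := fun s' => Best (s'.nat arrWho v) (s'.real arrTime v)
        (C ∪ {e | 0 < orient X Y a b c ∧ e = (b, death X Y a b c)}) ∧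
      ∀ w ≠ v, s'.nat arrWho w = s.nat arrWho w ∧ s'.real arrTime w = s.real arrTime w) ?_).mono ?_
  · have ho : (X b - X a) * (Y c - Y b) - (Y b - Y a) * (X c - X b) = orient X Y a b c := rfl
    have hd : circumNum X Y a b c / (2 * orient X Y a b c) = death X Y a b c := rfl
    have hn : (X c * X c + Y c * Y c - (X b * X b + Y b * Y b)) * (X b - X a) -
      (X b * X b + Y b * Y b - (X a * X a + Y a * Y a)) * (X c - X b) = circumNum X Y a b c := rfl
    simp +contextual only [consider, Cmd.wp, NExp.Ok, RExp.Ok, BExp.Ok, BExp.Holds, NExp.val,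
      RExp.val, State.setReal_nat, State.setReal_real, State.setNat_nat, State.setNat_real,
      NExp.val_setReal, NExp.ok_setReal, hx', hy', hX, hY, ha, hb, hc, ha', hb', hc', hv, ho, hn,
      hd, true_and, and_true, and_self, if_true, if_false, false_and, Nat.reduceEqDiff,
      Int.cast_zero, Int.cast_ofNat, ne_eq, implies_true]
    refine ⟨by omega, by omega, fun h => ?_, fun h => ?_⟩
    · have hset : {e : ℕ × ℝ | e = (b, death X Y a b c)} = {(b, death X Y a b c)} :=
        Set.ofPred_eq_eq_singleton
      have hnew : Best (b + 1) (death X Y a b c) {(b, death X Y a b c)} :=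
        Or.inr ⟨by omega, by simp, by simp⟩
      rw [hset]
      refine ⟨⟨by omega, by omega, mul_ne_zero two_ne_zero h.ne'⟩, by omega, fun h' => ?_,
        fun h' => ?_⟩
      · exact hC.left hnew ⟨h'.1, fun _ => not_lt.1 h'.2⟩
      · refine ⟨by omega, by omega, hC.right hnew fun h0 => ⟨by omega, ?_⟩⟩
        by_contra hlt
        exact h' ⟨h0, fun h => hlt h.le⟩
    · have hset : {e : ℕ × ℝ | False} = ∅ := Set.ofPred_false
      rw [hset, Set.union_empty]
      exact hC
  · rintro t s' - ⟨ht, h⟩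
    refine ⟨?_, h⟩
    simp [consider] at ht
    omega

/-- Let the middle one of three sites compete, where the three words `x`, `y`, `z` encode optional
sites. -/
def considerIf (sx sy : ℕ) (x y z : NExp) : Cmd :=
  .ite (.and (.natLt (.const 0) x) (.natLt (.const 0) z))
    (consider sx sy (.sub x (.const 1)) (.sub y (.const 1)) (.sub z (.const 1))) .skip

theorem considerIf_spec {sx sy : ℕ} {x y z : NExp} {s : State} {v m : ℕ} {ox oy oz : Option ℕ}
    {X Y : ℕ → ℝ} {C : Set (ℕ × ℝ)} (hx : sx < 6) (hy : sy < 6) (hX : s.real sx = X)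
    (hY : s.real sy = Y) (hv : s.nat arrNode 0 = v) (hvW : v < W) (hm : m + 2 < W)
    (hw : s.nat arrWho v < W) (ha : x.val s = encode ox) (hb : y.val s = encode oy)
    (hc : z.val s = encode oz) (ho : ∀ a c, ox = some a → oz = some c → ∃ b < m, oy = some b)
    (ha' : x.Ok W s) (hb' : y.Ok W s) (hc' : z.Ok W s) (hcost : x.cost + y.cost + z.cost ≤ 30)
    (hC : Best (s.nat arrWho v) (s.real arrTime v) C) :
    Ex W (considerIf sx sy x y z) s fun t s' => t ≤ 900 ∧
      Best (s'.nat arrWho v) (s'.real arrTime v)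
        (C ∪ {e | ∃ a c, (ox = some a ∧ oy = some e.1 ∧ oz = some c) ∧
          0 < orient X Y a e.1 c ∧ e.2 = death X Y a e.1 c}) ∧
      ∀ w ≠ v, s'.nat arrWho w = s.nat arrWho w ∧ s'.real arrTime w = s.real arrTime w := by
  have hW0 : 0 < W ∧ 1 < W := by omega
  refine Ex.ite (by simp [ha', hc', hW0]) (fun h => ?_) (fun h => ?_)
  · simp only [BExp.Holds, NExp.val, ha, hc, encode_pos] at h
    obtain ⟨⟨a, rfl⟩, c, rfl⟩ := h
    obtain ⟨b, hbm, rfl⟩ := ho a c rfl rfl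
    refine (consider_spec (a := a) (b := b) (c := c) hx hy hX hY hv hvW hm hw (by simp [ha])
      (by simp [hb]) (by simp [hc]) hbm (by simp [ha', hW0]) (by simp [hb', hW0])
      (by simp [hc', hW0]) hC).mono ?_
    rintro t s' - ⟨ht, hB, hothers⟩
    refine ⟨?_, ?_, hothers⟩
    · simp at ht ⊢
      omega
    · convert hB using 2
      ext ⟨e, d⟩
      constructor
      · rintro ⟨a', c', ⟨h1, h2, h3⟩, h4, h5⟩
        simp only [Option.some.injEq] at h1 h2 h3
        subst h1 h2 h3
        exact ⟨h4, by rw [← h5]⟩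
      · rintro ⟨h1, h2⟩
        simp only [Prod.mk.injEq] at h2
        obtain ⟨rfl, rfl⟩ := h2
        exact ⟨a, c, ⟨rfl, rfl, rfl⟩, h1, rfl⟩
  · refine (Ex.of_wp (c := .skip) (Q := fun s' => s' = s) rfl).mono ?_
    rintro t s' - ⟨ht, rfl⟩
    refine ⟨?_, ?_, fun _ _ => ⟨rfl, rfl⟩⟩
    · simp at ht ⊢
      omega
    · convert hC using 1
      rw [Set.union_eq_left]
      rintro e ⟨a, c, ⟨rfl, -, rfl⟩, -⟩
      exact absurd ⟨by simp [ha], by simp [hc]⟩ h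

/-- Compute the first two entries at a node from those at its children. -/
def mergeFront : Cmd :=
  .ite (.natLt (.const 0) (.get arrFst lchild))
    (.seq (.setNat arrFst (.scalar arrNode) (.get arrFst lchild))
      (.ite (.natLt (.const 0) (.get arrSnd lchild))
        (.setNat arrSnd (.scalar arrNode) (.get arrSnd lchild))
        (.setNat arrSnd (.scalar arrNode) (.get arrFst rchild))))
    (.seq (.setNat arrFst (.scalar arrNode) (.get arrFst rchild))
      (.setNat arrSnd (.scalar arrNode) (.get arrSnd rchild)))

/-- Compute the last two entries at a node from those at its children. -/
def mergeBack : Cmd :=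
  .ite (.natLt (.const 0) (.get arrLst rchild))
    (.seq (.setNat arrLst (.scalar arrNode) (.get arrLst rchild))
      (.ite (.natLt (.const 0) (.get arrPen rchild))
        (.setNat arrPen (.scalar arrNode) (.get arrPen rchild))
        (.setNat arrPen (.scalar arrNode) (.get arrLst lchild))))
    (.seq (.setNat arrLst (.scalar arrNode) (.get arrLst lchild))
      (.setNat arrPen (.scalar arrNode) (.get arrPen lchild)))

theorem encode_append_zero (l₁ l₂ : List ℕ) : encode (l₁ ++ l₂)[0]? =
    if 0 < encode l₁[0]? then encode l₁[0]? else encode l₂[0]? := by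
  cases l₁ <;> simp

theorem encode_append_one (l₁ l₂ : List ℕ) : encode (l₁ ++ l₂)[1]? =
    if 0 < encode l₁[0]? then (if 0 < encode l₁[1]? then encode l₁[1]? else encode l₂[0]?)
    else encode l₂[1]? := by
  rcases l₁ with _ | ⟨a, _ | ⟨b, l⟩⟩ <;> simp

theorem mergeFront_spec {s : State} {v m : ℕ} {l₁ l₂ : List ℕ} (hv : s.nat arrNode 0 = v)
    (hv0 : 0 < v) (hvW : v + v + 1 < W) (hm : m < W) (hm₁ : ∀ p ∈ l₁, p < m)
    (hm₂ : ∀ p ∈ l₂, p < m)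
    (h₁ : s.nat arrFst (v + v) = encode l₁[0]?) (h₂ : s.nat arrSnd (v + v) = encode l₁[1]?)
    (h₃ : s.nat arrFst (v + v + 1) = encode l₂[0]?)
    (h₄ : s.nat arrSnd (v + v + 1) = encode l₂[1]?) :
    Ex W mergeFront s fun t s' => t ≤ 100 ∧ (s'.nat arrFst v = encode (l₁ ++ l₂)[0]? ∧
      s'.nat arrSnd v = encode (l₁ ++ l₂)[1]?) ∧
      ∀ w ≠ v, s'.nat arrFst w = s.nat arrFst w ∧ s'.nat arrSnd w = s.nat arrSnd w := by
  have b₁ := (encode_getElem?_le hm₁ 0).trans_lt hm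
  have b₂ := (encode_getElem?_le hm₁ 1).trans_lt hm
  have b₃ := (encode_getElem?_le hm₂ 0).trans_lt hm
  have b₄ := (encode_getElem?_le hm₂ 1).trans_lt hm
  have e1 : v ≠ 0 := by omega
  have e2 : v + v + 1 ≠ v := by omega
  have e3 : v + v < W ∧ v < W ∧ 1 < W ∧ 0 < W := by omega
  refine (Ex.of_wp (Q := fun s' => (s'.nat arrFst v = encode (l₁ ++ l₂)[0]? ∧
      s'.nat arrSnd v = encode (l₁ ++ l₂)[1]?) ∧
      ∀ w ≠ v, s'.nat arrFst w = s.nat arrFst w ∧ s'.nat arrSnd w = s.nat arrSnd w) ?_).mono ?_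
  · simp only [encode_append_zero, encode_append_one]
    simp +contextual [mergeFront, hv, h₁, h₂, h₃, h₄, b₁, b₂, b₃, b₄, e1, e2, e3, hvW]
  · rintro t s' - ⟨ht, h⟩
    simp [mergeFront] at ht
    exact ⟨by omega, h⟩

theorem mergeBack_spec {s : State} {v m : ℕ} {l₁ l₂ : List ℕ} (hv : s.nat arrNode 0 = v)
    (hv0 : 0 < v) (hvW : v + v + 1 < W) (hm : m < W) (hm₁ : ∀ p ∈ l₁, p < m)
    (hm₂ : ∀ p ∈ l₂, p < m)
    (h₁ : s.nat arrLst (v + v + 1) = encode l₁[0]?)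
    (h₂ : s.nat arrPen (v + v + 1) = encode l₁[1]?)
    (h₃ : s.nat arrLst (v + v) = encode l₂[0]?)
    (h₄ : s.nat arrPen (v + v) = encode l₂[1]?) :
    Ex W mergeBack s fun t s' => t ≤ 100 ∧ (s'.nat arrLst v = encode (l₁ ++ l₂)[0]? ∧
      s'.nat arrPen v = encode (l₁ ++ l₂)[1]?) ∧
      ∀ w ≠ v, s'.nat arrLst w = s.nat arrLst w ∧ s'.nat arrPen w = s.nat arrPen w := by
  have b₁ := (encode_getElem?_le hm₁ 0).trans_lt hm
  have b₂ := (encode_getElem?_le hm₁ 1).trans_lt hm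
  have b₃ := (encode_getElem?_le hm₂ 0).trans_lt hm
  have b₄ := (encode_getElem?_le hm₂ 1).trans_lt hm
  have e1 : v ≠ 0 := by omega
  have e2 : v + v + 1 ≠ v := by omega
  have e3 : v + v < W ∧ v < W ∧ 1 < W ∧ 0 < W := by omega
  refine (Ex.of_wp (Q := fun s' => (s'.nat arrLst v = encode (l₁ ++ l₂)[0]? ∧
      s'.nat arrPen v = encode (l₁ ++ l₂)[1]?) ∧
      ∀ w ≠ v, s'.nat arrLst w = s.nat arrLst w ∧ s'.nat arrPen w = s.nat arrPen w) ?_).mono ?_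
  · simp only [encode_append_zero, encode_append_one]
    simp +contextual [mergeBack, hv, h₁, h₂, h₃, h₄, b₁, b₂, b₃, b₄, e1, e2, e3, hvW]
  · rintro t s' - ⟨ht, h⟩
    simp [mergeBack] at ht
    exact ⟨by omega, h⟩

/-- Compute the data at a node of the sweep line tree from those at its children. -/
def mergeSites (sx sy : ℕ) : Cmd :=
  .seq mergeBest <|
  .seq (considerIf sx sy (.get arrPen lchild) (.get arrLst lchild) (.get arrFst rchild)) <|
  .seq (considerIf sx sy (.get arrLst lchild) (.get arrFst rchild) (.get arrSnd rchild)) <|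
  .seq mergeFront mergeBack

theorem deaths_append (X Y : ℕ → ℝ) (l₁ l₂ : List ℕ) : deaths X Y (l₁ ++ l₂) =
    ((deaths X Y l₁ ∪ deaths X Y l₂) ∪ {e | ∃ a c,
      (l₁.reverse[1]? = some a ∧ l₁.reverse[0]? = some e.1 ∧ l₂[0]? = some c) ∧
      0 < orient X Y a e.1 c ∧ e.2 = death X Y a e.1 c}) ∪ {e | ∃ a c,
      (l₁.reverse[0]? = some a ∧ l₂[0]? = some e.1 ∧ l₂[1]? = some c) ∧
      0 < orient X Y a e.1 c ∧ e.2 = death X Y a e.1 c} := by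
  ext e
  simp only [deaths, consec_append, Set.mem_union, Set.mem_ofPred_eq, or_and_right, exists_or,
    or_assoc]

/-- The two calls of `considerIf` are for the two triples that straddle the border of the children's
lists (`deaths_append`). -/
theorem mergeSites_spec {sx sy : ℕ} {s : State} {v m : ℕ} {l₁ l₂ : List ℕ} {X Y : ℕ → ℝ}
    (hx : sx < 6) (hy : sy < 6) (hX : s.real sx = X) (hY : s.real sy = Y)
    (hv : s.nat arrNode 0 = v) (hv0 : 0 < v) (hvW : v + v + 1 < W) (hm : m + 2 < W)
    (h₁ : SweepRep m X Y s (v + v) l₁) (h₂ : SweepRep m X Y s (v + v + 1) l₂) :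
    Ex W (mergeSites sx sy) s fun t s' => t ≤ 2080 ∧ s'.nat arrNode 0 = v ∧
      SweepRep m X Y s' v (l₁ ++ l₂) ∧ ∀ w ≠ v, ∀ l, SweepRep m X Y s w l →
        SweepRep m X Y s' w l := by
  obtain ⟨a1, a2, a3, a4, a5⟩ := h₁.le
  obtain ⟨b1, b2, b3, b4, b5⟩ := h₂.le
  have e3 : v + v < W ∧ v < W ∧ 1 < W ∧ 0 < W ∧ m < W := by omega
  have hm1 : ∀ p ∈ l₁.reverse, p < m := fun p hp => h₁.lt p (List.mem_reverse.1 hp)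
  have hm2 : ∀ p ∈ l₂.reverse, p < m := fun p hp => h₂.lt p (List.mem_reverse.1 hp)
  have hx6 : sx ≠ arrTime ∧ sx ≠ 8 ∧ sx ≠ 9 := by omega
  have hy6 : sy ≠ arrTime ∧ sy ≠ 8 ∧ sy ≠ 9 := by omega
  have hle : ∀ {w : ℕ} {t : ℝ} {C : Set (ℕ × ℝ)}, Best w t C → C ⊆ deaths X Y (l₁ ++ l₂) →
      w < W := by
    intro w t C h hC
    rcases h with h | ⟨h1, h2, -⟩
    · omega
    · obtain ⟨a, c, h3, -⟩ := hC h2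
      have := h3.mem.2.1
      have : w - 1 < m := by
        rcases List.mem_append.1 this with h | h
        exacts [h₁.lt _ h, h₂.lt _ h]
      omega
  rw [deaths_append] at hle
  refine Ex.seq (mergeBest_spec hv hvW (by omega) (by omega) h₁.best h₂.best) ?_
  rintro t₁ s₁ hf₁ ⟨ht₁, hB₁, ho₁⟩
  have n1 : ∀ a, a ≠ arrWho → s₁.nat a = s.nat a := fun a ha => hf₁.nat a (by simp [mergeBest, ha])
  refine Ex.seq (considerIf_spec (m := m) (X := X) (Y := Y) (ox := l₁.reverse[1]?)
    (oy := l₁.reverse[0]?) (oz := l₂[0]?) hx hy ?_ ?_ (by rw [n1 _ (by norm_num), hv]) (by omega) hm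
    (hle hB₁ (by intro e he; exact Or.inl (Or.inl he))) ?_ ?_ ?_ ?_ ?_ ?_ ?_ (by simp) hB₁) ?_
  · rw [hf₁.real _ (by simp [mergeBest, hx6]), hX]
  · rw [hf₁.real _ (by simp [mergeBest, hy6]), hY]
  · simp [n1, hv, h₁.pen]
  · simp [n1, hv, h₁.lst]
  · simp [n1, hv, h₂.fst]
  · intro a c ha _
    have : 0 < l₁.reverse.length := by have := (List.getElem?_eq_some_iff.1 ha).1; omega
    exact ⟨_, hm1 _ (List.getElem_mem this), List.getElem?_eq_getElem this⟩
  · simp [n1, hv]; omega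
  · simp [n1, hv]; omega
  · simp [n1, hv]; omega
  rintro t₂ s₂ hf₂ ⟨ht₂, hB₂, ho₂⟩
  have n2 : ∀ a, a ≠ arrWho → s₂.nat a = s.nat a := fun a ha => by
    rw [hf₂.nat a (by simp [considerIf, consider, ha]), n1 a ha]
  refine Ex.seq (considerIf_spec (m := m) (X := X) (Y := Y) (ox := l₁.reverse[0]?) (oy := l₂[0]?)
    (oz := l₂[1]?) hx hy ?_ ?_ (by rw [n2 _ (by norm_num), hv]) (by omega) hm
    (hle hB₂ (by intro e he; exact Or.inl he)) ?_ ?_ ?_ ?_ ?_ ?_ ?_ (by simp) hB₂) ?_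
  · rw [hf₂.real _ (by simp [considerIf, consider, hx6]), hf₁.real _ (by simp [mergeBest, hx6]), hX]
  · rw [hf₂.real _ (by simp [considerIf, consider, hy6]), hf₁.real _ (by simp [mergeBest, hy6]), hY]
  · simp [n2, hv, h₁.lst]
  · simp [n2, hv, h₂.fst]
  · simp [n2, hv, h₂.snd]
  · intro a c _ hc
    have : 0 < l₂.length := by have := (List.getElem?_eq_some_iff.1 hc).1; omega
    exact ⟨_, h₂.lt _ (List.getElem_mem this), List.getElem?_eq_getElem this⟩
  · simp [n2, hv]; omega
  · simp [n2, hv]; omega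
  · simp [n2, hv]; omega
  rintro t₃ s₃ hf₃ ⟨ht₃, hB₃, ho₃⟩
  rw [← deaths_append] at hB₃
  have n3 : ∀ a, a ≠ arrWho → s₃.nat a = s.nat a := fun a ha => by
    rw [hf₃.nat a (by simp [considerIf, consider, ha]), n2 a ha]
  refine Ex.seq (mergeFront_spec (l₁ := l₁) (l₂ := l₂) (v := v) (m := m) (by simp [n3, hv]) hv0 hvW
    (by omega) h₁.lt h₂.lt (by simp [n3, h₁.fst]) (by simp [n3, h₁.snd]) (by simp [n3, h₂.fst])
    (by simp [n3, h₂.snd])) ?_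
  rintro t₄ s₄ hf₄ ⟨ht₄, hF₄, ho₄⟩
  have n4 : ∀ a, a ≠ arrFst → a ≠ arrSnd → s₄.nat a = s₃.nat a := fun a ha hb =>
    hf₄.nat a (by simp [mergeFront, ha, hb])
  refine (mergeBack_spec (l₁ := l₂.reverse) (l₂ := l₁.reverse) (v := v) (m := m)
    (by simp [n4, n3, hv]) hv0 hvW (by omega) hm2 hm1 (by simp [n4, n3, h₂.lst])
    (by simp [n4, n3, h₂.pen]) (by simp [n4, n3, h₁.lst]) (by simp [n4, n3, h₁.pen])).mono ?_
  rintro t₅ s₅ hf₅ ⟨ht₅, hF₅, ho₅⟩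
  have n5 : ∀ a, a ≠ arrLst → a ≠ arrPen → s₅.nat a = s₄.nat a := fun a ha hb =>
    hf₅.nat a (by simp [mergeBack, ha, hb])
  have hr : s₅.real = s₃.real := by
    funext a
    rw [hf₅.real a (by simp [mergeBack]), hf₄.real a (by simp [mergeFront])]
  rw [← List.reverse_append] at hF₅
  refine ⟨by omega, by simp [n5, n4, n3, hv], ⟨?_, ?_, ?_, hF₅.1, hF₅.2, ?_⟩, ?_⟩
  · intro p hp
    rcases List.mem_append.1 hp with h | h
    exacts [h₁.lt _ h, h₂.lt _ h]
  · rw [n5 _ (by norm_num) (by norm_num), hF₄.1]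
  · rw [n5 _ (by norm_num) (by norm_num), hF₄.2]
  · rw [n5 _ (by norm_num) (by norm_num), n4 _ (by norm_num) (by norm_num), hr]
    exact hB₃
  · intro w hw l h
    refine h.congr ?_ ?_ ?_ ?_ ?_ ?_
    · rw [n5 _ (by norm_num) (by norm_num), (ho₄ w hw).1, n3 _ (by norm_num)]
    · rw [n5 _ (by norm_num) (by norm_num), (ho₄ w hw).2, n3 _ (by norm_num)]
    · rw [(ho₅ w hw).1, n4 _ (by norm_num) (by norm_num), n3 _ (by norm_num)]
    · rw [(ho₅ w hw).2, n4 _ (by norm_num) (by norm_num), n3 _ (by norm_num)]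
    · rw [n5 _ (by norm_num) (by norm_num), n4 _ (by norm_num) (by norm_num), (ho₃ w hw).1,
        (ho₂ w hw).1, (ho₁ w hw).1]
    · rw [hr, (ho₃ w hw).2, (ho₂ w hw).2, (ho₁ w hw).2]

theorem updatePath_mergeSites_spec {sx sy m D leaf : ℕ} {X Y : ℕ → ℝ} {occ occ' : ℕ → Option ℕ}
    {s₀ : State} (hx : sx < 6) (hy : sy < 6) (hX : s₀.real sx = X) (hY : s₀.real sy = Y)
    (hm : m + 2 < W) (hW : 2 * 2 ^ D < W) (hl : s₀.nat arrNode 0 = leaf)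
    (h1 : 2 ^ D ≤ leaf) (h2 : leaf < 2 ^ (D + 1)) (hocc : ∀ w ≠ leaf, occ' w = occ w)
    (hold : ∀ h ≤ D, ∀ v, 2 ^ (D - h) ≤ v → v < 2 ^ (D - h + 1) → v ≠ leaf →
      SweepRep m X Y s₀ v (leafList occ h v))
    (hnew : SweepRep m X Y s₀ leaf (occ' leaf).toList) :
    Ex W (updatePath (mergeSites sx sy)) s₀ fun t s' =>
      t ≤ 2100 * (D + 1) ∧ TreeRep (SweepRep m X Y) D occ' s' := by
  have hx6 : sx ≠ arrTime ∧ sx ≠ 8 ∧ sx ≠ 9 := by omega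
  have hy6 : sy ≠ arrTime ∧ sy ≠ 8 ∧ sy ≠ 9 := by omega
  refine updatePath_spec (B := 2080) ?_ ?_ hW hl h1 h2 hocc hold hnew
  · intro s v l₁ l₂ hf hv hv0 hvD hR₁ hR₂
    rw [two_mul] at hR₁ hR₂
    refine mergeSites_spec hx hy ?_ ?_ hv hv0 (by omega) hm hR₁ hR₂
    · rw [hf.real _ (by simp [updatePath, mergeSites, mergeBest, considerIf, consider, mergeFront,
        mergeBack, hx6]), hX]
    · rw [hf.real _ (by simp [updatePath, mergeSites, mergeBest, considerIf, consider, mergeFront,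
        mergeBack, hy6]), hY]
  · intro s s' v l hn hr h
    refine h.congr ?_ ?_ ?_ ?_ ?_ ?_
    · rw [hn _ (by norm_num)]
    · rw [hn _ (by norm_num)]
    · rw [hn _ (by norm_num)]
    · rw [hn _ (by norm_num)]
    · rw [hn _ (by norm_num)]
    · rw [hr]

/-! ### The sweep -/

-- Word arrays of the sweep: the sites by first coordinate, the ranks of the first coordinates, the
-- sites and the query points by second coordinate; then scalars: the numbers of inserted sites and
-- of answered queries, the current site, the current query, a flag, and a counter.
notation "arrByX" => (16 : ℕ)
notation "arrRank" => (17 : ℕ)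
notation "arrByY" => (18 : ℕ)
notation "arrByQ" => (19 : ℕ)
notation "arrIns" => (20 : ℕ)
notation "arrAns" => (21 : ℕ)
notation "arrSite" => (22 : ℕ)
notation "arrQuery" => (23 : ℕ)
notation "arrFlag" => (24 : ℕ)
notation "arrCur" => (25 : ℕ)

/-- The number of proper increases of the key `K` among the first `k + 1` terms of `σ`. -/
noncomputable def denseRank (K : ℕ → ℝ) (σ : ℕ → ℕ) : ℕ → ℕ
  | 0 => 0
  | k + 1 => denseRank K σ k + if K (σ k) < K (σ (k + 1)) then 1 else 0

theorem denseRank_le (K : ℕ → ℝ) (σ : ℕ → ℕ) (k : ℕ) : denseRank K σ k ≤ k := by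
  induction k with
  | zero => rfl
  | succ k ih => unfold denseRank; split_ifs <;> omega

/-- In a sorted sequence, dense ranks compare like keys. -/
theorem denseRank_mono {K : ℕ → ℝ} {σ : ℕ → ℕ} {m i j : ℕ} (h : IsSorting K m σ) (hij : i ≤ j)
    (hj : j < m) : (K (σ i) = K (σ j) → denseRank K σ i = denseRank K σ j) ∧
      (K (σ i) < K (σ j) → denseRank K σ i < denseRank K σ j) := by
  suffices H : denseRank K σ i ≤ denseRank K σ j ∧
      (K (σ i) = K (σ j) → denseRank K σ i = denseRank K σ j) ∧
      (K (σ i) < K (σ j) → denseRank K σ i < denseRank K σ j) from H.2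
  induction j, hij using Nat.le_induction with
  | base => simp
  | succ j hij ih =>
    obtain ⟨h1, h2, h3⟩ := ih (by omega)
    have hm := h.mono i j hij (by omega)
    have hm' := h.mono j (j + 1) (by omega) hj
    have hsucc : denseRank K σ (j + 1) =
        denseRank K σ j + if K (σ j) < K (σ (j + 1)) then 1 else 0 := rfl
    rw [hsucc]
    split_ifs with hlt
    · exact ⟨by omega, fun he => absurd he (hm.trans_lt hlt).ne, fun _ => by omega⟩
    · rw [hm'.antisymm (not_lt.1 hlt)] at h2 h3
      exact ⟨by omega, by simpa using h2, by simpa using h3⟩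

/-- Store the rank of the first coordinate of every site, the same for equal coordinates.  In the
first round, subtraction truncates and the first site is compared with itself. -/
def computeRanks (sx c : ℕ) : Cmd :=
  .seq (.seq (.setNat arrCtr (.const 0) (.const 0)) (.setNat arrCur (.const 0) (.const 0))) <|
  .while (.natLt (.scalar arrCtr) (.get 0 (.const c))) <|
    .seq (.ite (.realLt (.get sx (.get arrByX (.sub (.scalar arrCtr) (.const 1))))
        (.get sx (.get arrByX (.scalar arrCtr))))
      (.setNat arrCur (.const 0) (.add (.scalar arrCur) (.const 1))) .skip) <|
    .seq (.setNat arrRank (.get arrByX (.scalar arrCtr)) (.scalar arrCur)) <|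
    .setNat arrCtr (.const 0) (.add (.scalar arrCtr) (.const 1))

/-- `rank` numbers the sites by increasing first coordinate, with equal numbers for equal
coordinates. -/
structure IsRanking (X : ℕ → ℝ) (m : ℕ) (rank : ℕ → ℕ) : Prop where
  lt : ∀ p < m, rank p < m
  rank_lt : ∀ p < m, ∀ q < m, X p < X q → rank p < rank q
  rank_eq : ∀ p < m, ∀ q < m, X p = X q → rank p = rank q

theorem IsRanking.lt_of_rank_lt {X : ℕ → ℝ} {m : ℕ} {rank : ℕ → ℕ} (h : IsRanking X m rank)
    {p q : ℕ} (hp : p < m) (hq : q < m) (hr : rank p < rank q) : X p < X q := by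
  rcases lt_trichotomy (X p) (X q) with h' | h' | h'
  · exact h'
  · have := h.rank_eq p hp q hq h'; omega
  · have := h.rank_lt q hq p hp h'; omega

theorem IsRanking.eq_of_rank_eq {X : ℕ → ℝ} {m : ℕ} {rank : ℕ → ℕ} (h : IsRanking X m rank)
    {p q : ℕ} (hp : p < m) (hq : q < m) (hr : rank p = rank q) : X p = X q := by
  rcases lt_trichotomy (X p) (X q) with h' | h' | h'
  · have := h.rank_lt p hp q hq h'; omega
  · exact h'
  · have := h.rank_lt q hq p hp h'; omega

theorem computeRanks_spec {sx c m : ℕ} {s₀ : State} (hc : s₀.nat 0 c = m) (hcW : c < W)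
    (hm : 1 ≤ m) (hW : 8 * m + 8 < W) (hσ : IsSorting (s₀.real sx) m (s₀.nat arrByX)) :
    Ex W (computeRanks sx c) s₀ fun t s' => t ≤ 100 * m ∧
      IsRanking (s₀.real sx) m (s'.nat arrRank) := by
  set X := s₀.real sx with hX
  set σ := s₀.nat arrByX with hσ'
  refine Ex.seq (Ex.of_wp (Q := fun s => s.nat arrCtr 0 = 0 ∧ s.nat arrCur 0 = 0 ∧
    s.nat 0 c = m ∧ s.nat arrByX = σ ∧ s.real = s₀.real) ?_) ?_
  · simp [hc]
    exact ⟨by omega, funext fun j => by simp [hσ']⟩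
  rintro t₁ s₁ - ⟨ht₁, h1, h1', hc1, hσ1, hr1⟩
  refine (Ex.loop (γ := ℕ) (fun k s => s.nat arrCtr 0 = k ∧ k ≤ m ∧
    s.nat arrCur 0 = denseRank X σ (k - 1) ∧
    ∀ i < k, s.nat arrRank (σ i) = denseRank X σ i) (fun k => (m - k) * 60) 0
    ⟨h1, by omega, h1', by simp⟩ ?_ ?_).mono ?_
  · rintro k s hf ⟨hs, hk, -⟩
    have := hf.nat 0 (by simp)
    simp [hs, this, hc1]
    omega
  · rintro k s hf ⟨hs, hk, hcur, hrank⟩ hlt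
    have h0 := hf.nat 0 (by simp)
    have hσs : s.nat arrByX = σ := by rw [hf.nat arrByX (by simp), hσ1]
    have hXs : s.real sx = X := by rw [hf.real sx (by simp), hr1]
    simp [hs, h0, hc1] at hlt
    have hσk := hσ.lt k hlt
    have hσk' := hσ.lt (k - 1) (by omega)
    have hle := denseRank_le X σ (k - 1)
    refine Ex.seq (Ex.of_wp (Q := fun s' => s'.nat arrCtr 0 = k ∧
      s'.nat arrCur 0 = denseRank X σ k ∧ s'.nat arrByX = σ ∧ s'.nat arrRank = s.nat arrRank)
      ?_) ?_
    · have hk0 : denseRank X σ k = denseRank X σ (k - 1) +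
          if X (σ (k - 1)) < X (σ k) then 1 else 0 := by
        rcases k with _ | k
        · simp
        · rw [Nat.add_sub_cancel]; rfl
      simp [hs, hσs, hXs, hcur, hk0]
      exact ⟨by omega, fun h => ⟨by omega, h, funext fun j => by simp [hσs],
        funext fun j => by simp⟩⟩
    rintro t₂ s₂ - ⟨ht₂, hs2, hcur2, hσ2, hrank2⟩
    have hle' := denseRank_le X σ k
    refine (Ex.of_wp (Q := fun s' => s'.nat arrCtr 0 = k + 1 ∧
      s'.nat arrCur 0 = denseRank X σ k ∧
      ∀ i < k + 1, s'.nat arrRank (σ i) = denseRank X σ i) ?_).mono ?_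
    · simp [hs2, hσ2, hcur2, hrank2]
      refine ⟨by omega, by omega, fun i hi => ?_⟩
      split_ifs with h
      · exact ((denseRank_mono hσ hi hlt).1 (by rw [h])).symm
      · rcases hi.lt_or_eq with h' | rfl
        · exact hrank i h'
        · exact absurd rfl h
    · rintro t s' - ⟨ht, h1, h2, h3⟩
      refine ⟨k + 1, ⟨h1, hlt, by simpa using h2, h3⟩, ?_⟩
      simp at ht ht₂ ⊢
      omega
  · rintro t s' hf ⟨k, ⟨hs, hk, -, hrank⟩, hn, ht⟩
    have h0 : s'.nat 0 c = m := by rw [hf.nat 0 (by simp), hc1]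
    obtain rfl : k = m := by simp [hs, h0] at hn; omega
    refine ⟨?_, ⟨?_, ?_, ?_⟩⟩
    · simp at ht₁ ht
      omega
    · intro p hp
      obtain ⟨i, hi, rfl⟩ := hσ.surj p hp
      rw [hrank i hi]
      exact (denseRank_le X σ i).trans_lt hi
    · intro p hp q hq h
      obtain ⟨i, hi, rfl⟩ := hσ.surj p hp
      obtain ⟨j, hj, rfl⟩ := hσ.surj q hq
      rw [hrank i hi, hrank j hj]
      rcases le_total i j with hij | hij
      · exact (denseRank_mono hσ hij hj).2 h
      · exact absurd h (not_lt.2 (hσ.mono j i hij hi))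
    · intro p hp q hq h
      obtain ⟨i, hi, rfl⟩ := hσ.surj p hp
      obtain ⟨j, hj, rfl⟩ := hσ.surj q hq
      rw [hrank i hi, hrank j hj]
      rcases le_total i j with hij | hij
      · exact (denseRank_mono hσ hij hj).1 h
      · exact ((denseRank_mono hσ hij hi).1 h.symm).symm

/-- The squared distance between the site `p` and the query point `u`. -/
def distExp (sx sy qx qy : ℕ) (p u : NExp) : RExp :=
  .add (.mul (.sub (.get sx p) (.get qx u)) (.sub (.get sx p) (.get qx u)))
    (.mul (.sub (.get sy p) (.get qy u)) (.sub (.get sy p) (.get qy u)))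

/-- Descend from the root of the sweep line tree to a leaf that carries a site nearest to the query
point. -/
def locate (sx sy qx qy : ℕ) : Cmd :=
  .seq (.setNat arrNode (.const 0) (.const 1)) <|
  .while (.natLt (.scalar arrNode) (.scalar arrSize)) <|
    .ite (.natLt (.const 0) (.get arrFst rchild))
      (.ite (.natLt (.const 0) (.get arrFst lchild))
        (.ite (.realLt
            (distExp sx sy qx qy (.sub (.get arrFst rchild) (.const 1)) (.scalar arrQuery))
            (distExp sx sy qx qy (.sub (.get arrLst lchild) (.const 1)) (.scalar arrQuery)))
          (.setNat arrNode (.const 0) rchild) (.setNat arrNode (.const 0) lchild))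
        (.setNat arrNode (.const 0) rchild))
      (.setNat arrNode (.const 0) lchild)

/-- The descent keeps to nodes below which some active site is as near as any active site. -/
theorem locate_spec {sx sy qx qy m u D : ℕ} {X Y : ℕ → ℝ} {x t : ℝ} {occ : ℕ → Option ℕ}
    {s₀ : State} (hX : s₀.real sx = X) (hY : s₀.real sy = Y) (hx : s₀.real qx u = x)
    (ht : s₀.real qy u = t) (hu : s₀.nat arrQuery 0 = u) (huW : u < W) (hm : m < W)
    (hW : 2 * 2 ^ D < W) (hD : s₀.nat arrSize 0 = 2 ^ D)
    (hT : TreeRep (SweepRep m X Y) D occ s₀)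
    (hocc : (leafList occ D 1).Pairwise fun p q => X p < X q)
    (hgap : ∀ a b c, Consec (leafList occ D 1) a b c → 0 ≤ gap X Y a b c t) :
    Ex W (locate sx sy qx qy) s₀ fun tm s' => tm ≤ 220 * (D + 1) ∧
      ∃ v, s'.nat arrNode 0 = v ∧ 2 ^ D ≤ v ∧ v < 2 ^ (D + 1) ∧
        ∀ p ∈ leafList occ D 1, ∃ q, occ v = some q ∧ sqDist X Y q x t ≤ sqDist X Y p x t := by
  have hDpos : 0 < 2 ^ D := by positivity
  refine Ex.seq (Ex.of_wp (Q := fun s => s.nat arrNode 0 = 1 ∧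
    (∀ a, a ≠ arrNode → s.nat a = s₀.nat a) ∧ s.real = s₀.real) ?_) ?_
  · simp
    exact ⟨by omega, fun a ha => funext fun j => by simp [ha]⟩
  rintro t₁ s₁ - ⟨ht₁, hn1, ho1, hr1⟩
  refine (Ex.loop (γ := ℕ × ℕ) (fun g s => s.nat arrNode 0 = g.2 ∧ g.1 ≤ D ∧
    2 ^ (D - g.1) ≤ g.2 ∧ g.2 < 2 ^ (D - g.1 + 1) ∧
    (leafList occ g.1 g.2).Pairwise (fun p q => X p < X q) ∧
    (∀ a b c, Consec (leafList occ g.1 g.2) a b c → 0 ≤ gap X Y a b c t) ∧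
    ∀ p ∈ leafList occ D 1, ∃ q ∈ leafList occ g.1 g.2, sqDist X Y q x t ≤ sqDist X Y p x t)
    (fun g => g.1 * 200) (D, 1) ⟨hn1, le_rfl, by simp, by simp, hocc, hgap,
      fun p hp => ⟨p, hp, le_rfl⟩⟩ ?_ ?_).mono ?_
  · rintro ⟨h, v⟩ s hf ⟨hs, hh, hv1, hv2, -⟩
    have h1 := hf.nat arrSize (by simp)
    have h2 : 2 ^ (D - h + 1) ≤ 2 ^ (D + 1) := Nat.pow_le_pow_right (by norm_num) (by omega)
    have h3 : 2 ^ (D + 1) = 2 * 2 ^ D := by ring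
    dsimp only at hs hv1 hv2
    simp [hs, h1, ho1, hD]
    omega
  · rintro ⟨h, v⟩ s hf ⟨hs, hh, hv1, hv2, hpw, hg, hdom⟩ hlt
    dsimp only at hs hh hv1 hv2 hpw hg hdom
    have hn : ∀ a, a ≠ arrNode → s.nat a = s₀.nat a := fun a ha => by
      rw [hf.nat a (by simp [ha]), ho1 a ha]
    have hr : s.real = s₀.real := by
      funext a
      rw [hf.real a (by simp), hr1]
    simp [hs, hn, hD] at hlt
    obtain ⟨h, rfl⟩ : ∃ h', h = h' + 1 := by
      refine Nat.exists_eq_succ_of_ne_zero ?_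
      rintro rfl
      simp at hv1
      omega
    have hDh : D - h = D - (h + 1) + 1 := by omega
    have hl1 : 2 ^ (D - h) ≤ 2 * v ∧ 2 * v < 2 ^ (D - h + 1) := by
      rw [hDh, pow_succ, pow_succ] at *; omega
    have hl2 : 2 ^ (D - h) ≤ 2 * v + 1 ∧ 2 * v + 1 < 2 ^ (D - h + 1) := by
      rw [hDh, pow_succ, pow_succ] at *; omega
    have R₁ := hT h (by omega) _ hl1.1 hl1.2
    have R₂ := hT h (by omega) _ hl2.1 hl2.2
    rw [leafList_succ] at hpw hg hdom
    set l₁ := leafList occ h (2 * v)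
    set l₂ := leafList occ h (2 * v + 1)
    rw [two_mul] at R₁ R₂
    obtain ⟨a1, -, a3, -, -⟩ := R₁.le
    obtain ⟨b1, -, -, -, -⟩ := R₂.le
    have hWs : v < W ∧ v + v < W ∧ v + v + 1 < W ∧ 0 < W ∧ 1 < W := by omega
    -- the sites below the chosen child are at least as good as those below its sibling
    refine (Ex.of_wp (Q := fun s' => ∃ v', s'.nat arrNode 0 = v' ∧
      ((v' = v + v ∧ ∀ p ∈ l₂, ∃ q ∈ l₁, sqDist X Y q x t ≤ sqDist X Y p x t) ∨
      (v' = v + v + 1 ∧ ∀ p ∈ l₁, ∃ q ∈ l₂, sqDist X Y q x t ≤ sqDist X Y p x t))) ?_).mono ?_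
    · have hsq : ∀ p, (X p - x) * (X p - x) + (Y p - t) * (Y p - t) = sqDist X Y p x t :=
        fun p => rfl
      have nil_of : ∀ l : List ℕ, encode l[0]? = 0 → l = [] := by
        rintro (_ | ⟨a, l⟩) <;> simp
      have hsome : ∀ l : List ℕ, l ≠ [] → ∃ p, l[0]? = some p ∧ p ∈ l := by
        rintro (_ | ⟨a, l⟩) <;> simp
      have hB₁ : encode l₁[0]? < W := by rw [← R₁.fst]; omega
      have hB₂ : encode l₂[0]? < W := by rw [← R₂.fst]; omega
      have hB₃ : encode l₁.reverse[0]? < W := by rw [← R₁.lst]; omega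
      simp only [Cmd.wp, BExp.Ok, BExp.Holds, NExp.Ok, NExp.val, RExp.Ok, RExp.val, distExp, hs, hn,
        ne_eq, Nat.reduceEqDiff, not_false_eq_true, R₁.fst, R₂.fst, R₁.lst, hX, hY, hx, ht, hu, hr,
        hsq, hWs, huW, hB₁, hB₂, hB₃, and_true, State.setNat_nat, if_true,
        exists_eq_left', true_and]
      refine ⟨fun h2 => ⟨fun h1 => ?_, fun h1 => ?_⟩, fun h2 => ?_⟩
      · have hne₁ : l₁ ≠ [] := by rintro h; simp [h] at h1
        have hne₂ : l₂ ≠ [] := by rintro h; simp [h] at h2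
        obtain ⟨a, ha, ha'⟩ := hsome l₁.reverse (by simpa using hne₁)
        obtain ⟨b, hb, hb'⟩ := hsome l₂ hne₂
        have H := exists_nearest_append (x := x) ha hb hpw hg
        rw [ha, hb]
        simp only [encode_some, Nat.add_sub_cancel]
        exact ⟨fun hlt => Or.inr (fun p hp => ⟨b, hb', H.2 hlt.le p hp⟩),
          fun hlt => Or.inl (fun p hp => ⟨a, List.mem_reverse.1 ha',
            H.1 (not_lt.1 hlt) p hp⟩)⟩
      · rw [nil_of l₁ (by omega)]
        exact Or.inr (by simp)
      · rw [nil_of l₂ (by omega)]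
        exact Or.inl (by simp)
    · rintro tm s' - ⟨htm, v', hv', hor⟩
      have key : ∀ l l' : List ℕ, (∀ p ∈ l', ∃ q ∈ l, sqDist X Y q x t ≤ sqDist X Y p x t) →
          (∀ p ∈ leafList occ D 1, ∃ q, (q ∈ l ∨ q ∈ l') ∧ sqDist X Y q x t ≤ sqDist X Y p x t) →
          ∀ p ∈ leafList occ D 1, ∃ q ∈ l, sqDist X Y q x t ≤ sqDist X Y p x t := by
        intro l l' h1 h2 p hp
        obtain ⟨q, hq | hq, hle⟩ := h2 p hp
        · exact ⟨q, hq, hle⟩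
        · obtain ⟨q', hq', hle'⟩ := h1 q hq
          exact ⟨q', hq', hle'.trans hle⟩
      have hcost : tm + (BExp.natLt (.scalar arrNode) (.scalar arrSize)).cost + 1 + h * 200 ≤
          (h + 1) * 200 := by
        simp [distExp] at htm ⊢
        omega
      rcases hor with ⟨rfl, hl⟩ | ⟨rfl, hl⟩
      · refine ⟨(h, 2 * v), ⟨by rw [hv', two_mul], by simp only; omega, hl1.1, hl1.2,
          (List.pairwise_append.1 hpw).1, fun a b c hc => hg a b c (consec_append.2 (Or.inl hc)),
          key l₁ l₂ hl fun p hp => ?_⟩, hcost⟩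
        obtain ⟨q, hq, hle⟩ := hdom p hp
        exact ⟨q, List.mem_append.1 hq, hle⟩
      · refine ⟨(h, 2 * v + 1), ⟨by rw [hv', two_mul], by simp only; omega, hl2.1, hl2.2,
          (List.pairwise_append.1 hpw).2.1,
          fun a b c hc => hg a b c (consec_append.2 (Or.inr (Or.inl hc))),
          key l₂ l₁ hl fun p hp => ?_⟩, hcost⟩
        obtain ⟨q, hq, hle⟩ := hdom p hp
        exact ⟨q, (List.mem_append.1 hq).symm, hle⟩
  · rintro tm s' hf ⟨⟨h, v⟩, ⟨hs, hh, hv1, hv2, hpw, hg, hdom⟩, hn, htm⟩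
    dsimp only at hs hh hv1 hv2 hpw hg hdom
    have hsz : s'.nat arrSize 0 = 2 ^ D := by
      rw [hf.nat arrSize (by simp), ho1 _ (by norm_num), hD]
    simp [hs, hsz] at hn
    obtain rfl : h = 0 := by
      by_contra hne
      have : 2 ^ (D - h + 1) ≤ 2 ^ D := Nat.pow_le_pow_right (by norm_num) (by omega)
      omega
    refine ⟨?_, v, hs, hn, by simpa using hv2, fun p hp => ?_⟩
    · simp at ht₁ htm
      omega
    · obtain ⟨q, hq, hle⟩ := hdom p hp
      rw [leafList_zero] at hq
      exact ⟨q, by simpa using hq, hle⟩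

/-- The word `w` encodes a site nearest to the point `(x, t)` among the sites that are not above it:
it is one more than the number of the site, and `0` if there is none. -/
def IsNearestBelow (X Y : ℕ → ℝ) (m : ℕ) (x t : ℝ) (w : ℕ) : Prop :=
  (w = 0 ∧ ∀ p < m, t < Y p) ∨ (0 < w ∧ w - 1 < m ∧ ∀ p < m, Y p ≤ t →
    sqDist X Y (w - 1) x t ≤ sqDist X Y p x t)

/-- The data that stay fixed during a sweep: `m` sites `(X p, Y p)` and `nq` query points
`(QX u, QY u)`, numbers for the first coordinates of the sites, the orders of the sites and of the
query points by second coordinate, and the height `D` of the sweep line tree. -/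
structure Sweep where
  (m nq D : ℕ)
  (X Y QX QY : ℕ → ℝ)
  (rank byY byQ : ℕ → ℕ)
  ranking : IsRanking X m rank
  sortY : IsSorting Y m byY
  sortQ : IsSorting QY nq byQ
  m_le : m ≤ 2 ^ D

namespace Sweep

/-- The situation after `k` sites have been inserted and `j` queries have been answered, where `occ`
gives the active sites: on and above the current sweep line, inactive sites are never strictly
nearest among the inserted ones. -/
structure Inv (A : Sweep) (k j : ℕ) (occ : ℕ → Option ℕ) : Prop where
  k_le : k ≤ A.m
  j_le : j ≤ A.nq
  occ_eq : ∀ v p, occ v = some p → v = 2 ^ A.D + A.rank p ∧ ∃ i < k, A.byY i = p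
  below : j < A.nq → ∀ i < k, A.Y (A.byY i) ≤ A.QY (A.byQ j)
  dom : j < A.nq → ∀ i < k, ∀ x t, A.QY (A.byQ j) ≤ t → ∃ v q, occ v = some q ∧
    sqDist A.X A.Y q x t ≤ sqDist A.X A.Y (A.byY i) x t

variable {A : Sweep} {k j : ℕ} {occ : ℕ → Option ℕ}

theorem inv_zero (A : Sweep) : A.Inv 0 0 fun _ => none :=
  ⟨Nat.zero_le _, Nat.zero_le _, by simp, by simp, by simp⟩

theorem Inv.lt (h : A.Inv k j occ) {v p : ℕ} (hv : occ v = some p) : p < A.m := by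
  obtain ⟨-, i, hi, rfl⟩ := h.occ_eq v p hv
  exact A.sortY.lt i (hi.trans_le h.k_le)

theorem leaf_lt (A : Sweep) {p : ℕ} (hp : p < A.m) : 2 ^ A.D + A.rank p < 2 ^ (A.D + 1) := by
  have := A.ranking.lt p hp
  have := A.m_le
  rw [pow_succ]
  omega

theorem Inv.mem_root (h : A.Inv k j occ) {v p : ℕ} (hv : occ v = some p) :
    p ∈ leafList occ A.D 1 := by
  refine mem_leafList.2 ⟨v, ?_, hv⟩
  have h1 := (h.occ_eq v p hv).1
  have h2 := A.leaf_lt (h.lt hv)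
  rw [pow_succ] at h2
  rw [Nat.div_eq_iff (by positivity)]
  omega

theorem Inv.occ_of_mem (h : A.Inv k j occ) {p : ℕ} (hp : p ∈ leafList occ A.D 1) :
    occ (2 ^ A.D + A.rank p) = some p := by
  obtain ⟨w, -, hw⟩ := mem_leafList.1 hp
  rwa [← (h.occ_eq w p hw).1]

theorem Inv.pairwise (h : A.Inv k j occ) :
    (leafList occ A.D 1).Pairwise fun p q => A.X p < A.X q := by
  refine leafList_pairwise (fun v w p q hvw hp hq => ?_) _ _
  have h1 := (h.occ_eq v p hp).1
  have h2 := (h.occ_eq w q hq).1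
  exact A.ranking.lt_of_rank_lt (h.lt hp) (h.lt hq) (by omega)

/-- A new site replaces the active site with the same first coordinate, if any. -/
theorem Inv.insert (h : A.Inv k j occ) (hk : k < A.m) (hj : j < A.nq)
    (hle : A.Y (A.byY k) ≤ A.QY (A.byQ j)) :
    A.Inv (k + 1) j
      (Function.update occ (2 ^ A.D + A.rank (A.byY k)) (some (A.byY k))) := by
  refine ⟨hk, h.j_le, fun v p hv => ?_, fun _ i hi => ?_, fun _ i hi x t ht => ?_⟩
  · by_cases hvl : v = 2 ^ A.D + A.rank (A.byY k)
    · rw [hvl, Function.update_self, Option.some.injEq] at hv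
      exact ⟨by rw [hvl, hv], k, by omega, hv⟩
    · rw [Function.update_of_ne hvl] at hv
      obtain ⟨h1, i, hi, h2⟩ := h.occ_eq v p hv
      exact ⟨h1, i, by omega, h2⟩
  · rcases Nat.lt_succ_iff_lt_or_eq.1 hi with hi | rfl
    · exact h.below hj i hi
    · exact hle
  · rcases Nat.lt_succ_iff_lt_or_eq.1 hi with hi | rfl
    · obtain ⟨v, q, hv, hq⟩ := h.dom hj i hi x t ht
      by_cases hvl : v = 2 ^ A.D + A.rank (A.byY k)
      · obtain ⟨h1, i', hi', rfl⟩ := h.occ_eq v q hv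
        refine ⟨_, _, Function.update_self .., le_trans ?_ hq⟩
        exact sqDist_le_of_above (A.ranking.eq_of_rank_eq (h.lt hv) (A.sortY.lt k hk) (by omega))
          (A.sortY.mono i' k hi'.le hk) (hle.trans ht)
      · exact ⟨v, q, by rw [Function.update_of_ne hvl]; exact hv, hq⟩
    · exact ⟨_, _, Function.update_self .., le_rfl⟩

/-- An active site whose cell has ended below the sweep line may be removed: above the sweep line,
one of its neighbors is always at least as near. -/
theorem Inv.remove (h : A.Inv k j occ) (hj : j < A.nq) {a b c : ℕ}
    (habc : Consec (leafList occ A.D 1) a b c) (ho : 0 < orient A.X A.Y a b c)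
    (hd : death A.X A.Y a b c < A.QY (A.byQ j)) :
    A.Inv k j (Function.update occ (2 ^ A.D + A.rank b) none) := by
  have hX := habc.rel h.pairwise
  have hm := habc.mem
  have ha := h.occ_of_mem hm.1
  have hb := h.occ_of_mem hm.2.1
  have hc := h.occ_of_mem hm.2.2
  have hab := A.ranking.rank_lt a (h.lt ha) b (h.lt hb) hX.1
  have hbc := A.ranking.rank_lt b (h.lt hb) c (h.lt hc) hX.2
  refine ⟨h.k_le, h.j_le, fun v p hv => ?_, h.below, fun _ i hi x t ht => ?_⟩
  · by_cases hvl : v = 2 ^ A.D + A.rank b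
    · rw [hvl, Function.update_self] at hv
      exact absurd hv (by simp)
    · rw [Function.update_of_ne hvl] at hv
      exact h.occ_eq v p hv
  · obtain ⟨v, q, hv, hq⟩ := h.dom hj i hi x t ht
    by_cases hvl : v = 2 ^ A.D + A.rank b
    · rw [hvl, hb, Option.some.injEq] at hv
      subst hv
      have hgap := gap_neg_of_le ho ((gap_neg_iff ho).2 hd) ht
      rcases sqDist_le_of_gap_neg (x := x) hX.1 hX.2 hgap with h' | h'
      · exact ⟨2 ^ A.D + A.rank a, a,
          by rw [Function.update_of_ne (by omega)]; exact ha, h'.trans hq⟩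
      · exact ⟨2 ^ A.D + A.rank c, c,
          by rw [Function.update_of_ne (by omega)]; exact hc, h'.trans hq⟩
    · exact ⟨v, q, by rw [Function.update_of_ne hvl]; exact hv, hq⟩

theorem Inv.advance (h : A.Inv k j occ) (hj : j < A.nq) : A.Inv k (j + 1) occ :=
  ⟨h.k_le, hj, h.occ_eq,
    fun hj' i hi => (h.below hj i hi).trans (A.sortQ.mono j (j + 1) (by omega) hj'),
    fun hj' i hi x t ht => h.dom hj i hi x t ((A.sortQ.mono j (j + 1) (by omega) hj').trans ht)⟩

/-- When no active site is left whose cell has ended, the gaps have the signs that binary search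
needs. -/
theorem Inv.gap_nonneg (h : A.Inv k j occ) (hj : j < A.nq)
    (hno : ∀ e ∈ deaths A.X A.Y (leafList occ A.D 1), A.QY (A.byQ j) ≤ e.2) {a b c : ℕ}
    (habc : Consec (leafList occ A.D 1) a b c) :
    0 ≤ gap A.X A.Y a b c (A.QY (A.byQ j)) := by
  have hX := habc.rel h.pairwise
  rcases lt_or_ge 0 (orient A.X A.Y a b c) with ho | ho
  · have := hno (b, death A.X A.Y a b c) ⟨a, c, habc, ho, rfl⟩
    by_contra! hneg
    exact absurd ((gap_neg_iff ho).1 hneg) (not_lt.2 this)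
  · refine gap_nonneg_of_orient_nonpos hX.1 hX.2 ?_ ho
    obtain ⟨-, i, hi, rfl⟩ := h.occ_eq _ _ (h.occ_of_mem habc.mem.2.1)
    exact h.below hj i hi

/-- The word `w` answers the query with number `u`. -/
def IsAnswer (A : Sweep) (u w : ℕ) : Prop :=
  IsNearestBelow A.X A.Y A.m (A.QX u) (A.QY u) w

/-- A query may be answered when all sites not above it have been inserted. -/
theorem Inv.answer (h : A.Inv k j occ) (hj : j < A.nq)
    (hk : k < A.m → A.QY (A.byQ j) < A.Y (A.byY k)) {v : ℕ}
    (hv : ∀ p ∈ leafList occ A.D 1, ∃ q, occ v = some q ∧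
      sqDist A.X A.Y q (A.QX (A.byQ j)) (A.QY (A.byQ j)) ≤
        sqDist A.X A.Y p (A.QX (A.byQ j)) (A.QY (A.byQ j))) :
    A.IsAnswer (A.byQ j) (encode (occ v)) := by
  have H : ∀ p < A.m, A.Y p ≤ A.QY (A.byQ j) → ∃ q, occ v = some q ∧
      sqDist A.X A.Y q (A.QX (A.byQ j)) (A.QY (A.byQ j)) ≤
        sqDist A.X A.Y p (A.QX (A.byQ j)) (A.QY (A.byQ j)) := by
    intro p hp hle
    obtain ⟨i, hi, rfl⟩ := A.sortY.surj p hp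
    have hik : i < k := by
      by_contra! hki
      have := A.sortY.mono k i hki hi
      linarith [hk (hki.trans_lt hi)]
    obtain ⟨w, q, hw, hq⟩ := h.dom hj i hik (A.QX (A.byQ j)) _ le_rfl
    obtain ⟨q', hq', hle'⟩ := hv q (h.mem_root hw)
    exact ⟨q', hq', hle'.trans hq⟩
  cases ho : occ v with
  | none =>
    refine Or.inl ⟨rfl, fun p hp => ?_⟩
    by_contra! hle
    obtain ⟨q, hq, -⟩ := H p hp hle
    simp [ho] at hq
  | some q =>
    refine Or.inr ⟨by simp, by simpa using h.lt ho, fun p hp hle => ?_⟩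
    obtain ⟨q', hq', hle'⟩ := H p hp hle
    rw [ho, Option.some.injEq] at hq'
    subst hq'
    simpa using hle'

end Sweep

/-- Let the leaf with the number of the current site carry nothing, or that site. -/
def setLeaf (content : NExp) : Cmd :=
  .seq (.setNat arrNode (.const 0) (.add (.scalar arrSize) (.get arrRank (.scalar arrSite)))) <|
  .seq (.setNat arrFst (.scalar arrNode) content) <|
  .seq (.setNat arrSnd (.scalar arrNode) (.const 0)) <|
  .seq (.setNat arrLst (.scalar arrNode) content) <|
  .seq (.setNat arrPen (.scalar arrNode) (.const 0)) <|
  .setNat arrWho (.scalar arrNode) (.const 0)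

/-- Insert the next site. -/
def insertSite (sx sy : ℕ) : Cmd :=
  .seq (setLeaf (.add (.scalar arrSite) (.const 1))) <|
  .seq (updatePath (mergeSites sx sy)) <|
  .setNat arrIns (.const 0) (.add (.scalar arrIns) (.const 1))

/-- Remove the site whose cell ends first. -/
def removeSite (sx sy : ℕ) : Cmd :=
  .seq (.setNat arrSite (.const 0) (.sub (.get arrWho (.const 1)) (.const 1))) <|
  .seq (setLeaf (.const 0)) <|
  updatePath (mergeSites sx sy)

/-- Answer the current query. -/
def answerQuery (sx sy qx qy out : ℕ) : Cmd :=
  .seq (locate sx sy qx qy) <|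
  .seq (.setNat out (.scalar arrQuery) (.get arrFst (.scalar arrNode))) <|
  .setNat arrAns (.const 0) (.add (.scalar arrAns) (.const 1))

/-- Find the current query point, and test whether the next site is not above it. -/
def nextEvent (sy qy cs : ℕ) : Cmd :=
  .seq (.setNat arrQuery (.const 0) (.get arrByQ (.scalar arrAns))) <|
  .seq (.setNat arrFlag (.const 0) (.const 0)) <|
  .ite (.natLt (.scalar arrIns) (.get 0 (.const cs)))
    (.seq (.setNat arrSite (.const 0) (.get arrByY (.scalar arrIns)))
      (.ite (.realLt (.get qy (.scalar arrQuery)) (.get sy (.scalar arrSite))) .skip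
        (.setNat arrFlag (.const 0) (.const 1)))) .skip

/-- One event of the sweep.  Sites not above the current query point are inserted first, then sites
whose cell has ended below it are removed, and then the query is answered. -/
def sweepStep (sx sy qx qy cs out : ℕ) : Cmd :=
  .seq (nextEvent sy qy cs) <|
  .ite (.natLt (.const 0) (.scalar arrFlag)) (insertSite sx sy) <|
  .ite (.and (.natLt (.const 0) (.get arrWho (.const 1)))
      (.realLt (.get arrTime (.const 1)) (.get qy (.scalar arrQuery))))
    (removeSite sx sy) (answerQuery sx sy qx qy out)

/-- For each of the query points (coordinates in real arrays `qx` and `qy`, their number in cell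
`cq` of word array `0`), find a nearest one among the sites that are not above it (coordinates in
real arrays `sx` and `sy`, their number in cell `cs` of word array `0`), and write one more than its
number to word array `out`, or `0` if there is none. -/
def sweep (sx sy qx qy cs cq out : ℕ) : Cmd :=
  .seq (sortBy sx cs arrByX) <|
  .seq (computeRanks sx cs) <|
  .seq (sortBy sy cs arrByY) <|
  .seq (sortBy qy cq arrByQ) <|
  .seq (initTree cs) <|
  .seq (.seq (.setNat arrIns (.const 0) (.const 0)) (.setNat arrAns (.const 0) (.const 0))) <|
  .while (.natLt (.scalar arrAns) (.get 0 (.const cq))) (sweepStep sx sy qx qy cs out)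

theorem not_writesNat_updatePath {sx sy a : ℕ} (ha : a = 0 ∨ 10 ≤ a) :
    ¬ (updatePath (mergeSites sx sy)).WritesNat a := by
  simp [updatePath, mergeSites, mergeBest, considerIf, consider, mergeFront, mergeBack]
  omega

theorem not_writesReal_updatePath {sx sy a : ℕ} (ha : a < 6) :
    ¬ (updatePath (mergeSites sx sy)).WritesReal a := by
  simp [updatePath, mergeSites, mergeBest, considerIf, consider, mergeFront, mergeBack]
  omega

theorem not_writesNat_sweepStep {sx sy qx qy cs out a : ℕ} (ha : a = 0 ∨ 10 ≤ a)
    (ha' : a < 20 ∨ 25 ≤ a) (ho : a ≠ out) : ¬ (sweepStep sx sy qx qy cs out).WritesNat a := by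
  simp [sweepStep, nextEvent, insertSite, removeSite, answerQuery, setLeaf, locate,
    not_writesNat_updatePath ha]
  omega

theorem not_writesReal_sweepStep {sx sy qx qy cs out a : ℕ} (ha : a < 6) :
    ¬ (sweepStep sx sy qx qy cs out).WritesReal a := by
  simp [sweepStep, nextEvent, insertSite, removeSite, answerQuery, setLeaf, locate,
    not_writesReal_updatePath ha]

theorem deaths_of_length_lt {X Y : ℕ → ℝ} {l : List ℕ} (h : l.length < 3) : deaths X Y l = ∅ := by
  ext e
  simp only [Set.mem_empty_iff_false, iff_false]
  rintro ⟨a, c, ⟨i, -, -, hi⟩, -⟩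
  have := (List.getElem?_eq_some_iff.1 hi).1
  omega

theorem sweepRep_leaf {m v : ℕ} {X Y : ℕ → ℝ} {s : State} {o : Option ℕ}
    (ho : ∀ p, o = some p → p < m) (h1 : s.nat arrFst v = encode o) (h2 : s.nat arrSnd v = 0)
    (h3 : s.nat arrLst v = encode o) (h4 : s.nat arrPen v = 0) (h5 : s.nat arrWho v = 0) :
    SweepRep m X Y s v o.toList := by
  cases o with
  | none => exact ⟨by simp, h1, h2, h3, h4, Or.inl ⟨h5, deaths_of_length_lt (by simp)⟩⟩
  | some p => exact ⟨by simpa using ho p rfl, h1, h2, h3, h4,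
      Or.inl ⟨h5, deaths_of_length_lt (by simp)⟩⟩

/-- The memory holds the data of the sweep. -/
structure Sweep.Loaded (A : Sweep) (sx sy qx qy cs cq : ℕ) (s : State) : Prop where
  X : s.real sx = A.X
  Y : s.real sy = A.Y
  QX : s.real qx = A.QX
  QY : s.real qy = A.QY
  m : s.nat 0 cs = A.m
  nq : s.nat 0 cq = A.nq
  size : s.nat arrSize 0 = 2 ^ A.D
  rank : s.nat arrRank = A.rank
  byY : s.nat arrByY = A.byY
  byQ : s.nat arrByQ = A.byQ

theorem Sweep.Loaded.mono {A : Sweep} {sx sy qx qy cs cq : ℕ} {s s' : State}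
    (h : A.Loaded sx sy qx qy cs cq s) (hsx : sx < 6) (hsy : sy < 6) (hqx : qx < 6) (hqy : qy < 6)
    (hr : ∀ a < 6, s'.real a = s.real a)
    (hn : ∀ a, a = 0 ∨ a = arrSize ∨ a = arrRank ∨ a = arrByY ∨ a = arrByQ → s'.nat a = s.nat a) :
    A.Loaded sx sy qx qy cs cq s' :=
  ⟨(hr _ hsx).trans h.X, (hr _ hsy).trans h.Y, (hr _ hqx).trans h.QX, (hr _ hqy).trans h.QY,
    by rw [hn 0 (by simp), h.m], by rw [hn 0 (by simp), h.nq], by rw [hn arrSize (by simp), h.size],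
    by rw [hn arrRank (by simp), h.rank], by rw [hn arrByY (by simp), h.byY],
    by rw [hn arrByQ (by simp), h.byQ]⟩

/-- Changing the content of a leaf and updating the tree, followed by a command `c`. -/
theorem setLeaf_updatePath_spec {A : Sweep} {sx sy qx qy cs cq p : ℕ} {occ : ℕ → Option ℕ}
    {o : Option ℕ} {content : NExp} {s : State} (hsx : sx < 6) (hsy : sy < 6)
    (hW : 2 * 2 ^ A.D + 2 < W) (hL : A.Loaded sx sy qx qy cs cq s) (hp : p < A.m)
    (hsite : s.nat arrSite 0 = p) (ho : ∀ q, o = some q → q < A.m)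
    (hcontent : content = .add (.scalar arrSite) (.const 1) ∧ o = some p ∨
      content = .const 0 ∧ o = none)
    (hT : TreeRep (SweepRep A.m A.X A.Y) A.D occ s) {c : Cmd} {Q : ℕ → State → Prop}
    (hc : ∀ t s', (∀ a, a = 0 ∨ 10 ≤ a → s'.nat a = s.nat a) → t ≤ 2100 * (A.D + 1) + 60 →
      TreeRep (SweepRep A.m A.X A.Y) A.D (Function.update occ (2 ^ A.D + A.rank p) o) s' →
      Ex W c s' fun t' s'' => Q (t + t') s'') :
    Ex W (.seq (setLeaf content) (.seq (updatePath (mergeSites sx sy)) c)) s Q := by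
  have hrank := A.ranking.lt p hp
  have hmle := A.m_le
  have hlt := A.leaf_lt hp
  refine Ex.seq (Ex.of_wp (Q := fun s' => s'.nat arrNode 0 = 2 ^ A.D + A.rank p ∧
    s'.nat arrFst (2 ^ A.D + A.rank p) = encode o ∧ s'.nat arrSnd (2 ^ A.D + A.rank p) = 0 ∧
    s'.nat arrLst (2 ^ A.D + A.rank p) = encode o ∧ s'.nat arrPen (2 ^ A.D + A.rank p) = 0 ∧
    s'.nat arrWho (2 ^ A.D + A.rank p) = 0 ∧ s'.real = s.real ∧
    ∀ w ≠ 2 ^ A.D + A.rank p, s'.nat arrFst w = s.nat arrFst w ∧ s'.nat arrSnd w = s.nat arrSnd w ∧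
      s'.nat arrLst w = s.nat arrLst w ∧ s'.nat arrPen w = s.nat arrPen w ∧
      s'.nat arrWho w = s.nat arrWho w) ?_) ?_
  · have hWs : 0 < W ∧ 1 < W ∧ p < W ∧ 2 ^ A.D < W ∧ A.rank p < W ∧ 2 ^ A.D + A.rank p < W ∧
      p + 1 < W := by omega
    rcases hcontent with ⟨rfl, rfl⟩ | ⟨rfl, rfl⟩ <;>
      simp +contextual [setLeaf, hL.size, hL.rank, hsite, hWs]
  rintro t₁ s₁ hf₁ ⟨ht₁, hn, h1, h2, h3, h4, h5, hr, hw⟩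
  have hcost : (setLeaf content).maxCost ≤ 50 := by
    rcases hcontent with ⟨rfl, -⟩ | ⟨rfl, -⟩ <;> simp [setLeaf]
  refine Ex.seq (updatePath_mergeSites_spec (m := A.m) (occ := occ)
    (occ' := Function.update occ (2 ^ A.D + A.rank p) o)
    hsx hsy (by rw [hr, hL.X]) (by rw [hr, hL.Y]) (by omega) (by omega) hn (by omega) hlt
    (fun w hw => Function.update_of_ne hw _ _) (fun h hh v hv1 hv2 hv => ?_) ?_) ?_
  · obtain ⟨w1, w2, w3, w4, w5⟩ := hw v hv
    exact (hT h hh v hv1 hv2).congr w1 w2 w3 w4 w5 (by rw [hr])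
  · rw [Function.update_self]
    exact sweepRep_leaf ho h1 h2 h3 h4 h5
  rintro t₂ s₂ hf₂ ⟨ht₂, hT₂⟩
  refine (hc (t₁ + t₂) s₂ (fun a ha => ?_) (by omega) hT₂).mono fun t s' _ h => by
    rwa [← Nat.add_assoc]
  rw [hf₂.nat a (not_writesNat_updatePath ha), hf₁.nat a]
  simp [setLeaf]
  omega

/-- The memory during the sweep. -/
structure Sweep.StateInv (A : Sweep) (out k j : ℕ) (occ : ℕ → Option ℕ) (s : State) : Prop where
  inv : A.Inv k j occ
  ins : s.nat arrIns 0 = k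
  ans : s.nat arrAns 0 = j
  tree : TreeRep (SweepRep A.m A.X A.Y) A.D occ s
  out : ∀ i < j, A.IsAnswer (A.byQ i) (s.nat out (A.byQ i))

/-- The potential of the sweep: an insertion pays for the removal of the site, too. -/
def Sweep.potential (A : Sweep) (g : ℕ × ℕ × (ℕ → Option ℕ)) : ℕ :=
  (2 * (A.m - g.1) + (A.nq - g.2.1) + (occupied g.2.2 A.D).card) * (2300 * (A.D + 1))

/-- Every event keeps the invariant and lowers the potential by its running time, with `20` steps to
spare for the test of the loop. -/
theorem sweepStep_spec {A : Sweep} {sx sy qx qy cs cq out k j : ℕ} {occ : ℕ → Option ℕ} {s : State}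
    (hsx : sx < 6) (hsy : sy < 6) (hqx : qx < 6) (hqy : qy < 6) (hcs : cs < W) (hout : 30 ≤ out)
    (hW : 2 * 2 ^ A.D + 2 < W) (hnq : A.nq + 2 < W) (hL : A.Loaded sx sy qx qy cs cq s)
    (hI : A.StateInv out k j occ s) (hj : j < A.nq) :
    Ex W (sweepStep sx sy qx qy cs out) s fun t s' => ∃ g : ℕ × ℕ × (ℕ → Option ℕ),
      A.StateInv out g.1 g.2.1 g.2.2 s' ∧ t + 20 + A.potential g ≤ A.potential (k, j, occ) := by
  obtain ⟨hinv, hins, hans, hT, hans'⟩ := hI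
  obtain ⟨O, rfl⟩ := Nat.exists_eq_add_of_le' hout
  have hmle := A.m_le
  have hu := A.sortQ.lt j hj
  have hk := hinv.k_le
  have hDpos : 0 < 2 ^ A.D := by positivity
  have hWs : 0 < W ∧ 1 < W := by omega
  refine Ex.seq (Ex.of_wp (Q := fun s' => s'.nat arrQuery 0 = A.byQ j ∧
    (s'.nat arrFlag 0 = 1 ∧ k < A.m ∧ A.Y (A.byY k) ≤ A.QY (A.byQ j) ∧
      s'.nat arrSite 0 = A.byY k ∨
    s'.nat arrFlag 0 = 0 ∧ (k < A.m → A.QY (A.byQ j) < A.Y (A.byY k)))) ?_) ?_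
  · have hσ : k < A.m → A.byY k < W := fun h => by have := A.sortY.lt k h; omega
    simp only [nextEvent, Cmd.wp, NExp.Ok, NExp.val, RExp.Ok, RExp.val, BExp.Ok, BExp.Holds,
      State.setNat_nat, State.setNat_real, hins, hans, hL.m, hL.byQ, hL.byY, hL.QY, hL.Y,
      Nat.reduceEqDiff, and_true, if_true, if_false, false_and, true_and]
    refine ⟨by omega, by omega, by omega, fun h => ⟨⟨by omega, by omega, hσ h⟩, ?_, ?_, ?_⟩, ?_⟩
    · have := hσ h; omega
    · exact fun h' => Or.inr fun _ => h'
    · exact fun h' => ⟨by omega, Or.inl ⟨h, not_lt.1 h'⟩⟩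
    · exact fun h => Or.inr fun h' => absurd h' h
  rintro t₁ s₁ hf₁ ⟨ht₁, hq₁, hor⟩
  have hn₁ : ∀ a, a < 22 ∨ 25 ≤ a → s₁.nat a = s.nat a := fun a ha => hf₁.nat a (by
    simp [nextEvent]; omega)
  have hr₁ : s₁.real = s.real := funext fun a => hf₁.real a (by simp [nextEvent])
  have hL₁ : A.Loaded sx sy qx qy cs cq s₁ :=
    hL.mono hsx hsy hqx hqy (fun a _ => by rw [hr₁]) fun a ha => hn₁ a (by omega)
  have hT₁ : TreeRep (SweepRep A.m A.X A.Y) A.D occ s₁ := fun h hh v h1 h2 =>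
    (hT h hh v h1 h2).congr (by rw [hn₁ _ (by norm_num)]) (by rw [hn₁ _ (by norm_num)])
      (by rw [hn₁ _ (by norm_num)]) (by rw [hn₁ _ (by norm_num)]) (by rw [hn₁ _ (by norm_num)])
      (by rw [hr₁])
  have hins₁ : s₁.nat arrIns 0 = k := by rw [hn₁ _ (by norm_num), hins]
  have hans₁ : s₁.nat arrAns 0 = j := by rw [hn₁ _ (by norm_num), hans]
  have hans'₁ : ∀ i < j, A.IsAnswer (A.byQ i) (s₁.nat (O + 30) (A.byQ i)) := fun i hi => by
    rw [hn₁ _ (by omega)]; exact hans' i hi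
  have ht₁' : t₁ ≤ 40 := ht₁.trans (by simp [nextEvent])
  have hflag : s₁.nat arrFlag 0 < W := by omega
  refine Ex.ite (by simp [hflag, hWs]) (fun h => ?_) fun h => ?_
  · -- insertion
    obtain ⟨-, hkm, hY, hsite⟩ : s₁.nat arrFlag 0 = 1 ∧ k < A.m ∧
        A.Y (A.byY k) ≤ A.QY (A.byQ j) ∧ s₁.nat arrSite 0 = A.byY k := by
      rcases hor with h' | ⟨h', -⟩
      · exact h'
      · simp [h'] at h
    have hp := A.sortY.lt k hkm
    refine setLeaf_updatePath_spec (o := some (A.byY k)) hsx hsy hW hL₁ hp hsite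
      (by simpa using hp) (Or.inl ⟨rfl, rfl⟩) hT₁ fun t₂ s₂ hn₂ ht₂ hT₂ => ?_
    have hins₂ : s₂.nat arrIns 0 = k := by rw [hn₂ _ (by norm_num), hins₁]
    refine (Ex.of_wp (Q := fun s' => s'.nat arrIns 0 = k + 1 ∧ s'.real = s₂.real ∧
      ∀ a ≠ arrIns, s'.nat a = s₂.nat a) ?_).mono ?_
    · simp +contextual [hins₂, hWs]
      exact ⟨by omega, fun a ha => funext fun i => by simp [ha]⟩
    rintro t₃ s₃ - ⟨ht₃, hins₃, hr₃, hn₃⟩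
    refine ⟨(k + 1, j, Function.update occ (2 ^ A.D + A.rank (A.byY k)) (some (A.byY k))),
      ⟨hinv.insert hkm hj hY, hins₃, ?_, fun h hh v h1 h2 => (hT₂ h hh v h1 h2).congr ?_ ?_ ?_ ?_ ?_
        (by rw [hr₃]), ?_⟩, ?_⟩
    · rw [hn₃ _ (by norm_num), hn₂ _ (by norm_num), hans₁]
    · rw [hn₃ _ (by norm_num)]
    · rw [hn₃ _ (by norm_num)]
    · rw [hn₃ _ (by norm_num)]
    · rw [hn₃ _ (by norm_num)]
    · rw [hn₃ _ (by norm_num)]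
    · intro i hi
      rw [hn₃ _ (by omega), hn₂ _ (by omega)]
      exact hans'₁ i hi
    · have hcard := occupied_card_le (D := A.D) (occ := occ)
        (occ' := Function.update occ (2 ^ A.D + A.rank (A.byY k)) (some (A.byY k)))
        (fun w hw => Function.update_of_ne hw _ _)
      have : A.potential (k + 1, j,
          Function.update occ (2 ^ A.D + A.rank (A.byY k)) (some (A.byY k))) +
          2300 * (A.D + 1) ≤ A.potential (k, j, occ) := by
        unfold Sweep.potential
        rw [← Nat.succ_mul]
        exact Nat.mul_le_mul_right _ (by dsimp only; omega)
      simp at ht₃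
      simp only [BExp.cost, NExp.cost]
      omega
  obtain ⟨hflag0, hkY⟩ : s₁.nat arrFlag 0 = 0 ∧
      (k < A.m → A.QY (A.byQ j) < A.Y (A.byY k)) := by
    rcases hor with ⟨h', -⟩ | h'
    · simp [h'] at h
    · exact h'
  have hroot := hT₁.root
  have hwho := hroot.le.2.2.2.2
  refine Ex.ite (by simp [hWs, hq₁]; omega) (fun h' => ?_) fun h' => ?_
  · -- removal
    simp only [BExp.Holds, NExp.val, RExp.val, hq₁, hL₁.QY] at h'
    rcases hroot.best with ⟨h0, -⟩ | ⟨-, ⟨a, c, hac, ho, htime⟩, -⟩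
    · omega
    dsimp only at hac ho htime
    obtain ⟨b, hb⟩ : ∃ b, s₁.nat arrWho 1 = b + 1 := ⟨s₁.nat arrWho 1 - 1, by omega⟩
    rw [hb, Nat.add_sub_cancel] at hac ho htime
    have hocc := hinv.occ_of_mem hac.mem.2.1
    have hbm := hinv.lt hocc
    refine Ex.seq (Ex.of_wp (Q := fun s' => s'.nat arrSite 0 = b ∧ s'.real = s₁.real ∧
      ∀ a ≠ arrSite, s'.nat a = s₁.nat a) ?_) ?_
    · simp +contextual [hb, hWs]
      exact ⟨by omega, fun a ha => funext fun i => by simp [ha]⟩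
    rintro t₂ s₂ - ⟨ht₂, hsite₂, hr₂, hn₂⟩
    have hL₂ : A.Loaded sx sy qx qy cs cq s₂ :=
      hL₁.mono hsx hsy hqx hqy (fun a _ => by rw [hr₂]) fun a ha => hn₂ a (by omega)
    have hT₂ : TreeRep (SweepRep A.m A.X A.Y) A.D occ s₂ := fun h hh v h1 h2 =>
      (hT₁ h hh v h1 h2).congr (by rw [hn₂ _ (by norm_num)]) (by rw [hn₂ _ (by norm_num)])
        (by rw [hn₂ _ (by norm_num)]) (by rw [hn₂ _ (by norm_num)]) (by rw [hn₂ _ (by norm_num)])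
        (by rw [hr₂])
    -- a trailing `skip` brings the command into the shape treated by `setLeaf_updatePath_spec`
    suffices H : Ex W (.seq (setLeaf (.const 0)) (.seq (updatePath (mergeSites sx sy)) .skip)) s₂
        fun t s' => ∃ g : ℕ × ℕ × (ℕ → Option ℕ), A.StateInv (O + 30) g.1 g.2.1 g.2.2 s' ∧
          t₁ + ((BExp.natLt (.const 0) (.scalar arrFlag)).cost + 1 +
            ((BExp.and (.natLt (.const 0) (.get arrWho (.const 1)))
              (.realLt (.get arrTime (.const 1)) (.get qy (.scalar arrQuery)))).cost + 1 +
            (t₂ + t))) + 20 + A.potential g ≤ A.potential (k, j, occ) by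
      obtain ⟨_, _, he, g, hg, hle⟩ := H
      cases he with
      | seq e₁ e₂ =>
        cases e₂ with
        | seq e₃ e₄ =>
          cases e₄
          exact ⟨_, _, .seq e₁ e₃, g, hg, by omega⟩
    refine setLeaf_updatePath_spec (o := none) hsx hsy hW hL₂ hbm hsite₂
      (by simp) (Or.inr ⟨rfl, rfl⟩) hT₂ fun t₃ s₃ hn₃ ht₃ hT₃ => ?_
    refine (Ex.of_wp (c := .skip) (Q := fun s' => s' = s₃) rfl).mono ?_
    rintro t₄ s₄ - ⟨ht₄, rfl⟩
    refine ⟨(k, j, Function.update occ (2 ^ A.D + A.rank b) none),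
      ⟨hinv.remove hj hac ho (by rw [← htime]; exact h'.2), ?_, ?_, hT₃, ?_⟩, ?_⟩
    · rw [hn₃ _ (by norm_num), hn₂ _ (by norm_num), hins₁]
    · rw [hn₃ _ (by norm_num), hn₂ _ (by norm_num), hans₁]
    · intro i hi
      rw [hn₃ _ (by omega), hn₂ _ (by omega)]
      exact hans'₁ i hi
    · have hcard := occupied_card_vacate (D := A.D) (occ := occ)
        (occ' := Function.update occ (2 ^ A.D + A.rank b) none) (by omega) (A.leaf_lt hbm)
        (fun w hw => Function.update_of_ne hw _ _) (by simp [hocc]) (Function.update_self ..)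
      have : A.potential (k, j, Function.update occ (2 ^ A.D + A.rank b) none) +
          2300 * (A.D + 1) ≤ A.potential (k, j, occ) := by
        unfold Sweep.potential
        rw [← Nat.succ_mul]
        exact Nat.mul_le_mul_right _ (by dsimp only; omega)
      simp at ht₂ ht₄
      simp only [BExp.cost, NExp.cost, RExp.cost]
      omega
  · -- query
    have hno : ∀ e ∈ deaths A.X A.Y (leafList occ A.D 1), A.QY (A.byQ j) ≤ e.2 := by
      simp only [BExp.Holds, NExp.val, RExp.val, hq₁, hL₁.QY] at h'
      intro e he
      rcases hroot.best with ⟨-, h0⟩ | ⟨h0, -, h1⟩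
      · rw [h0] at he
        exact he.elim
      · exact le_trans (not_lt.1 fun h2 => h' ⟨h0, h2⟩) (h1 e he)
    refine Ex.seq (locate_spec (m := A.m) (D := A.D) (u := A.byQ j) hL₁.X hL₁.Y
      (congrFun hL₁.QX _) (congrFun hL₁.QY _) hq₁ (by omega) (by omega) (by omega) hL₁.size hT₁
      hinv.pairwise fun a b c habc => hinv.gap_nonneg hj hno habc) ?_
    rintro t₂ s₂ hf₂ ⟨ht₂, v, hv, hv1, hv2, hnear⟩
    have hn₂ : ∀ a, a ≠ arrNode → s₂.nat a = s₁.nat a := fun a ha =>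
      hf₂.nat a (by simp [locate, ha])
    have hr₂ : s₂.real = s₁.real := funext fun a => hf₂.real a (by simp [locate])
    have hfst : s₂.nat arrFst v = encode (occ v) := by
      have := (hT₁ 0 (Nat.zero_le _) v (by simpa using hv1) (by simpa using hv2)).fst
      rw [hn₂ _ (by norm_num), this, leafList_zero]
      cases occ v <;> rfl
    have hfstW : encode (occ v) < W := by
      cases ho : occ v with
      | none => simpa using hWs.1
      | some q => have := hinv.lt ho; simp; omega
    have h2D : 2 ^ (A.D + 1) = 2 * 2 ^ A.D := by ring
    refine (Ex.of_wp (Q := fun s' => s'.nat arrAns 0 = j + 1 ∧ s'.real = s₂.real ∧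
      s'.nat (O + 30) (A.byQ j) = encode (occ v) ∧
      (∀ i ≠ A.byQ j, s'.nat (O + 30) i = s₂.nat (O + 30) i) ∧
      ∀ a, a ≠ arrAns → a ≠ O + 30 → s'.nat a = s₂.nat a) ?_).mono ?_
    · simp +contextual [hn₂, hq₁, hv, hfst, hans₁, hWs, hfstW]
      refine ⟨by omega, by omega, fun a ha hb => funext fun i => by simp [ha, hb]⟩
    rintro t₃ s₃ - ⟨ht₃, hans₃, hr₃, ho₃, ho₃', hn₃⟩
    refine ⟨(k, j + 1, occ), ⟨hinv.advance hj, ?_, hans₃, fun h hh v h1 h2 =>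
      (hT₁ h hh v h1 h2).congr ?_ ?_ ?_ ?_ ?_ (by rw [hr₃, hr₂]), ?_⟩, ?_⟩
    · rw [hn₃ _ (by norm_num) (by omega), hn₂ _ (by norm_num), hins₁]
    · rw [hn₃ _ (by norm_num) (by omega), hn₂ _ (by norm_num)]
    · rw [hn₃ _ (by norm_num) (by omega), hn₂ _ (by norm_num)]
    · rw [hn₃ _ (by norm_num) (by omega), hn₂ _ (by norm_num)]
    · rw [hn₃ _ (by norm_num) (by omega), hn₂ _ (by norm_num)]
    · rw [hn₃ _ (by norm_num) (by omega), hn₂ _ (by norm_num)]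
    · intro i hi
      by_cases hij : A.byQ i = A.byQ j
      · rw [hij, ho₃]
        exact hinv.answer hj hkY hnear
      · rw [ho₃' _ hij, hn₂ _ (by omega)]
        refine hans'₁ i ((Nat.lt_succ_iff.1 hi).lt_of_ne ?_)
        rintro rfl
        exact hij rfl
    · have : A.potential (k, j + 1, occ) + 2300 * (A.D + 1) ≤ A.potential (k, j, occ) := by
        unfold Sweep.potential
        rw [← Nat.succ_mul]
        exact Nat.mul_le_mul_right _ (by dsimp only; omega)
      simp at ht₃
      simp only [BExp.cost, NExp.cost, RExp.cost]
      omega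

theorem not_writesNat_sortBy {K c P a : ℕ} (ha : a = 0 ∨ 16 ≤ a) (hP : a ≠ P) :
    ¬ (sortBy K c P).WritesNat a := by
  simp [sortBy, initTree, updatePath, mergeBest, hP]
  omega

theorem not_writesReal_sortBy {K c P a : ℕ} (ha : a < 6) : ¬ (sortBy K c P).WritesReal a := by
  simp [sortBy, initTree, updatePath, mergeBest]
  omega

theorem sweep_spec {sx sy qx qy cs cq out m nq : ℕ} {s₀ : State} (hsx : sx < 6) (hsy : sy < 6)
    (hqx : qx < 6) (hqy : qy < 6) (hcs : cs < W) (hcq : cq < W) (hout : 30 ≤ out)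
    (hm : s₀.nat 0 cs = m) (hnq : s₀.nat 0 cq = nq) (hm1 : 1 ≤ m) (hnq1 : 1 ≤ nq)
    (hW : 8 * (m + nq) + 8 < W) :
    Ex W (sweep sx sy qx qy cs cq out) s₀ fun t s' =>
      t ≤ 8000 * ((m + nq) * (Nat.log 2 (m + nq) + 2)) ∧
      ∀ u < nq, IsNearestBelow (s₀.real sx) (s₀.real sy) m (s₀.real qx u) (s₀.real qy u)
        (s'.nat out u) := by
  refine Ex.seq (sortBy_spec (m := m) hm hcs hm1 (by omega) hsx (by norm_num)) ?_
  rintro t₁ s₁ hf₁ ⟨ht₁, hσX⟩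
  have hr₁ : ∀ a < 6, s₁.real a = s₀.real a := fun a ha =>
    hf₁.real a (not_writesReal_sortBy ha)
  have hn₁ : ∀ a, a = 0 ∨ 17 ≤ a → s₁.nat a = s₀.nat a := fun a ha =>
    hf₁.nat a (not_writesNat_sortBy (by omega) (by omega))
  rw [← hr₁ sx hsx] at hσX
  refine Ex.seq (computeRanks_spec (m := m) (by rw [hn₁ 0 (by simp), hm]) hcs hm1 (by omega) hσX) ?_
  rintro t₂ s₂ hf₂ ⟨ht₂, hrank⟩
  have hr₂ : ∀ a < 6, s₂.real a = s₀.real a := fun a ha => by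
    rw [hf₂.real a (by simp [computeRanks]), hr₁ a ha]
  have hn₂ : ∀ a, a = 0 ∨ 18 ≤ a ∧ a < 25 ∨ 26 ≤ a → s₂.nat a = s₀.nat a := fun a ha => by
    rw [hf₂.nat a (by simp [computeRanks]; omega), hn₁ a (by omega)]
  rw [hr₁ sx hsx] at hrank
  refine Ex.seq (sortBy_spec (m := m) (by rw [hn₂ 0 (by simp), hm]) hcs hm1 (by omega) hsy
    (by norm_num)) ?_
  rintro t₃ s₃ hf₃ ⟨ht₃, hσY⟩
  have hr₃ : ∀ a < 6, s₃.real a = s₀.real a := fun a ha => by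
    rw [hf₃.real a (not_writesReal_sortBy ha), hr₂ a ha]
  have hn₃ : ∀ a, a = 0 ∨ a = arrRank → s₃.nat a = s₂.nat a := fun a ha =>
    hf₃.nat a (not_writesNat_sortBy (by omega) (by omega))
  rw [hr₂ sy hsy] at hσY
  refine Ex.seq (sortBy_spec (m := nq) (by rw [hn₃ 0 (by simp), hn₂ 0 (by simp), hnq]) hcq hnq1
    (by omega) hqy (by norm_num)) ?_
  rintro t₄ s₄ hf₄ ⟨ht₄, hσQ⟩
  have hr₄ : ∀ a < 6, s₄.real a = s₀.real a := fun a ha => by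
    rw [hf₄.real a (not_writesReal_sortBy ha), hr₃ a ha]
  have hn₄ : ∀ a, a = 0 ∨ a = arrRank ∨ a = arrByY → s₄.nat a = s₃.nat a := fun a ha =>
    hf₄.nat a (not_writesNat_sortBy (by omega) (by omega))
  rw [hr₃ qy hqy] at hσQ
  have h0 : s₄.nat 0 = s₀.nat 0 := by
    rw [hn₄ 0 (by simp), hn₃ 0 (by simp), hn₂ 0 (by simp)]
  refine Ex.seq (initTree_spec (m := m) (by rw [h0, hm]) hcs hm1 (by omega)) ?_
  rintro t₅ s₅ hf₅ ⟨ht₅, D, hD, hmD, hDm, hz⟩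
  have hn₅ : ∀ a, a = 0 ∨ 16 ≤ a → s₅.nat a = s₄.nat a := fun a ha =>
    hf₅.nat a (by simp [initTree]; omega)
  have hr₅ : s₅.real = s₄.real := funext fun a => hf₅.real a (by simp [initTree])
  let A : Sweep :=
    { m := m, nq := nq, D := D, X := s₀.real sx, Y := s₀.real sy, QX := s₀.real qx
      QY := s₀.real qy, rank := s₂.nat arrRank, byY := s₃.nat arrByY, byQ := s₄.nat arrByQ
      ranking := hrank, sortY := hσY, sortQ := hσQ, m_le := hmD }
  refine Ex.seq (Ex.of_wp (Q := fun s => s.nat arrIns 0 = 0 ∧ s.nat arrAns 0 = 0 ∧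
    s.real = s₅.real ∧ ∀ a, a ≠ arrIns → a ≠ arrAns → s.nat a = s₅.nat a) ?_) ?_
  · simp
    exact ⟨by omega, fun a ha hb => funext fun i => by simp [ha, hb]⟩
  rintro t₆ s₆ - ⟨ht₆, hins, hans, hr₆, hn₆⟩
  have hL : A.Loaded sx sy qx qy cs cq s₆ := by
    refine ⟨?_, ?_, ?_, ?_, ?_, ?_, ?_, ?_, ?_, ?_⟩
    · rw [hr₆, hr₅, hr₄ _ hsx]
    · rw [hr₆, hr₅, hr₄ _ hsy]
    · rw [hr₆, hr₅, hr₄ _ hqx]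
    · rw [hr₆, hr₅, hr₄ _ hqy]
    · rw [hn₆ _ (by norm_num) (by norm_num), hn₅ _ (by simp), h0, hm]
    · rw [hn₆ _ (by norm_num) (by norm_num), hn₅ _ (by simp), h0, hnq]
    · rw [hn₆ _ (by norm_num) (by norm_num), hD]
    · rw [hn₆ _ (by norm_num) (by norm_num), hn₅ _ (by simp), hn₄ _ (by simp), hn₃ _ (by simp)]
    · rw [hn₆ _ (by norm_num) (by norm_num), hn₅ _ (by simp), hn₄ _ (by simp)]
    · rw [hn₆ _ (by norm_num) (by norm_num), hn₅ _ (by simp)]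
  have hL' : ∀ s, Frame (.while (.natLt (.scalar arrAns) (.get 0 (.const cq)))
      (sweepStep sx sy qx qy cs out)) s₆ s → A.Loaded sx sy qx qy cs cq s := fun s hf =>
    hL.mono hsx hsy hqx hqy (fun a ha => hf.real a (not_writesReal_sweepStep ha))
      fun a ha => hf.nat a (not_writesNat_sweepStep (by omega) (by omega) (by omega))
  refine (Ex.loop (γ := ℕ × ℕ × (ℕ → Option ℕ)) (fun g s => A.StateInv out g.1 g.2.1 g.2.2 s)
    A.potential (0, 0, fun _ => none) ⟨A.inv_zero, hins, hans, TreeRep.of_empty fun v hv => ?_,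
      by simp⟩ ?_ ?_).mono ?_
  · obtain ⟨z1, z2, z3, z4, z5⟩ := hz v hv
    refine ⟨by simp, ?_, ?_, ?_, ?_, Or.inl ⟨?_, deaths_of_length_lt (by simp)⟩⟩ <;>
      rw [hn₆ _ (by norm_num) (by norm_num)] <;> simpa
  · rintro ⟨k, j, occ⟩ s hf hI
    have h1 := hI.ans
    have h2 := hI.inv.j_le
    have h3 := (hL' s hf).nq
    have h4 : A.nq = nq := rfl
    dsimp only at h1 h2
    simp [h1, h3]
    omega
  · rintro ⟨k, j, occ⟩ s hf hI hlt
    have h1 := hI.ans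
    have h2 := (hL' s hf).nq
    dsimp only at h1
    simp [h1, h2] at hlt
    refine (sweepStep_spec hsx hsy hqx hqy hcs hout (show 2 * 2 ^ D + 2 < W by omega)
      (show nq + 2 < W by omega) (hL' s hf) hI hlt).mono ?_
    rintro t s' - ⟨g, hg, hle⟩
    refine ⟨g, hg, ?_⟩
    dsimp only at hle
    simp only [BExp.cost, NExp.cost]
    omega
  · rintro t s' hf ⟨⟨k, j, occ⟩, hI, hn, ht⟩
    have h1 := hI.ans
    have h2 := (hL' s' hf).nq
    have h3 := hI.inv.j_le
    have h4 : A.nq = nq := rfl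
    dsimp only at h1 h3
    simp [h1, h2] at hn
    obtain rfl : j = nq := by omega
    refine ⟨?_, fun u hu => ?_⟩
    · have hpot : A.potential (0, 0, fun _ => none) = (2 * m + j) * (2300 * (D + 1)) := by
        simp [Sweep.potential, occupied, A]
      have hDle : D ≤ Nat.log 2 m + 1 := by
        rcases Nat.eq_zero_or_pos D with h | h
        · omega
        · have h3 : 2 ^ D = 2 * 2 ^ (D - 1) := by
            rw [← pow_succ']; congr 1; omega
          have := Nat.le_log_of_pow_le (b := 2) (by norm_num) (show 2 ^ (D - 1) ≤ m by omega)
          omega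
      set N := m + j
      have l1 : Nat.log 2 m ≤ Nat.log 2 N := Nat.log_mono_right (by omega)
      have l2 : Nat.log 2 j ≤ Nat.log 2 N := Nat.log_mono_right (by omega)
      set lg := Nat.log 2 N
      have e1 : m * (Nat.log 2 m + 2) ≤ N * (lg + 2) := Nat.mul_le_mul (by omega) (by omega)
      have e2 : j * (Nat.log 2 j + 2) ≤ N * (lg + 2) := Nat.mul_le_mul (by omega) (by omega)
      have e3 : N * 2 ≤ N * (lg + 2) := Nat.mul_le_mul le_rfl (by omega)
      have e4 : (2 * m + j) * (2300 * (D + 1)) ≤ 4600 * (N * (lg + 2)) := by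
        calc (2 * m + j) * (2300 * (D + 1)) ≤ (2 * N) * (2300 * (lg + 2)) :=
              Nat.mul_le_mul (by omega) (by omega)
          _ = 4600 * (N * (lg + 2)) := by ring
      simp at ht ht₆
      omega
    · obtain ⟨i, hi, rfl⟩ := hσQ.surj u hu
      exact hI.out i hi

theorem not_writesNat_sweep {sx sy qx qy cs cq out a : ℕ} (ha : a = 0 ∨ 30 ≤ a) (ho : a ≠ out) :
    ¬ (sweep sx sy qx qy cs cq out).WritesNat a := by
  simp only [sweep, Cmd.WritesNat, not_or]
  refine ⟨not_writesNat_sortBy (by omega) (by omega), ?_,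
    not_writesNat_sortBy (by omega) (by omega), not_writesNat_sortBy (by omega) (by omega), ?_, ?_,
    not_writesNat_sweepStep (by omega) (by omega) ho⟩
  · simp [computeRanks]; omega
  · simp [initTree]; omega
  · omega

theorem not_writesReal_sweep {sx sy qx qy cs cq out a : ℕ} (ha : a < 6) :
    ¬ (sweep sx sy qx qy cs cq out).WritesReal a := by
  simp [sweep, not_writesReal_sortBy ha, not_writesReal_sweepStep ha, computeRanks, initTree]

/-! ### Nearest neighbors in both directions -/

-- Word arrays with the results of the two sweeps.
notation "arrBelow" => (30 : ℕ)
notation "arrAbove" => (31 : ℕ)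

/-- For every query point, choose the nearer one of the sites found below and above it. -/
def chooseNearer (sx sy qx qy cq res : ℕ) : Cmd :=
  let below := NExp.sub (.get arrBelow (.scalar arrCtr)) (.const 1)
  let above := NExp.sub (.get arrAbove (.scalar arrCtr)) (.const 1)
  .seq (.setNat arrCtr (.const 0) (.const 0)) <|
  .while (.natLt (.scalar arrCtr) (.get 0 (.const cq))) <|
    .seq (.ite (.natLt (.const 0) (.get arrBelow (.scalar arrCtr)))
      (.ite (.and (.natLt (.const 0) (.get arrAbove (.scalar arrCtr)))
          (.realLt (distExp sx sy qx qy above (.scalar arrCtr))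
            (distExp sx sy qx qy below (.scalar arrCtr))))
        (.setNat res (.scalar arrCtr) above) (.setNat res (.scalar arrCtr) below))
      (.setNat res (.scalar arrCtr) above)) <|
    .setNat arrCtr (.const 0) (.add (.scalar arrCtr) (.const 1))

/-- `p` is a site nearest to `(x, t)`. -/
def IsNearestSite (X Y : ℕ → ℝ) (m : ℕ) (x t : ℝ) (p : ℕ) : Prop :=
  p < m ∧ ∀ p' < m, sqDist X Y p x t ≤ sqDist X Y p' x t

section Combine
variable {X Y Y' : ℕ → ℝ} {m w w' : ℕ} {x t : ℝ}

theorem sqDist_neg {p : ℕ} (hY : Y' p = -Y p) : sqDist X Y' p x (-t) = sqDist X Y p x t := by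
  unfold sqDist
  rw [hY]
  ring

/-- A site found in the sweep with negated second coordinates is nearest among the sites that are
not below the query point. -/
theorem IsNearestBelow.above (hY : ∀ p < m, Y' p = -Y p) (h : IsNearestBelow X Y' m x (-t) w) :
    (w = 0 ∧ ∀ p < m, Y p < t) ∨ (0 < w ∧ w - 1 < m ∧ ∀ p < m, t ≤ Y p →
      sqDist X Y (w - 1) x t ≤ sqDist X Y p x t) := by
  rcases h with ⟨h1, h2⟩ | ⟨h1, h2, h3⟩
  · refine Or.inl ⟨h1, fun p hp => ?_⟩
    have := h2 p hp
    rw [hY p hp] at this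
    linarith
  · refine Or.inr ⟨h1, h2, fun p hp hle => ?_⟩
    have := h3 p hp (by rw [hY p hp]; linarith)
    rwa [sqDist_neg (hY _ h2), sqDist_neg (hY p hp)] at this

/-- The three cases of `chooseNearer`: the results `w` below and `w'` above are compared if both
exist, and one of them exists since there is a site. -/
theorem IsNearestBelow.combine (hm : 1 ≤ m) (hY : ∀ p < m, Y' p = -Y p)
    (h : IsNearestBelow X Y m x t w) (h' : IsNearestBelow X Y' m x (-t) w') :
    (0 < w → ¬ (0 < w' ∧ sqDist X Y (w' - 1) x t < sqDist X Y (w - 1) x t) →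
      IsNearestSite X Y m x t (w - 1)) ∧
    (0 < w → 0 < w' → sqDist X Y (w' - 1) x t < sqDist X Y (w - 1) x t →
      IsNearestSite X Y m x t (w' - 1)) ∧
    (¬ 0 < w → IsNearestSite X Y m x t (w' - 1)) := by
  have h'' := h'.above hY
  refine ⟨fun hw hn => ?_, fun hw hw' hlt => ?_, fun hw => ?_⟩
  · rcases h with h | ⟨-, h1, h2⟩
    · omega
    refine ⟨h1, fun p hp => ?_⟩
    rcases le_total (Y p) t with hpt | hpt
    · exact h2 p hp hpt
    · rcases h'' with ⟨-, h3⟩ | ⟨h3, h4, h5⟩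
      · exact absurd (h3 p hp) (not_lt.2 hpt)
      · exact (not_lt.1 fun hlt => hn ⟨h3, hlt⟩).trans (h5 p hp hpt)
  · rcases h with h | ⟨-, h1, h2⟩
    · omega
    rcases h'' with h'' | ⟨-, h4, h5⟩
    · omega
    refine ⟨h4, fun p hp => ?_⟩
    rcases le_total (Y p) t with hpt | hpt
    · exact hlt.le.trans (h2 p hp hpt)
    · exact h5 p hp hpt
  · rcases h with ⟨-, h⟩ | h
    · rcases h'' with ⟨-, h3⟩ | ⟨-, h4, h5⟩
      · exact absurd (h 0 (by omega)) (h3 0 (by omega)).asymm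
      · exact ⟨h4, fun p hp => h5 p hp (h p hp).le⟩
    · omega

theorem IsNearestBelow.le (h : IsNearestBelow X Y m x t w) : w ≤ m := by
  rcases h with h | h <;> omega

end Combine

theorem chooseNearer_spec {sx sy qx qy cq res m nq : ℕ} {X Y Y' QX QY : ℕ → ℝ} {s₀ : State}
    (hX : s₀.real sx = X) (hY : s₀.real sy = Y) (hQX : s₀.real qx = QX) (hQY : s₀.real qy = QY)
    (hcq : cq < W) (hres : 32 ≤ res) (hm1 : 1 ≤ m) (hnq : s₀.nat 0 cq = nq)
    (hW : 8 * (m + nq) + 8 < W) (hneg : ∀ p < m, Y' p = -Y p)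
    (hbelow : ∀ u < nq, IsNearestBelow X Y m (QX u) (QY u) (s₀.nat arrBelow u))
    (habove : ∀ u < nq, IsNearestBelow X Y' m (QX u) (-QY u) (s₀.nat arrAbove u)) :
    Ex W (chooseNearer sx sy qx qy cq res) s₀ fun t s' => t ≤ 200 * (nq + 1) ∧
      ∀ u < nq, IsNearestSite X Y m (QX u) (QY u) (s'.nat res u) := by
  obtain ⟨R, rfl⟩ := Nat.exists_eq_add_of_le' hres
  refine Ex.seq (Ex.of_wp (Q := fun s => s.nat arrCtr 0 = 0 ∧ s.real = s₀.real ∧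
    ∀ a, a ≠ arrCtr → s.nat a = s₀.nat a) ?_) ?_
  · simp
    exact ⟨by omega, fun a ha => funext fun i => by simp [ha]⟩
  rintro t₁ s₁ - ⟨ht₁, hi₁, hr₁, hn₁⟩
  refine (Ex.loop (γ := ℕ) (fun k s => s.nat arrCtr 0 = k ∧ k ≤ nq ∧
    ∀ u < k, IsNearestSite X Y m (QX u) (QY u) (s.nat (R + 32) u)) (fun k => (nq - k) * 190) 0
    ⟨hi₁, by omega, by simp⟩ ?_ ?_).mono ?_
  · rintro k s hf ⟨hs, hk, -⟩
    have h0 := hf.nat 0 (by simp)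
    simp [hs, h0, hn₁, hnq]
    omega
  · rintro k s hf ⟨hs, hk, hres⟩ hlt
    have h0 := hf.nat 0 (by simp)
    have hb : s.nat arrBelow = s₀.nat arrBelow := by
      rw [hf.nat arrBelow (by simp), hn₁ _ (by norm_num)]
    have ha : s.nat arrAbove = s₀.nat arrAbove := by
      rw [hf.nat arrAbove (by simp), hn₁ _ (by norm_num)]
    have hr : s.real = s₀.real := by
      funext a
      rw [hf.real a (by simp), hr₁]
    simp [hs, h0, hn₁, hnq] at hlt
    have hle := (hbelow k hlt).le
    have hle' := (habove k hlt).le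
    have hWs : 0 < W ∧ 1 < W ∧ k < W ∧ s₀.nat arrBelow k < W ∧ s₀.nat arrAbove k < W := by omega
    obtain ⟨c1, c2, c3⟩ := (hbelow k hlt).combine hm1 hneg (habove k hlt)
    refine Ex.seq (Ex.of_wp (Q := fun s' => s'.nat arrCtr 0 = k ∧
      IsNearestSite X Y m (QX k) (QY k) (s'.nat (R + 32) k) ∧
      ∀ u < k, s'.nat (R + 32) u = s.nat (R + 32) u) ?_) ?_
    · have hsq : ∀ p, (X p - QX k) * (X p - QX k) + (Y p - QY k) * (Y p - QY k) =
          sqDist X Y p (QX k) (QY k) := fun p => rfl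
      have hu : ∀ u < k, u ≠ k := fun u hu => hu.ne
      simp +contextual only [Cmd.wp, BExp.Ok, BExp.Holds, NExp.Ok, NExp.val, RExp.Ok, RExp.val,
        distExp, hs, hb, ha, hr, hX, hY, hQX, hQY, hsq, hWs, State.setNat_nat, and_true, true_and,
        and_self, if_true, if_false, implies_true, Nat.reduceEqDiff, false_and, hu, not_and]
      refine ⟨fun h1 => ⟨fun h2 => ?_, fun h2 => ?_⟩, fun h1 => ?_⟩
      · exact c2 h1 h2.1 h2.2
      · exact c1 h1 fun h3 => h2 h3.1 h3.2
      · exact c3 h1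
    rintro t₂ s₂ - ⟨ht₂, hs₂, hk₂, hu₂⟩
    refine (Ex.of_wp (Q := fun s' => s'.nat arrCtr 0 = k + 1 ∧
      s'.nat (R + 32) = s₂.nat (R + 32)) ?_).mono ?_
    · simp [hs₂]
      exact ⟨by omega, funext fun i => by simp⟩
    · rintro t s' - ⟨ht, hs', hR⟩
      refine ⟨k + 1, ⟨hs', hlt, fun u hu => ?_⟩, ?_⟩
      · rw [hR]
        rcases Nat.lt_succ_iff_lt_or_eq.1 hu with h | rfl
        · rw [hu₂ u h]; exact hres u h
        · exact hk₂
      · simp [distExp] at ht ht₂ ⊢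
        omega
  · rintro t s' hf ⟨k, ⟨hs, hk, hres⟩, hn, ht⟩
    have h0 := hf.nat 0 (by simp)
    simp [hs, h0, hn₁, hnq] at hn
    obtain rfl : k = nq := by omega
    refine ⟨?_, hres⟩
    simp at ht ht₁
    omega

/-- Write the number of a nearest site of every query point to word array `res`.  The real arrays
`sy'` and `qy'` are to hold the negatives of the second coordinates, so that a sweep upwards in
these coordinates is a sweep downwards. -/
def nearestSites (sx sy sy' qx qy qy' cs cq res : ℕ) : Cmd :=
  .seq (sweep sx sy qx qy cs cq arrBelow) <|
  .seq (sweep sx sy' qx qy' cs cq arrAbove) <|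
  chooseNearer sx sy qx qy cq res

theorem nearestSites_spec {sx sy sy' qx qy qy' cs cq res m nq : ℕ} {s₀ : State} (hsx : sx < 6)
    (hsy : sy < 6) (hsy' : sy' < 6) (hqx : qx < 6) (hqy : qy < 6) (hqy' : qy' < 6) (hcs : cs < W)
    (hcq : cq < W) (hres : 32 ≤ res) (hm : s₀.nat 0 cs = m) (hnq : s₀.nat 0 cq = nq) (hm1 : 1 ≤ m)
    (hnq1 : 1 ≤ nq) (hW : 8 * (m + nq) + 8 < W)
    (hneg : ∀ p < m, s₀.real sy' p = -s₀.real sy p)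
    (hneg' : ∀ u < nq, s₀.real qy' u = -s₀.real qy u) :
    Ex W (nearestSites sx sy sy' qx qy qy' cs cq res) s₀ fun t s' =>
      t ≤ 16400 * ((m + nq) * (Nat.log 2 (m + nq) + 2)) ∧
      ∀ u < nq, IsNearestSite (s₀.real sx) (s₀.real sy) m (s₀.real qx u) (s₀.real qy u)
        (s'.nat res u) := by
  refine Ex.seq (sweep_spec (m := m) (nq := nq) hsx hsy hqx hqy hcs hcq (by norm_num) hm hnq hm1
    hnq1 hW) ?_
  rintro t₁ s₁ hf₁ ⟨ht₁, h₁⟩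
  have hr₁ : ∀ a < 6, s₁.real a = s₀.real a := fun a ha => hf₁.real a (not_writesReal_sweep ha)
  have h0 : s₁.nat 0 = s₀.nat 0 := hf₁.nat 0 (not_writesNat_sweep (by simp) (by norm_num))
  refine Ex.seq (sweep_spec (m := m) (nq := nq) hsx hsy' hqx hqy' hcs hcq (by norm_num)
    (by rw [h0, hm]) (by rw [h0, hnq]) hm1 hnq1 hW) ?_
  rintro t₂ s₂ hf₂ ⟨ht₂, h₂⟩
  have hr₂ : ∀ a < 6, s₂.real a = s₀.real a := fun a ha => by
    rw [hf₂.real a (not_writesReal_sweep ha), hr₁ a ha]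
  have h0' : s₂.nat 0 = s₀.nat 0 := by
    rw [hf₂.nat 0 (not_writesNat_sweep (by simp) (by norm_num)), h0]
  have hb : s₂.nat arrBelow = s₁.nat arrBelow :=
    hf₂.nat _ (not_writesNat_sweep (by simp) (by norm_num))
  rw [hr₁ _ hsx, hr₁ _ hsy', hr₁ _ hqx, hr₁ _ hqy'] at h₂
  refine (chooseNearer_spec (m := m) (nq := nq) (hr₂ _ hsx) (hr₂ _ hsy) (hr₂ _ hqx) (hr₂ _ hqy) hcq
    hres hm1 (by rw [h0', hnq]) hW hneg (fun u hu => by rw [hb]; exact h₁ u hu)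
    (fun u hu => by rw [← hneg' u hu]; exact h₂ u hu)).mono ?_
  rintro t s' - ⟨ht, h⟩
  refine ⟨?_, h⟩
  have : (m + nq) * 2 ≤ (m + nq) * (Nat.log 2 (m + nq) + 2) := Nat.mul_le_mul le_rfl (by omega)
  omega

theorem not_writesNat_nearestSites {sx sy sy' qx qy qy' cs cq res a : ℕ}
    (ha : a = 0 ∨ 32 ≤ a) (ho : a ≠ res) :
    ¬ (nearestSites sx sy sy' qx qy qy' cs cq res).WritesNat a := by
  simp only [nearestSites, Cmd.WritesNat, not_or]
  refine ⟨not_writesNat_sweep (by omega) (by omega), not_writesNat_sweep (by omega) (by omega), ?_⟩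
  simp [chooseNearer, ho]
  omega

theorem not_writesReal_nearestSites {sx sy sy' qx qy qy' cs cq res a : ℕ} (ha : a < 6) :
    ¬ (nearestSites sx sy sy' qx qy qy' cs cq res).WritesReal a := by
  simp [nearestSites, not_writesReal_sweep ha, chooseNearer]

/-! ### The output -/

-- Word arrays with the nearest neighbors of the points of the first and of the second set.
notation "arrForth" => (32 : ℕ)
notation "arrBack" => (33 : ℕ)

/-- Write the negatives of the entries of real array `a` to real array `b`. -/
def negate (a b c : ℕ) : Cmd :=
  .seq (.setNat arrCtr (.const 0) (.const 0)) <|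
  .while (.natLt (.scalar arrCtr) (.get 0 (.const c))) <|
    .seq (.setReal b (.scalar arrCtr) (.sub (.const 0) (.get a (.scalar arrCtr)))) <|
    .setNat arrCtr (.const 0) (.add (.scalar arrCtr) (.const 1))

theorem negate_spec {a b c n : ℕ} {s₀ : State} (hc : s₀.nat 0 c = n) (hcW : c < W)
    (hW : n + 2 < W) (hab : a ≠ b) :
    Ex W (negate a b c) s₀ fun t s' => t ≤ 50 * (n + 1) ∧ ∀ i < n, s'.real b i = -s₀.real a i := by
  refine Ex.seq (Ex.of_wp (Q := fun s => s.nat arrCtr 0 = 0 ∧ s.real = s₀.real ∧ s.nat 0 c = n)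
    (by simp [hc]; omega)) ?_
  rintro t₁ s₁ - ⟨ht₁, hi₁, hr₁, hc₁⟩
  refine (Ex.loop (γ := ℕ) (fun k s => s.nat arrCtr 0 = k ∧ k ≤ n ∧
    ∀ i < k, s.real b i = -s₀.real a i) (fun k => (n - k) * 40) 0 ⟨hi₁, by omega, by simp⟩
    ?_ ?_).mono ?_
  · rintro k s hf ⟨hs, hk, -⟩
    have h0 := hf.nat 0 (by simp)
    simp [hs, h0, hc₁]
    omega
  · rintro k s hf ⟨hs, hk, hneg⟩ hlt
    have h0 := hf.nat 0 (by simp)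
    have hra : s.real a = s₀.real a := by rw [hf.real a (by simp [hab]), hr₁]
    simp [hs, h0, hc₁] at hlt
    refine (Ex.of_wp (Q := fun s' => s'.nat arrCtr 0 = k + 1 ∧
      ∀ i < k + 1, s'.real b i = -s₀.real a i) ?_).mono ?_
    · simp [hs, hra]
      refine ⟨by omega, by omega, fun i hi => ?_⟩
      split_ifs with h
      · rw [h]
      · exact hneg i (by omega)
    · rintro t s' - ⟨ht, hs', h'⟩
      refine ⟨k + 1, ⟨hs', hlt, h'⟩, ?_⟩
      simp at ht ⊢
      omega
  · rintro t s' hf ⟨k, ⟨hs, hk, hneg⟩, hn, ht⟩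
    have h0 := hf.nat 0 (by simp)
    simp [hs, h0, hc₁] at hn
    obtain rfl : k = n := by omega
    simp at ht ht₁
    exact ⟨by omega, hneg⟩

/-- List the pairs: first every point of the first set with its nearest neighbor, then every point
of the second set with its nearest neighbor unless this pair has been listed before. -/
def listPairs : Cmd :=
  .seq (.setNat arrCtr (.const 0) (.const 0)) <|
  .seq (.while (.natLt (.scalar arrCtr) (.get 0 (.const 0))) <|
    .seq (.setNat 1 (.scalar arrCtr) (.scalar arrCtr)) <|
    .seq (.setNat 2 (.scalar arrCtr) (.get arrForth (.scalar arrCtr))) <|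
    .setNat arrCtr (.const 0) (.add (.scalar arrCtr) (.const 1))) <|
  .seq (.seq (.setNat arrCur (.const 0) (.scalar arrCtr)) (.setNat arrCtr (.const 0) (.const 0))) <|
  .seq (.while (.natLt (.scalar arrCtr) (.get 0 (.const 1))) <|
    .seq (.ite (.and
        (.not (.natLt (.get arrForth (.get arrBack (.scalar arrCtr))) (.scalar arrCtr)))
        (.not (.natLt (.scalar arrCtr) (.get arrForth (.get arrBack (.scalar arrCtr)))))) .skip <|
      .seq (.setNat 1 (.scalar arrCur) (.get arrBack (.scalar arrCtr))) <|
      .seq (.setNat 2 (.scalar arrCur) (.scalar arrCtr)) <|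
      .setNat arrCur (.const 0) (.add (.scalar arrCur) (.const 1))) <|
    .setNat arrCtr (.const 0) (.add (.scalar arrCtr) (.const 1))) <|
  .setNat 0 (.const 0) (.scalar arrCur)

/-- Word arrays `1` and `2` contain the list of pairs `L`. -/
def Holds {a b : ℕ} (s : State) (L : List (Fin a × Fin b)) : Prop :=
  ∀ (k : ℕ) (e : Fin a × Fin b), L[k]? = some e → s.nat 1 k = e.1 ∧ s.nat 2 k = e.2

theorem Holds.append {a b : ℕ} {s s' : State} {L : List (Fin a × Fin b)} {e : Fin a × Fin b}
    (h : Holds s L) (h1 : s'.nat 1 L.length = e.1) (h2 : s'.nat 2 L.length = e.2)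
    (h3 : ∀ k < L.length, s'.nat 1 k = s.nat 1 k ∧ s'.nat 2 k = s.nat 2 k) :
    Holds s' (L ++ [e]) := by
  intro k e' he
  rcases lt_trichotomy k L.length with hk | rfl | hk
  · rw [List.getElem?_append_left hk] at he
    rw [(h3 k hk).1, (h3 k hk).2]
    exact h k e' he
  · simp at he
    subst he
    exact ⟨h1, h2⟩
  · have := (List.getElem?_eq_some_iff.1 he).1
    simp at this
    omega

theorem listPairs_spec {a b : ℕ} {F : Fin a → Fin b} {G : Fin b → Fin a} {s₀ : State}
    (ha : s₀.nat 0 0 = a) (hb : s₀.nat 0 1 = b) (hW : 8 * (a + b) + 8 < W)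
    (hF : ∀ i : Fin a, s₀.nat arrForth i = F i) (hG : ∀ j : Fin b, s₀.nat arrBack j = G j) :
    Ex W listPairs s₀ fun t s' => t ≤ 200 * (a + b + 1) ∧
      ∃ L : List (Fin a × Fin b), s'.nat 0 0 = L.length ∧ Holds s' L ∧ L.Nodup ∧
        ∀ e, e ∈ L ↔ e.2 = F e.1 ∨ e.1 = G e.2 := by
  refine Ex.seq (Ex.of_wp (Q := fun s => s.nat arrCtr 0 = 0 ∧
    ∀ c, c ≠ arrCtr → s.nat c = s₀.nat c) ?_) ?_
  · simp
    exact ⟨by omega, fun c hc => funext fun i => by simp [hc]⟩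
  rintro t₁ s₁ - ⟨ht₁, hi₁, hn₁⟩
  refine Ex.seq (Ex.loop (γ := ℕ) (fun k s => s.nat arrCtr 0 = k ∧ k ≤ a ∧
    ∃ L : List (Fin a × Fin b), L.length = k ∧ Holds s L ∧ L.Nodup ∧
      ∀ e, e ∈ L ↔ (e.1 : ℕ) < k ∧ e.2 = F e.1) (fun k => (a - k) * 40) 0
    ⟨hi₁, by omega, [], by simp [Holds]⟩ ?_ ?_) ?_
  · rintro k s hf ⟨hs, hk, -⟩
    have h0 := hf.nat 0 (by simp)
    simp [hs, h0, hn₁, ha]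
    omega
  · rintro k s hf ⟨hs, hk, L, hLk, hL, hnd, hmem⟩ hlt
    have h0 := hf.nat 0 (by simp)
    simp [hs, h0, hn₁, ha] at hlt
    have hFs : s.nat arrForth k = F ⟨k, hlt⟩ := by
      rw [hf.nat arrForth (by simp), hn₁ _ (by norm_num), ← hF]
    have hFlt := (F ⟨k, hlt⟩).2
    refine (Ex.of_wp (Q := fun s' => s'.nat arrCtr 0 = k + 1 ∧ s'.nat 1 k = k ∧
      s'.nat 2 k = F ⟨k, hlt⟩ ∧ ∀ i < k, s'.nat 1 i = s.nat 1 i ∧ s'.nat 2 i = s.nat 2 i)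
      ?_).mono ?_
    · have hne : ∀ i < k, i ≠ k := fun i hi => hi.ne
      simp +contextual [hs, hFs, hne]
      omega
    · rintro t s' - ⟨ht, hs', h1, h2, hsame⟩
      refine ⟨k + 1, ⟨hs', hlt, L ++ [(⟨k, hlt⟩, F ⟨k, hlt⟩)], by simp [hLk],
        hL.append (by rw [hLk, h1]) (by rw [hLk, h2]) (by rw [hLk]; exact hsame), ?_, ?_⟩, ?_⟩
      · rw [List.nodup_append]
        refine ⟨hnd, by simp, ?_⟩
        rintro e he e' he' rfl
        simp at he'
        have := ((hmem e).1 he).1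
        rw [he'] at this
        simp at this
      · rintro ⟨i, j⟩
        simp only [List.mem_append, hmem, List.mem_singleton, Prod.mk.injEq]
        constructor
        · rintro (⟨h, rfl⟩ | ⟨rfl, rfl⟩)
          · exact ⟨by omega, rfl⟩
          · exact ⟨by simp, rfl⟩
        · rintro ⟨h, rfl⟩
          rcases Nat.lt_succ_iff_lt_or_eq.1 h with h | h
          · exact Or.inl ⟨h, rfl⟩
          · obtain rfl : i = ⟨k, hlt⟩ := Fin.ext h
            exact Or.inr ⟨rfl, rfl⟩
      · simp at ht ⊢
        omega
  rintro t₂ s₂ hf₂ ⟨k, ⟨hs₂, hk, L₀, hL₀k, hL₀, hnd₀, hmem₀⟩, hn, ht₂⟩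
  have h02 : s₂.nat 0 = s₀.nat 0 := by rw [hf₂.nat 0 (by simp), hn₁ 0 (by norm_num)]
  have hF₂ : s₂.nat arrForth = s₀.nat arrForth := by
    rw [hf₂.nat _ (by simp), hn₁ _ (by norm_num)]
  have hG₂ : s₂.nat arrBack = s₀.nat arrBack := by
    rw [hf₂.nat _ (by simp), hn₁ _ (by norm_num)]
  obtain rfl : k = a := by simp [hs₂, h02, ha] at hn; omega
  refine Ex.seq (Ex.of_wp (Q := fun s => s.nat arrCtr 0 = 0 ∧ s.nat arrCur 0 = k ∧
    ∀ c, c ≠ arrCtr → c ≠ arrCur → s.nat c = s₂.nat c) ?_) ?_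
  · simp [hs₂]
    exact ⟨by omega, by omega, fun c hc hc' => funext fun i => by simp [hc, hc']⟩
  rintro t₃ s₃ - ⟨ht₃, hi₃, hc₃, hn₃⟩
  refine Ex.seq (Ex.loop (γ := ℕ) (fun j s => s.nat arrCtr 0 = j ∧ j ≤ b ∧
    ∃ L : List (Fin k × Fin b), s.nat arrCur 0 = L.length ∧ L.length ≤ k + j ∧ Holds s L ∧
      L.Nodup ∧ ∀ e, e ∈ L ↔ e.2 = F e.1 ∨ (e.2 : ℕ) < j ∧ e.1 = G e.2)
    (fun j => (b - j) * 80) 0 ⟨hi₃, by omega, L₀, by rw [hc₃, hL₀k], by omega, ?_, hnd₀, ?_⟩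
    ?_ ?_) ?_
  · intro i e he
    rw [hn₃ _ (by norm_num) (by norm_num), hn₃ _ (by norm_num) (by norm_num)]
    exact hL₀ i e he
  · rintro ⟨i, j⟩
    simp [hmem₀]
  · rintro j s hf ⟨hs, hj, -⟩
    have h0 := hf.nat 0 (by simp)
    simp [hs, h0, hn₃, h02, hb]
    omega
  · rintro j s hf ⟨hs, hj, L, hcur, hLle, hL, hnd, hmem⟩ hlt
    have h0 := hf.nat 0 (by simp)
    simp [hs, h0, hn₃, h02, hb] at hlt
    have hGs : s.nat arrBack j = G ⟨j, hlt⟩ := by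
      rw [hf.nat arrBack (by simp), hn₃ _ (by norm_num) (by norm_num), hG₂, ← hG]
    have hFs : s.nat arrForth (G ⟨j, hlt⟩) = F (G ⟨j, hlt⟩) := by
      rw [hf.nat arrForth (by simp), hn₃ _ (by norm_num) (by norm_num), hF₂, ← hF]
    have hFlt := (F (G ⟨j, hlt⟩)).2
    have hGlt := (G ⟨j, hlt⟩).2
    have hWs : 0 < W ∧ 1 < W ∧ j < W ∧ (G ⟨j, hlt⟩ : ℕ) < W ∧ (F (G ⟨j, hlt⟩) : ℕ) < W ∧
      L.length < W ∧ L.length + 1 < W := by omega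
    refine Ex.seq (Ex.of_wp (Q := fun s' => s'.nat arrCtr 0 = j ∧
      ∃ L : List (Fin k × Fin b), s'.nat arrCur 0 = L.length ∧ L.length ≤ k + (j + 1) ∧
      Holds s' L ∧ L.Nodup ∧ ∀ e, e ∈ L ↔ e.2 = F e.1 ∨ (e.2 : ℕ) < j + 1 ∧ e.1 = G e.2) ?_) ?_
    · simp only [Cmd.wp, BExp.Ok, BExp.Holds, NExp.Ok, NExp.val, State.setNat_nat, hs, hcur, hGs,
        hFs, hWs, Nat.reduceEqDiff, and_true, true_and, if_true, if_false, false_and]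
      refine ⟨fun h => ⟨L, rfl, by omega, hL, hnd, ?_⟩, fun h => ?_⟩
      · rintro ⟨i, j'⟩
        rw [hmem]
        constructor
        · rintro (h' | ⟨h1, h2⟩)
          · exact Or.inl h'
          · exact Or.inr ⟨by omega, h2⟩
        · rintro (h' | ⟨h1, h2⟩)
          · exact Or.inl h'
          · rcases Nat.lt_succ_iff_lt_or_eq.1 h1 with h1 | h1
            · exact Or.inr ⟨h1, h2⟩
            · obtain rfl : j' = ⟨j, hlt⟩ := Fin.ext h1
              dsimp only at h2
              subst h2
              exact Or.inl (Fin.ext (by simp only; omega))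
      · refine ⟨L ++ [(G ⟨j, hlt⟩, ⟨j, hlt⟩)], by simp, by simp; omega,
          hL.append (by simp) (by simp) (fun i hi => by simp [hi.ne]), ?_, ?_⟩
        · rw [List.nodup_append]
          refine ⟨hnd, by simp, ?_⟩
          rintro e he e' he' rfl
          simp at he'
          subst he'
          rcases (hmem _).1 he with h' | h'
          · have := congrArg Fin.val h'
            simp only at this
            omega
          · simp at h'
        · rintro ⟨i, j'⟩
          simp only [List.mem_append, hmem, List.mem_singleton, Prod.mk.injEq]
          constructor
          · rintro ((h' | ⟨h1, h2⟩) | ⟨rfl, rfl⟩)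
            · exact Or.inl h'
            · exact Or.inr ⟨by omega, h2⟩
            · exact Or.inr ⟨by simp, rfl⟩
          · rintro (h' | ⟨h1, h2⟩)
            · exact Or.inl (Or.inl h')
            · rcases Nat.lt_succ_iff_lt_or_eq.1 h1 with h1 | h1
              · exact Or.inl (Or.inr ⟨h1, h2⟩)
              · obtain rfl : j' = ⟨j, hlt⟩ := Fin.ext h1
                exact Or.inr ⟨h2, rfl⟩
    rintro t₄ s₄ - ⟨ht₄, hs₄, L', hcur', hL'le, hL', hnd', hmem'⟩
    refine (Ex.of_wp (Q := fun s' => s'.nat arrCtr 0 = j + 1 ∧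
      ∀ c ≠ arrCtr, s'.nat c = s₄.nat c) ?_).mono ?_
    · simp [hs₄]
      exact ⟨by omega, fun c hc => funext fun i => by simp [hc]⟩
    · rintro t s' - ⟨ht, hs', hsame⟩
      refine ⟨j + 1, ⟨hs', hlt, L', by rw [hsame _ (by norm_num), hcur'], hL'le,
        fun i e he => ?_, hnd', hmem'⟩, ?_⟩
      · rw [hsame _ (by norm_num), hsame _ (by norm_num)]
        exact hL' i e he
      · simp at ht ht₄ ⊢
        omega
  rintro t₄ s₄ hf₄ ⟨j, ⟨hs₄, hj, L, hcur, hLle, hL, hnd, hmem⟩, hn₄, ht₄⟩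
  have h04 : s₄.nat 0 = s₃.nat 0 := hf₄.nat 0 (by simp)
  obtain rfl : j = b := by simp [hs₄, h04, hn₃, h02, hb] at hn₄; omega
  refine (Ex.of_wp (Q := fun s' => s'.nat 0 0 = L.length ∧ ∀ c ≠ 0, s'.nat c = s₄.nat c) ?_).mono ?_
  · simp [hcur]
    exact ⟨by omega, fun c hc => funext fun i => by simp [hc]⟩
  · rintro t s' - ⟨ht, hs', hsame⟩
    refine ⟨?_, L, hs', fun i e he => ?_, hnd, fun e => ?_⟩
    · simp at ht ht₁ ht₂ ht₃ ht₄
      omega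
    · rw [hsame _ (by norm_num), hsame _ (by norm_num)]
      exact hL i e he
    · rw [hmem]
      simp

/-- The program.  It negates the second coordinates of both sets, into real arrays `4` and `5`, and
computes nearest neighbors of all points in the other set, by two sweeps in each direction,
and the list of pairs. -/
def nearestNeighborProgram : Program where
  main :=
    .seq (negate 1 4 0) <|
    .seq (negate 3 5 1) <|
    .seq (nearestSites 2 3 5 0 1 4 1 0 arrForth) <|
    .seq (nearestSites 0 1 4 2 3 5 0 1 arrBack) listPairs
  procs := []

theorem nearestNeighborProgram_spec {a b : ℕ} {s₀ : State} (ha : s₀.nat 0 0 = a)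
    (hb : s₀.nat 0 1 = b) (ha1 : 1 ≤ a) (hb1 : 1 ≤ b) (hW : 8 * (a + b) + 8 < W) :
    ∃ t s', nearestNeighborProgram.HaltsIn W s₀ t s' ∧
      t ≤ 34000 * ((a + b) * (Nat.log 2 (a + b) + 2)) ∧
      ∃ (F : Fin a → Fin b) (G : Fin b → Fin a),
        (∀ i : Fin a, IsNearestSite (s₀.real 2) (s₀.real 3) b (s₀.real 0 i) (s₀.real 1 i) (F i)) ∧
        (∀ j : Fin b, IsNearestSite (s₀.real 0) (s₀.real 1) a (s₀.real 2 j) (s₀.real 3 j) (G j)) ∧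
        ∃ L : List (Fin a × Fin b), s'.nat 0 0 = L.length ∧ Holds s' L ∧ L.Nodup ∧
          ∀ e, e ∈ L ↔ e.2 = F e.1 ∨ e.1 = G e.2 := by
  suffices H : Ex W nearestNeighborProgram.main s₀ fun t s' =>
      t ≤ 34000 * ((a + b) * (Nat.log 2 (a + b) + 2)) ∧
      ∃ (F : Fin a → Fin b) (G : Fin b → Fin a),
        (∀ i : Fin a, IsNearestSite (s₀.real 2) (s₀.real 3) b (s₀.real 0 i) (s₀.real 1 i) (F i)) ∧
        (∀ j : Fin b, IsNearestSite (s₀.real 0) (s₀.real 1) a (s₀.real 2 j) (s₀.real 3 j) (G j)) ∧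
        ∃ L : List (Fin a × Fin b), s'.nat 0 0 = L.length ∧ Holds s' L ∧ L.Nodup ∧
          ∀ e, e ∈ L ↔ e.2 = F e.1 ∨ e.1 = G e.2 from H
  refine Ex.seq (negate_spec (a := 1) (b := 4) (c := 0) (n := a) ha (by omega) (by omega)
    (by norm_num)) ?_
  rintro t₁ s₁ hf₁ ⟨ht₁, h₁⟩
  have hn₁ : s₁.nat 0 = s₀.nat 0 := hf₁.nat 0 (by simp [negate])
  have hr₁ : ∀ a, a ≠ 4 → s₁.real a = s₀.real a := fun a ha => hf₁.real a (by simp [negate, ha])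
  refine Ex.seq (negate_spec (a := 3) (b := 5) (c := 1) (n := b) (by rw [hn₁, hb]) (by omega)
    (by omega) (by norm_num)) ?_
  rintro t₂ s₂ hf₂ ⟨ht₂, h₂⟩
  have hn₂ : s₂.nat 0 = s₀.nat 0 := by rw [hf₂.nat 0 (by simp [negate]), hn₁]
  have hr₂ : ∀ a, a ≠ 4 → a ≠ 5 → s₂.real a = s₀.real a := fun a h4 h5 => by
    rw [hf₂.real a (by simp [negate, h5]), hr₁ a h4]
  have hneg : ∀ i < a, s₂.real 4 i = -s₂.real 1 i := fun i hi => by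
    rw [hf₂.real 4 (by simp [negate]), h₁ i hi, hr₂ 1 (by norm_num) (by norm_num)]
  have hneg' : ∀ i < b, s₂.real 5 i = -s₂.real 3 i := fun i hi => by
    rw [h₂ i hi, hr₂ 3 (by norm_num) (by norm_num), hr₁ 3 (by norm_num)]
  refine Ex.seq (nearestSites_spec (m := b) (nq := a) (by norm_num) (by norm_num) (by norm_num)
    (by norm_num) (by norm_num) (by norm_num) (by omega) (by omega) (by norm_num)
    (by rw [hn₂, hb]) (by rw [hn₂, ha]) hb1 ha1 (by omega) hneg' hneg) ?_
  rintro t₃ s₃ hf₃ ⟨ht₃, h₃⟩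
  have hn₃ : s₃.nat 0 = s₀.nat 0 := by
    rw [hf₃.nat 0 (not_writesNat_nearestSites (by simp) (by norm_num)), hn₂]
  have hr₃ : ∀ a < 6, s₃.real a = s₂.real a := fun a ha =>
    hf₃.real a (not_writesReal_nearestSites ha)
  refine Ex.seq (nearestSites_spec (m := a) (nq := b) (by norm_num) (by norm_num) (by norm_num)
    (by norm_num) (by norm_num) (by norm_num) (by omega) (by omega) (by norm_num)
    (by rw [hn₃, ha]) (by rw [hn₃, hb]) ha1 hb1 (by omega)
    (by simpa [hr₃] using hneg) (by simpa [hr₃] using hneg')) ?_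
  rintro t₄ s₄ hf₄ ⟨ht₄, h₄⟩
  have hn₄ : s₄.nat 0 = s₀.nat 0 := by
    rw [hf₄.nat 0 (not_writesNat_nearestSites (by simp) (by norm_num)), hn₃]
  have hforth : s₄.nat arrForth = s₃.nat arrForth :=
    hf₄.nat _ (not_writesNat_nearestSites (by norm_num) (by norm_num))
  simp only [hr₃, hr₂, Nat.reduceLT, ne_eq, Nat.reduceEqDiff, not_false_eq_true] at h₃ h₄
  refine (listPairs_spec (a := a) (b := b)
    (F := fun i => ⟨s₃.nat arrForth i, (h₃ i i.2).1⟩)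
    (G := fun j => ⟨s₄.nat arrBack j, (h₄ j j.2).1⟩) (by rw [hn₄, ha]) (by rw [hn₄, hb]) hW
    (fun i => by rw [hforth]) (fun j => rfl)).mono ?_
  rintro t s' - ⟨ht, hL⟩
  refine ⟨?_, fun i => ⟨s₃.nat arrForth i, (h₃ i i.2).1⟩,
    fun j => ⟨s₄.nat arrBack j, (h₄ j j.2).1⟩, fun i => h₃ i i.2, fun j => h₄ j j.2, hL⟩
  rw [Nat.add_comm b a] at ht₃
  have : (a + b) * 2 ≤ (a + b) * (Nat.log 2 (a + b) + 2) := Nat.mul_le_mul le_rfl (by omega)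
  omega

end RealRAM

/-! ### Nearest-neighbor pairings -/

theorem IsNearestNeighborPairing.isManyToManyMatching {S T : Finset Plane}
    {M : Finset (Plane × Plane)} (h : IsNearestNeighborPairing S T M) :
    IsManyToManyMatching S T M := by
  obtain ⟨f, g, hf, hg, hM⟩ := h
  refine ⟨?_, fun p hp => ⟨f p, (hM _ _).2 (Or.inl ⟨hp, rfl⟩)⟩,
    fun q hq => ⟨g q, (hM _ _).2 (Or.inr ⟨hq, rfl⟩)⟩⟩
  rintro ⟨u, v⟩ he
  rw [Finset.mem_product]
  rcases (hM u v).1 he with ⟨hu, rfl⟩ | ⟨hv, rfl⟩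
  · exact ⟨hu, (hf u hu).1⟩
  · exact ⟨(hg v hv).1, hv⟩

/-- In a set of pairs in which every point of `A` occurs as `π`, the points of `A` can be charged to
distinct pairs. -/
theorem sum_le_matchingCost {A : Finset Plane} {M : Finset (Plane × Plane)}
    {π : Plane × Plane → Plane} {d : Plane → ℝ} (hM : ∀ p ∈ A, ∃ e ∈ M, π e = p)
    (hd : ∀ e ∈ M, π e ∈ A → d (π e) ≤ dist e.1 e.2) : ∑ p ∈ A, d p ≤ matchingCost M := by
  choose! c hc hπ using hM
  have hinj : Set.InjOn c A := fun p hp q hq h => by rw [← hπ p hp, ← hπ q hq, h]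
  calc ∑ p ∈ A, d p ≤ ∑ p ∈ A, dist (c p).1 (c p).2 := Finset.sum_le_sum fun p hp => by
        have := hd (c p) (hc p hp)
        rw [hπ p hp] at this
        exact this hp
    _ = ∑ e ∈ A.image c, dist e.1 e.2 :=
        (Finset.sum_image (f := fun e : Plane × Plane => dist e.1 e.2) hinj).symm
    _ ≤ matchingCost M := Finset.sum_le_sum_of_subset_of_nonneg
        (Finset.image_subset_iff.2 hc) fun _ _ _ => dist_nonneg

theorem IsNearestNeighborPairing.matchingCost_le {S T : Finset Plane}
    {M M' : Finset (Plane × Plane)} (h : IsNearestNeighborPairing S T M)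
    (hM' : IsManyToManyMatching S T M') : matchingCost M ≤ 2 * matchingCost M' := by
  obtain ⟨f, g, hf, hg, hM⟩ := h
  obtain ⟨hsub, hS, hT⟩ := hM'
  have h1 : ∑ u ∈ S, dist u (f u) ≤ matchingCost M' :=
    sum_le_matchingCost (π := Prod.fst) (fun p hp => (hS p hp).imp' (fun q => (p, q))
      fun q hq => ⟨hq, rfl⟩) fun e he hp => (hf _ hp).2 _ (Finset.mem_product.1 (hsub he)).2
  have h2 : ∑ v ∈ T, dist v (g v) ≤ matchingCost M' :=
    sum_le_matchingCost (π := Prod.snd) (fun q hq => (hT q hq).imp' (fun p => (p, q))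
      fun p hp => ⟨hp, rfl⟩) fun e he hp => by
        rw [dist_comm e.1]
        exact (hg _ hp).2 _ (Finset.mem_product.1 (hsub he)).1
  have hMsub : M ⊆ S.image (fun u => (u, f u)) ∪ T.image (fun v => (g v, v)) := by
    rintro ⟨u, v⟩ he
    rw [Finset.mem_union, Finset.mem_image, Finset.mem_image]
    rcases (hM u v).1 he with ⟨hu, rfl⟩ | ⟨hv, rfl⟩
    · exact Or.inl ⟨u, hu, rfl⟩
    · exact Or.inr ⟨v, hv, rfl⟩
  calc matchingCost M
      ≤ ∑ e ∈ S.image (fun u => (u, f u)) ∪ T.image (fun v => (g v, v)), dist e.1 e.2 :=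
        Finset.sum_le_sum_of_subset_of_nonneg hMsub fun _ _ _ => dist_nonneg
    _ ≤ ∑ e ∈ S.image (fun u => (u, f u)), dist e.1 e.2 +
          ∑ e ∈ T.image (fun v => (g v, v)), dist e.1 e.2 := by
        rw [← Finset.sum_union_inter]
        exact le_add_of_nonneg_right (Finset.sum_nonneg fun _ _ => dist_nonneg)
    _ = ∑ u ∈ S, dist u (f u) + ∑ v ∈ T, dist v (g v) := by
        rw [Finset.sum_image fun _ _ _ _ h => (Prod.ext_iff.1 h).1,
          Finset.sum_image fun _ _ _ _ h => (Prod.ext_iff.1 h).2]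
        simp only [dist_comm]
    _ ≤ 2 * matchingCost M' := by linarith

theorem dist_le_of_sqDist_le {X Y : ℕ → ℝ} {p p' : ℕ} {u q q' : Plane} (h1 : X p = q 0)
    (h2 : Y p = q 1) (h1' : X p' = q' 0) (h2' : Y p' = q' 1)
    (h : RealRAM.sqDist X Y p (u 0) (u 1) ≤ RealRAM.sqDist X Y p' (u 0) (u 1)) :
    dist u q ≤ dist u q' := by
  rw [EuclideanSpace.dist_eq, EuclideanSpace.dist_eq]
  refine Real.sqrt_le_sqrt ?_
  simp only [RealRAM.sqDist, h1, h2, h1', h2'] at h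
  simp only [Fin.sum_univ_two, Real.dist_eq, sq_abs]
  linarith

theorem isNearest_of_isNearestSite {T : Finset Plane} {b : ℕ} {X Y : ℕ → ℝ} {u : Plane}
    (y : Fin b ≃ {p // p ∈ T}) (hX : ∀ j : Fin b, X j = (y j : Plane) 0)
    (hY : ∀ j : Fin b, Y j = (y j : Plane) 1) {j : Fin b}
    (h : RealRAM.IsNearestSite X Y b (u 0) (u 1) j) : IsNearest T u (y j) := by
  refine ⟨(y j).2, fun r hr => ?_⟩
  obtain ⟨j', hj'⟩ := y.surjective ⟨r, hr⟩
  have hr' : (y j' : Plane) = r := by rw [hj']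
  rw [← hr']
  exact dist_le_of_sqDist_le (hX j) (hY j) (hX j') (hY j') (h.2 j' j'.2)

theorem mainTheorem4 :
    (∀ (S T : Finset Plane) (M : Finset (Plane × Plane)), IsNearestNeighborPairing S T M →
      IsManyToManyMatching S T M ∧
      ∀ M' : Finset (Plane × Plane), IsManyToManyMatching S T M' →
        matchingCost M ≤ 2 * matchingCost M') ∧
    (∃ (P : RealRAM.Program) (w : ℕ) (C : ℝ),
      ∀ (S T : Finset Plane), S.Nonempty → T.Nonempty →
      ∀ (x : Fin S.card ≃ {p // p ∈ S}) (y : Fin T.card ≃ {p // p ∈ T}),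
      ∃ (t : ℕ) (s : RealRAM.State) (M : Finset (Plane × Plane)),
        P.HaltsIn ((S.card + T.card) ^ w)
          (RealRAM.input (fun i => (x i : Plane)) (fun j => (y j : Plane))) t s ∧
        (t : ℝ) ≤ C * (((S.card + T.card : ℕ) : ℝ) * Real.log ((S.card + T.card : ℕ) : ℝ)) ∧
        RealRAM.IsOutput (fun i => (x i : Plane)) (fun j => (y j : Plane)) s M ∧
        IsNearestNeighborPairing S T M) := by
  refine ⟨fun S T M h => ⟨h.isManyToManyMatching, fun M' hM' => h.matchingCost_le hM'⟩,
    RealRAM.nearestNeighborProgram, 6, 102000 / Real.log 2, fun S T hS hT x y => ?_⟩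
  have ha1 : 1 ≤ S.card := hS.card_pos
  have hb1 : 1 ≤ T.card := hT.card_pos
  set n := S.card + T.card with hn
  -- words below `8 * n + 8` suffice; `n ^ 6` exceeds this already for `n = 2`
  have hW : 8 * n + 8 < n ^ 6 := by
    have h2 : 2 ≤ n := by omega
    have h5 : 2 ^ 5 ≤ n ^ 5 := Nat.pow_le_pow_left h2 5
    have : n ^ 6 = n * n ^ 5 := by ring
    nlinarith
  obtain ⟨t, s, hhalt, ht, F, G, hF, hG, L, hlen, hL, hnd, hmem⟩ :=
    RealRAM.nearestNeighborProgram_spec (W := n ^ 6)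
      (s₀ := RealRAM.input (fun i => (x i : Plane)) (fun j => (y j : Plane)))
      (by simp [RealRAM.input]) (by simp [RealRAM.input]) ha1 hb1 hW
  simp only [RealRAM.input, if_true, OfNat.ofNat_ne_zero, OfNat.ofNat_ne_one, one_ne_zero,
    if_false, Nat.reduceEqDiff, Fin.is_lt, dite_true, Fin.eta] at hF hG
  have hinj : Function.Injective fun e : Fin S.card × Fin T.card =>
      ((x e.1 : Plane), (y e.2 : Plane)) := by
    rintro ⟨i, j⟩ ⟨i', j'⟩ h
    simp only [Prod.mk.injEq] at h
    rw [x.injective (Subtype.ext h.1), y.injective (Subtype.ext h.2)]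
  refine ⟨t, s, ⟨((L.map fun e => ((x e.1 : Plane), (y e.2 : Plane)) : List (Plane × Plane)) :
    Multiset (Plane × Plane)), hnd.map hinj⟩, hhalt, ?_, ⟨L, hlen, fun k hk =>
      hL k _ (List.getElem?_eq_getElem hk), rfl⟩, ?_⟩
  · have hlog : (Nat.log 2 n : ℝ) ≤ Real.log n / Real.log 2 := by
      have := Real.natLog_le_logb n 2
      simpa [Real.logb] using this
    have hlog2 : 0 < Real.log 2 := Real.log_pos (by norm_num)
    have hone : 1 ≤ Real.log n / Real.log 2 := by
      rw [le_div_iff₀ hlog2, one_mul]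
      exact Real.log_le_log (by norm_num) (by exact_mod_cast (by omega : 2 ≤ n))
    have h2 : (t : ℝ) ≤ 34000 * (n * (Nat.log 2 n + 2)) := by exact_mod_cast ht
    calc (t : ℝ) ≤ 34000 * (n * (Nat.log 2 n + 2)) := h2
      _ ≤ 34000 * (n * (3 * (Real.log n / Real.log 2))) := by gcongr; linarith
      _ = 102000 / Real.log 2 * (n * Real.log n) := by ring
  · have hx : ∀ (u : Plane) (hu : u ∈ S), (x (x.symm ⟨u, hu⟩) : Plane) = u := fun u hu => by simp
    have hy : ∀ (v : Plane) (hv : v ∈ T), (y (y.symm ⟨v, hv⟩) : Plane) = v := fun v hv => by simp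
    refine ⟨fun u => if hu : u ∈ S then y (F (x.symm ⟨u, hu⟩)) else 0,
      fun v => if hv : v ∈ T then x (G (y.symm ⟨v, hv⟩)) else 0, fun u hu => ?_, fun v hv => ?_,
      fun u v => ?_⟩
    · simp only [dif_pos hu]
      refine isNearest_of_isNearestSite y (fun j => ?_) (fun j => ?_) (hx u hu ▸ hF _) <;> simp
    · simp only [dif_pos hv]
      refine isNearest_of_isNearestSite x (fun j => ?_) (fun j => ?_) (hy v hv ▸ hG _) <;> simp
    · rw [← Finset.mem_val, Multiset.mem_coe, List.mem_map]
      constructor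
      · rintro ⟨⟨i, j⟩, he, h⟩
        simp only [Prod.mk.injEq] at h
        obtain ⟨rfl, rfl⟩ := h
        rcases (hmem _).1 he with h | h
        · left
          simp only at h
          simp [h]
        · right
          simp only at h
          simp [h]
      · rintro (⟨hu, rfl⟩ | ⟨hv, rfl⟩)
        · exact ⟨(x.symm ⟨u, hu⟩, F (x.symm ⟨u, hu⟩)), (hmem _).2 (Or.inl rfl), by simp [hu]⟩
        · exact ⟨(G (y.symm ⟨v, hv⟩), y.symm ⟨v, hv⟩), (hmem _).2 (Or.inr rfl), by simp [hv]⟩
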